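/- All Hilbert spaces are finite-dimensional, $|A|$ denotes the dimension of $A$, $\mathcal D(A)$ the set of density matrices on $A$, and $k\ge 1$ is an integer. A state $\rho^{AB}\in\mathcal D(A\otimes B)$ is $k$-extendible if there is an extension $\tilde\rho^{AB_1\cdots B_k}\in\mathcal D(A\otimes B^{\otimes k})$ with $\tilde\rho^{AB_j}=\rho^{AB}$ for all $j$. $\mathrm{Sep}(A:B)$ is the convex hull of the product states in $\mathcal D(A\otimes B)$. A measurement on $B$ is a finite family $(M_y)_y$ of positive semidefinite matrices on $B$ with $\sum_y M_y=I$, and is identified with the map $\Lambda(X)=\sum_y\mathrm{tr}(M_yX)|y\rangle\langle y|$. A quantum operation is a completely positive trace-preserving map. **Theorem.** 1. Let $\rho^{AB}$ be $k$-extendible and let $\mu$ be a probability distribution over quantum operations $\mathcal E_m:A\to\tilde A$. Then there is $\sigma\in\mathrm{Sep}(A:B)$ such that for all measurements $\Lambda$ on $B$ $$\mathop{\mathbb E}_{m\sim\mu}\big\|(\mathcal E_m\otimes\Lambda)(\rho^{AB}-\sigma^{AB})\big\|_1\le\sqrt{\frac{2\ln|\tilde A|}{k}}.$$ 2. There is a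 single program for a real-number random access machine (unit-cost field operations and comparisons of reals; natural-number expressions are charged for the binary lengths of their constants and of the registers they read) which, given $|A|$, $|B|$, $k$, a measurement $\Lambda$ on $B$ with $N$ outcomes and an extension $\tilde\rho^{AB_1\cdots B_k}$ of a state $\rho^{AB}$ as above, halts after at most $\mathrm{poly}(|A|,|B|^k,N^k)$ steps (hence $\mathrm{poly}(|A|,|B|^k)$ steps if $N\le\mathrm{poly}(|B|)$) and outputs the matrix of some $\sigma\in\mathrm{Sep}(A:B)$ such that, for all $\tilde A$ and all probability distributions $\mu$ over quantum operations $\mathcal E_m:A\to\tilde A$, $$\mathop{\mathbb E}_{m\sim\mu}\big\|(\mathcal E_m\otimes\Lambda)(\rho^{AB}-\sigma^{AB})\big\|_1\le\sqrt{\frac{2\ln|\tilde A|}{k}}.$$ 3. Let $X,Y,\mathcal A,\mathcal B$ be finite sets with $\mathcal B\neq\emptyset$, let $\mu$ be a probability distribution on $\mathcal A$, and let $p(x,y|a,b)$ be a $k$-extendible non-signaling conditional distribution. This means that $p$ is the marginal on the first party and any one $B$-party of a conditional distribution $p(x,y_1,\dots,y_k|a,b_1,\dots,b_k)$ that is invariant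 under simultaneous permutations of the $y_j$ and the $b_j$ and is non-signaling, i.e. for each of the $k+1$ parties the marginal on the outputs of all the other parties does not depend on that party's input. Then there is a local hidden variable distribution $q(x,y|a,b)=\sum_l\pi_l\,q_l(x|a)\,r_l(y|b)$ (a finite sum, with $\pi$ a probability distribution and $q_l,r_l$ conditional distributions) such that for all $b\in\mathcal B$ $$\mathop{\mathbb E}_{a\sim\mu}\sum_{x,y}\big|p(x,y|a,b)-q(x,y|a,b)\big|\le\sqrt{\frac{2\ln|X|}{k}}.$$ -/

import Mathlib

open scoped ComplexOrder Kronecker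

noncomputable section

namespace QDF

/-! Finite-dimensional quantum states. A system is given by a finite index type of an orthonormal
basis, so that its dimension is the cardinality of the type. -/

section Quantum

/-- Density matrices: positive semidefinite matrices of unit trace. -/
def IsState {A : Type*} [Fintype A] (ρ : Matrix A A ℂ) : Prop :=
  ρ.PosSemidef ∧ ρ.trace = 1

/-- The reduced matrix on `A B_j` of a matrix on `A ⊗ B_1 ⊗ ⋯ ⊗ B_k`: the partial trace over all
`B_i` with `i ≠ j`. -/
def reducedTo {A B : Type*} [Fintype B] [DecidableEq B] {k : ℕ}
    (R : Matrix (A × (Fin k → B)) (A × (Fin k → B)) ℂ) (j : Fin k) :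
    Matrix (A × B) (A × B) ℂ :=
  Matrix.of fun p q => ∑ f : Fin k → B,
    if f j = p.2 then R (p.1, f) (q.1, Function.update f j q.2) else 0

/-- `R` is a state on `A ⊗ B^{⊗ k}` extending `ρ`: all its `A B_j` marginals are equal to `ρ`. -/
def IsExtension {A B : Type*} [Fintype A] [Fintype B] [DecidableEq B] (k : ℕ)
    (ρ : Matrix (A × B) (A × B) ℂ)
    (R : Matrix (A × (Fin k → B)) (A × (Fin k → B)) ℂ) : Prop :=
  IsState R ∧ ∀ j : Fin k, reducedTo R j = ρ

/-- `k`-extendible states. -/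
def IsExtendible {A B : Type*} [Fintype A] [Fintype B] [DecidableEq B] (k : ℕ)
    (ρ : Matrix (A × B) (A × B) ℂ) : Prop :=
  IsState ρ ∧ ∃ R : Matrix (A × (Fin k → B)) (A × (Fin k → B)) ℂ, IsExtension k ρ R

/-- Separable states: the convex hull of the product states. -/
def SepStates (A B : Type*) [Fintype A] [Fintype B] : Set (Matrix (A × B) (A × B) ℂ) :=
  convexHull ℝ {τ | ∃ (α : Matrix A A ℂ) (β : Matrix B B ℂ),
    IsState α ∧ IsState β ∧ τ = α ⊗ₖ β}

/-- `(E ⊗ id_B) X`. -/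
def mapFst {A A' B : Type*} (E : Matrix A A ℂ →ₗ[ℂ] Matrix A' A' ℂ)
    (X : Matrix (A × B) (A × B) ℂ) : Matrix (A' × B) (A' × B) ℂ :=
  Matrix.of fun p q => E (Matrix.of fun i j => X (i, p.2) (j, q.2)) p.1 q.1

/-- `(id_A ⊗ L) X`. -/
def mapSnd {A B B' : Type*} (L : Matrix B B ℂ →ₗ[ℂ] Matrix B' B' ℂ)
    (X : Matrix (A × B) (A × B) ℂ) : Matrix (A × B') (A × B') ℂ :=
  Matrix.of fun p q => L (Matrix.of fun i j => X (p.1, i) (q.1, j)) p.2 q.2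

/-- `(E ⊗ L) X`. -/
def mapTensor {A A' B B' : Type*} (E : Matrix A A ℂ →ₗ[ℂ] Matrix A' A' ℂ)
    (L : Matrix B B ℂ →ₗ[ℂ] Matrix B' B' ℂ)
    (X : Matrix (A × B) (A × B) ℂ) : Matrix (A' × B') (A' × B') ℂ :=
  mapSnd L (mapFst E X)

/-- Quantum operations (channels): completely positive trace-preserving linear maps. -/
def IsChannel {A A' : Type*} [Fintype A] [Fintype A']
    (E : Matrix A A ℂ →ₗ[ℂ] Matrix A' A' ℂ) : Prop :=
  (∀ (n : ℕ) (X : Matrix (A × Fin n) (A × Fin n) ℂ), X.PosSemidef → (mapFst E X).PosSemidef) ∧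
    ∀ X : Matrix A A ℂ, (E X).trace = X.trace

/-- Measurements (POVMs) with outcome set `Y`. -/
def IsPOVM {B Y : Type*} [DecidableEq B] [Fintype Y] (M : Y → Matrix B B ℂ) : Prop :=
  (∀ y, (M y).PosSemidef) ∧ ∑ y, M y = 1

/-- The quantum-classical map `Λ(X) = ∑_y tr(M_y X) |y⟩⟨y|` of a measurement. -/
def measMap {B Y : Type*} [Fintype B] [DecidableEq Y] (M : Y → Matrix B B ℂ) :
    Matrix B B ℂ →ₗ[ℂ] Matrix Y Y ℂ where
  toFun X := Matrix.diagonal fun y => (M y * X).trace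
  map_add' X X' := by
    ext i j
    by_cases h : i = j
    · subst h
      simp [Matrix.mul_add]
    · simp [h]
  map_smul' c X := by
    ext i j
    by_cases h : i = j
    · subst h
      simp
    · simp [h]

/-- The trace norm `tr √(Xᴴ X)`, the sum of the singular values. -/
def traceNorm {A : Type*} [Fintype A] [DecidableEq A] (X : Matrix A A ℂ) : ℝ :=
  ∑ i, √((Matrix.isHermitian_conjTranspose_mul_self X).eigenvalues i)

end Quantum

/-! Conditional probability distributions. -/

section Boxes

/-- `p o i` is the probability `p(o | i)` of the output `o` given the input `i`. -/
def IsCondDist {O I : Type*} [Fintype O] (p : O → I → ℝ) : Prop :=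
  (∀ o i, 0 ≤ p o i) ∧ ∀ i, ∑ o, p o i = 1

/-- `P(x, y_1, …, y_k | a, b_1, …, b_k)` is non-signaling: the marginal on the outputs of all
parties but one does not depend on the input of that party. -/
def IsNonSignaling {X Y A B : Type*} [Fintype X] [Fintype Y] {k : ℕ}
    (P : X × (Fin k → Y) → A × (Fin k → B) → ℝ) : Prop :=
  (∀ y a a' b, ∑ x, P (x, y) (a, b) = ∑ x, P (x, y) (a', b)) ∧
  ∀ (j : Fin k) (x : X) (y : Fin k → Y) (a : A) (b b' : Fin k → B), (∀ i, i ≠ j → b i = b' i) →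
    ∑ z, P (x, Function.update y j z) (a, b) = ∑ z, P (x, Function.update y j z) (a, b')

/-- `k`-extendible non-signaling conditional distributions `p(x, y | a, b)`. -/
def IsNSExtendible {X Y A B : Type*} [Fintype X] [Fintype Y] [DecidableEq Y] (k : ℕ)
    (p : X × Y → A × B → ℝ) : Prop :=
  IsCondDist p ∧ ∃ P : X × (Fin k → Y) → A × (Fin k → B) → ℝ,
    IsCondDist P ∧ IsNonSignaling P ∧
    (∀ (π : Equiv.Perm (Fin k)) x y a b, P (x, y ∘ π) (a, b ∘ π) = P (x, y) (a, b)) ∧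
    ∀ (j : Fin k) x y a (b : Fin k → B),
      ∑ y' : Fin k → Y, (if y' j = y then P (x, y') (a, b) else 0) = p (x, y) (a, b j)

/-- Local hidden variable distributions. -/
def IsLHV {X Y A B : Type*} [Fintype X] [Fintype Y] (p : X × Y → A × B → ℝ) : Prop :=
  ∃ (l : ℕ) (w : Fin l → ℝ) (q : Fin l → X → A → ℝ) (r : Fin l → Y → B → ℝ),
    (∀ i, 0 ≤ w i) ∧ ∑ i, w i = 1 ∧ (∀ i, IsCondDist (q i)) ∧ (∀ i, IsCondDist (r i)) ∧
    ∀ x y a b, p (x, y) (a, b) = ∑ i, w i * q i x a * r i y b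

end Boxes

/-! A real-number random access machine, given by a programming language with a step-counting
semantics. There are registers for natural numbers, and arrays of real numbers whose cells are
addressed by natural numbers. An arithmetic operation or comparison of reals costs one step; the
cost of an expression over the natural numbers includes the binary lengths of its constants and
of the registers that it reads. Programs can use no real constants but natural numbers, and there
is no rounding of reals to integers. -/

section Machine

/-- Machine states: `reg i` is register `i`, and `arr v i` is cell `i` of the array `v`. -/
structure MState where
  reg : ℕ → ℕ
  arr : ℕ → ℕ → ℝ

/-- Natural number expressions; subtraction is truncated, and division rounds down. -/
inductive NExp where
  | lit (n : ℕ)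
  | reg (i : ℕ)
  | add (e f : NExp)
  | sub (e f : NExp)
  | mul (e f : NExp)
  | div (e f : NExp)
  | mod (e f : NExp)

def NExp.eval (s : MState) : NExp → ℕ
  | lit n => n
  | reg i => s.reg i
  | add e f => e.eval s + f.eval s
  | sub e f => e.eval s - f.eval s
  | mul e f => e.eval s * f.eval s
  | div e f => e.eval s / f.eval s
  | mod e f => e.eval s % f.eval s

def NExp.cost (s : MState) : NExp → ℕ
  | lit n => 1 + n.size
  | reg i => 1 + (s.reg i).size
  | add e f => e.cost s + f.cost s + 1
  | sub e f => e.cost s + f.cost s + 1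
  | mul e f => e.cost s + f.cost s + 1
  | div e f => e.cost s + f.cost s + 1
  | mod e f => e.cost s + f.cost s + 1

/-- Real expressions: natural numbers, cells of arrays, and the field operations (with
`x / 0 = 0`). -/
inductive RExp where
  | nat (e : NExp)
  | read (v : ℕ) (e : NExp)
  | add (e f : RExp)
  | sub (e f : RExp)
  | mul (e f : RExp)
  | div (e f : RExp)

def RExp.eval (s : MState) : RExp → ℝ
  | nat e => (e.eval s : ℝ)
  | read v e => s.arr v (e.eval s)
  | add e f => e.eval s + f.eval s
  | sub e f => e.eval s - f.eval s
  | mul e f => e.eval s * f.eval s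
  | div e f => e.eval s / f.eval s

def RExp.cost (s : MState) : RExp → ℕ
  | nat e => e.cost s + 1
  | read _ e => e.cost s + 1
  | add e f => e.cost s + f.cost s + 1
  | sub e f => e.cost s + f.cost s + 1
  | mul e f => e.cost s + f.cost s + 1
  | div e f => e.cost s + f.cost s + 1

/-- Tests: comparisons of two natural numbers or of two reals. -/
inductive Test where
  | ltN (e f : NExp)
  | ltR (e f : RExp)

def Test.Holds (s : MState) : Test → Prop
  | ltN e f => e.eval s < f.eval s
  | ltR e f => e.eval s < f.eval s

def Test.cost (s : MState) : Test → ℕ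
  | ltN e f => e.cost s + f.cost s + 1
  | ltR e f => e.cost s + f.cost s + 1

/-- Programs. `setReg i e` is `reg i := e`, and `setArr v e f` is `arr v e := f`. -/
inductive Prog where
  | skip
  | setReg (i : ℕ) (e : NExp)
  | setArr (v : ℕ) (e : NExp) (f : RExp)
  | seq (c d : Prog)
  | cond (t : Test) (c d : Prog)
  | loop (t : Test) (c : Prog)

/-- `Runs c s n s'`: the program `c`, started in the state `s`, halts after `n` steps in the
state `s'`. `loop t c` repeats `c` as long as `t` holds. -/
inductive Runs : Prog → MState → ℕ → MState → Prop where
  | skip (s : MState) : Runs .skip s 1 s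
  | setReg (i : ℕ) (e : NExp) (s : MState) :
      Runs (.setReg i e) s (e.cost s + 1) ⟨Function.update s.reg i (e.eval s), s.arr⟩
  | setArr (v : ℕ) (e : NExp) (f : RExp) (s : MState) :
      Runs (.setArr v e f) s (e.cost s + f.cost s + 1)
        ⟨s.reg, Function.update s.arr v (Function.update (s.arr v) (e.eval s) (f.eval s))⟩
  | seq {c d : Prog} {s s' s'' : MState} {m n : ℕ} :
      Runs c s m s' → Runs d s' n s'' → Runs (.seq c d) s (m + n) s''
  | cond_true {t : Test} {c d : Prog} {s s' : MState} {n : ℕ} :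
      t.Holds s → Runs c s n s' → Runs (.cond t c d) s (t.cost s + n) s'
  | cond_false {t : Test} {c d : Prog} {s s' : MState} {n : ℕ} :
      ¬ t.Holds s → Runs d s n s' → Runs (.cond t c d) s (t.cost s + n) s'
  | loop_true {t : Test} {c : Prog} {s s' s'' : MState} {m n : ℕ} :
      t.Holds s → Runs c s m s' → Runs (.loop t c) s' n s'' →
        Runs (.loop t c) s (t.cost s + m + n) s''
  | loop_false {t : Test} {c : Prog} {s : MState} :
      ¬ t.Holds s → Runs (.loop t c) s (t.cost s) s

/-- The position of the basis vector `|i⟩|f_1⟩⋯|f_k⟩` of `A ⊗ B^{⊗ k}`. -/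
def position {a b k : ℕ} (p : Fin a × (Fin k → Fin b)) : ℕ :=
  p.1 * b ^ k + ∑ j : Fin k, (p.2 j : ℕ) * b ^ (j : ℕ)

/-- The input format. Registers 0 to 3 hold the dimensions `a` and `b`, the number `k` and the
number `n` of outcomes; arrays 0 and 1 hold the real and imaginary parts of the entries of the
matrix `R`, row by row, and arrays 2 and 3 those of the measurement operators `M`. Nothing is
assumed about the rest of the memory. -/
def IsInput {a b k n : ℕ}
    (R : Matrix (Fin a × (Fin k → Fin b)) (Fin a × (Fin k → Fin b)) ℂ)
    (M : Fin n → Matrix (Fin b) (Fin b) ℂ) (s : MState) : Prop :=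
  s.reg 0 = a ∧ s.reg 1 = b ∧ s.reg 2 = k ∧ s.reg 3 = n ∧
  (∀ p q, s.arr 0 (position p * (a * b ^ k) + position q) = (R p q).re ∧
    s.arr 1 (position p * (a * b ^ k) + position q) = (R p q).im) ∧
  ∀ (y : Fin n) (i j : Fin b),
    s.arr 2 (((y : ℕ) * b + i) * b + j) = (M y i j).re ∧
    s.arr 3 (((y : ℕ) * b + i) * b + j) = (M y i j).im

/-- The output format: arrays 4 and 5 hold the real and imaginary parts of the entries of the
matrix `σ`, row by row. -/
def IsOutput {a b : ℕ} (σ : Matrix (Fin a × Fin b) (Fin a × Fin b) ℂ) (s : MState) : Prop :=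
  ∀ p q : Fin a × Fin b,
    s.arr 4 (((p.1 : ℕ) * b + p.2) * (a * b) + ((q.1 : ℕ) * b + q.2)) = (σ p q).re ∧
    s.arr 5 (((p.1 : ℕ) * b + p.2) * (a * b) + ((q.1 : ℕ) * b + q.2)) = (σ p q).im

end Machine

end QDF

end

/-! Measuring some of the systems `B_i` destroys the correlations of `A` with the others. Suppose
that effects have been observed on the first `j` systems. Replacing each conditional state of `A`
and the next system by the product of its marginals, and averaging over the outcomes, gives a
separable state. A measurement `M` of the next system can tell this state from `ρ` only if its
outcome carries information about `E(A)`, that is, if performing it lowers the average entropy of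
the conditional states of `E(A)`. Pinsker's inequality and Cauchy–Schwarz make this quantitative:
the squared error is at most twice the drop in entropy (`sq_sum_traceNorm_le`,
`IsInstrument.sq_traceNorm_le`). The average entropy lies between `0` and `log |A'|`, so the drops
over `k` successive systems add up to at most `log |A'|`. Entropies are weighted by traces
(`weightedNegEntropy`), so that conditional states need not be normalised.

For a fixed measurement the average of the `k` separable states does the job (`averageState_spec`):
the drops telescope, and convexity of the square gives the root.

One state for all measurements is obtained without a minimax theorem
(`exists_sepState_forall_measurement`). If every separable state were refuted by some measurement,
the current separable candidate could be refuted, the refuting measurement performed on the next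
system, and so on. Each of the `k` rounds would lower the entropy, averaged over the channels, by
more than `log |A'| / k`, which is impossible.

For conditional distributions the same argument runs with diagonal matrices, the adversary choosing
an input in each round (`exists_isLHV_of_isNSExtendible`). Non-signaling makes the weights of the
hidden variable independent of all inputs still to be chosen.

For the algorithm, the entries of `averageState` are explicit rational expressions in the data,
evaluated by nested counting loops. The time bound `Prog.timeBound` is read off the syntax and is
always polynomial (`Prog.exists_poly`). It is valid as soon as all register values and iteration
counts are at most `L`, so the correctness proof only has to control values. -/

noncomputable section

namespace QDF

open Matrix
open scoped Matrix.Norms.L2Operator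

/-! ### The trace norm as a maximum over contractions -/

section TraceNorm

variable {n : Type*} [Fintype n] [DecidableEq n]

lemma exists_spectral {X : Matrix n n ℂ} (hX : X.IsHermitian) :
    ∃ V : Matrix n n ℂ, Vᴴ * V = 1 ∧ V * Vᴴ = 1 ∧
      X = V * diagonal (fun i => (hX.eigenvalues i : ℂ)) * Vᴴ := by
  refine ⟨hX.eigenvectorUnitary, ?_, ?_, ?_⟩
  · rw [← star_eq_conjTranspose]; exact Unitary.coe_star_mul_self _
  · rw [← star_eq_conjTranspose]; exact Unitary.coe_mul_star_self _
  · conv_lhs => rw [hX.spectral_theorem, Unitary.conjStarAlgAut_apply]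
    rfl

lemma norm_le_one_of_isometry {m : Type*} [Fintype m] [DecidableEq m]
    {V : Matrix m n ℂ} (h : Vᴴ * V = 1) : ‖V‖ ≤ 1 := by
  have h1 := l2_opNorm_conjTranspose_mul_self V
  rw [h, ← diagonal_one, l2_opNorm_diagonal] at h1
  have h2 : ‖(fun _ : n => (1 : ℂ))‖ ≤ 1 := by
    rw [pi_norm_le_iff_of_nonneg zero_le_one]; simp
  nlinarith [norm_nonneg V]

lemma norm_mul_le_one {l m : Type*} [Fintype l] [DecidableEq l] [Fintype m] [DecidableEq m]
    {U : Matrix l m ℂ} {V : Matrix m n ℂ}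
    (hU : ‖U‖ ≤ 1) (hV : ‖V‖ ≤ 1) : ‖U * V‖ ≤ 1 :=
  (l2_opNorm_mul U V).trans (mul_le_one₀ hU (norm_nonneg _) hV)

lemma sum_normSq_col_le_one {U : Matrix n n ℂ} (hU : ‖U‖ ≤ 1) (j : n) :
    ∑ i, ‖U i j‖ ^ 2 ≤ 1 := by
  have h := l2_opNorm_mulVec U (EuclideanSpace.single j 1)
  have h2 : ‖(EuclideanSpace.single j (1 : ℂ) : EuclideanSpace ℂ n)‖ = 1 := by simp
  rw [h2, mul_one] at h
  have h3 := h.trans hU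
  rw [EuclideanSpace.norm_eq, Real.sqrt_le_iff] at h3
  simpa using h3.2

lemma sum_normSq_row_le_one {U : Matrix n n ℂ} (hU : ‖U‖ ≤ 1) (i : n) :
    ∑ j, ‖U i j‖ ^ 2 ≤ 1 := by
  rw [← l2_opNorm_conjTranspose] at hU
  simpa using sum_normSq_col_le_one hU i

lemma norm_entry_le_one {U : Matrix n n ℂ} (hU : ‖U‖ ≤ 1) (i j : n) : ‖U i j‖ ≤ 1 := by
  have h := (Finset.single_le_sum (f := fun i => ‖U i j‖ ^ 2) (fun _ _ => by positivity)
    (Finset.mem_univ i)).trans (sum_normSq_col_le_one hU j)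
  exact (sq_le_one_iff₀ (norm_nonneg _)).mp h

/-- Every contraction bounds the trace norm from below. -/
lemma re_trace_mul_le_traceNorm {U : Matrix n n ℂ} (hU : ‖U‖ ≤ 1) (X : Matrix n n ℂ) :
    (U * X).trace.re ≤ traceNorm X := by
  obtain ⟨V, hV1, hV2, hX⟩ := exists_spectral (isHermitian_conjTranspose_mul_self X)
  set d := (isHermitian_conjTranspose_mul_self X).eigenvalues with hd
  -- The columns of `X * V` have squared lengths `d i`. Each diagonal entry of the trace thus pairs
  -- a row of length at most one with a column of length `√(d i)`.
  have hY : (X * V)ᴴ * (X * V) = diagonal (fun i => (d i : ℂ)) := by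
    calc (X * V)ᴴ * (X * V) = Vᴴ * (Xᴴ * X) * V := by
          rw [conjTranspose_mul]; simp only [Matrix.mul_assoc]
      _ = (Vᴴ * V) * diagonal (fun i => (d i : ℂ)) * (Vᴴ * V) := by
          rw [hX]; simp only [Matrix.mul_assoc]
      _ = _ := by rw [hV1, Matrix.one_mul, Matrix.mul_one]
  have hcol : ∀ i, ∑ l, ‖(X * V) l i‖ ^ 2 = d i := by
    intro i
    have := congrFun (congrFun hY i) i
    rw [Matrix.mul_apply] at this
    simp only [conjTranspose_apply, diagonal_apply_eq] at this
    have h2 : ((∑ l, ‖(X * V) l i‖ ^ 2 : ℝ) : ℂ) = d i := by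
      rw [← this]; push_cast
      refine Finset.sum_congr rfl fun l _ => ?_
      rw [← Complex.conj_mul']; rfl
    exact_mod_cast h2
  have hG : ‖Vᴴ * U‖ ≤ 1 := norm_mul_le_one
    (by rw [l2_opNorm_conjTranspose]; exact norm_le_one_of_isometry hV1) hU
  have htr : (U * X).trace = ((Vᴴ * U) * (X * V)).trace := by
    calc (U * X).trace = (U * X * (V * Vᴴ)).trace := by rw [hV2, Matrix.mul_one]
      _ = (Vᴴ * (U * X * V)).trace := by rw [← Matrix.mul_assoc, Matrix.trace_mul_comm]
      _ = _ := by simp only [Matrix.mul_assoc]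
  rw [htr, Matrix.trace, Complex.re_sum]
  refine Finset.sum_le_sum fun i _ => ?_
  rw [diag_apply, Matrix.mul_apply]
  calc (∑ l, (Vᴴ * U) i l * (X * V) l i).re ≤ ‖∑ l, (Vᴴ * U) i l * (X * V) l i‖ :=
        Complex.re_le_norm _
    _ ≤ ∑ l, ‖(Vᴴ * U) i l‖ * ‖(X * V) l i‖ := by
        refine (norm_sum_le _ _).trans (le_of_eq ?_)
        simp
    _ ≤ √(d i) := by
        refine Real.le_sqrt_of_sq_le ?_
        refine (Finset.sum_mul_sq_le_sq_mul_sq _ _ _).trans ?_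
        rw [hcol]
        exact mul_le_of_le_one_left ((hcol i) ▸ by positivity) (sum_normSq_row_le_one hG i)

/-- The trace norm is attained at a contraction. -/
lemma exists_re_trace_mul_eq_traceNorm (X : Matrix n n ℂ) :
    ∃ U : Matrix n n ℂ, ‖U‖ ≤ 1 ∧ (U * X).trace.re = traceNorm X := by
  obtain ⟨V, hV1, hV2, hX⟩ := exists_spectral (isHermitian_conjTranspose_mul_self X)
  have hnn : ∀ i, 0 ≤ (isHermitian_conjTranspose_mul_self X).eigenvalues i :=
    (posSemidef_conjTranspose_mul_self X).eigenvalues_nonneg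
  unfold traceNorm
  set d := (isHermitian_conjTranspose_mul_self X).eigenvalues with hd
  -- The witness is `|X|⁻¹ Xᴴ`, the adjoint of the polar part. The convention `0⁻¹ = 0` turns the
  -- inverse into a pseudo-inverse, and the witness into a partial isometry.
  set s : n → ℂ := fun i => ((√(d i))⁻¹ : ℝ) with hs
  have hss : (diagonal s)ᴴ = diagonal s := by
    rw [diagonal_conjTranspose]; congr 1; ext i; simp [hs]
  have hVn : ‖V‖ ≤ 1 := norm_le_one_of_isometry hV1
  have hVn' : ‖Vᴴ‖ ≤ 1 := by rw [l2_opNorm_conjTranspose]; exact hVn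
  refine ⟨V * diagonal s * Vᴴ * Xᴴ, ?_, ?_⟩
  · have h1 : (V * diagonal s * Vᴴ * Xᴴ) * (V * diagonal s * Vᴴ * Xᴴ)ᴴ =
        V * diagonal (fun i => s i * d i * s i) * Vᴴ := by
      calc _ = V * diagonal s * Vᴴ * (Xᴴ * X) * (V * diagonal s * Vᴴ) := by
            simp only [conjTranspose_mul, conjTranspose_conjTranspose, hss, Matrix.mul_assoc]
        _ = V * diagonal s * (Vᴴ * V) * diagonal (fun i => (d i : ℂ)) * (Vᴴ * V) *
              diagonal s * Vᴴ := by
            rw [hX]; simp only [Matrix.mul_assoc]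
        _ = V * (diagonal s * diagonal (fun i => (d i : ℂ)) * diagonal s) * Vᴴ := by
            rw [hV1]; simp only [Matrix.mul_one, Matrix.mul_assoc]
        _ = _ := by rw [diagonal_mul_diagonal, diagonal_mul_diagonal]
    have h2 := l2_opNorm_conjTranspose_mul_self (V * diagonal s * Vᴴ * Xᴴ)ᴴ
    rw [conjTranspose_conjTranspose, h1, l2_opNorm_conjTranspose] at h2
    have h3 : ‖diagonal (fun i => s i * d i * s i)‖ ≤ 1 := by
      rw [l2_opNorm_diagonal, pi_norm_le_iff_of_nonneg zero_le_one]
      intro i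
      have : s i * d i * s i = (((√(d i))⁻¹ * √(d i)) ^ 2 : ℝ) := by
        rw [mul_pow, Real.sq_sqrt (hnn i), hs]; push_cast; ring
      rw [this, Complex.norm_real]
      by_cases h0 : √(d i) = 0
      · simp [h0]
      · simp [inv_mul_cancel₀ h0]
    have h4 : ‖V * diagonal (fun i => s i * d i * s i) * Vᴴ‖ ≤ 1 :=
      norm_mul_le_one (norm_mul_le_one hVn h3) hVn'
    nlinarith [norm_nonneg (V * diagonal s * Vᴴ * Xᴴ)]
  · have h1 : (V * diagonal s * Vᴴ * Xᴴ * X).trace = (diagonal (fun i => s i * d i)).trace := by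
      calc _ = (V * diagonal s * Vᴴ * (Xᴴ * X)).trace := by rw [Matrix.mul_assoc]
        _ = (V * (diagonal s * (Vᴴ * V) * diagonal (fun i => (d i : ℂ)) * Vᴴ)).trace := by
            rw [hX]; simp only [Matrix.mul_assoc]
        _ = (diagonal s * diagonal (fun i => (d i : ℂ)) * (Vᴴ * V)).trace := by
            rw [Matrix.trace_mul_comm, hV1, Matrix.mul_one, Matrix.mul_assoc, hV1]
        _ = _ := by rw [hV1, Matrix.mul_one, diagonal_mul_diagonal]
    rw [h1, trace_diagonal, Complex.re_sum]
    refine Finset.sum_congr rfl fun i _ => ?_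
    have : s i * d i = ((√(d i))⁻¹ * (√(d i) * √(d i)) : ℝ) := by
      rw [Real.mul_self_sqrt (hnn i), hs]; push_cast; ring
    rw [this, Complex.ofReal_re]
    by_cases h0 : √(d i) = 0
    · simp [h0]
    · rw [← mul_assoc, inv_mul_cancel₀ h0, one_mul]

lemma traceNorm_nonneg (X : Matrix n n ℂ) : 0 ≤ traceNorm X :=
  Finset.sum_nonneg fun _ _ => Real.sqrt_nonneg _

/-- A contraction that is optimal for the sum is admissible for both summands. -/
lemma traceNorm_add_le (X Y : Matrix n n ℂ) : traceNorm (X + Y) ≤ traceNorm X + traceNorm Y := by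
  obtain ⟨U, hU, h⟩ := exists_re_trace_mul_eq_traceNorm (X + Y)
  rw [← h, Matrix.mul_add, trace_add, Complex.add_re]
  exact add_le_add (re_trace_mul_le_traceNorm hU X) (re_trace_mul_le_traceNorm hU Y)

lemma traceNorm_zero : traceNorm (0 : Matrix n n ℂ) = 0 := by
  obtain ⟨U, hU, h⟩ := exists_re_trace_mul_eq_traceNorm (0 : Matrix n n ℂ)
  rw [← h]; simp

lemma traceNorm_neg (X : Matrix n n ℂ) : traceNorm (-X) = traceNorm X := by
  have key : ∀ Y : Matrix n n ℂ, traceNorm (-Y) ≤ traceNorm Y := by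
    intro Y
    obtain ⟨U, hU, h⟩ := exists_re_trace_mul_eq_traceNorm (-Y)
    rw [← h]
    have := re_trace_mul_le_traceNorm (U := -U) (by rwa [norm_neg]) Y
    simpa using this
  refine le_antisymm (key X) ?_
  simpa using key (-X)

lemma traceNorm_sum_le {ι : Type*} (s : Finset ι) (X : ι → Matrix n n ℂ) :
    traceNorm (∑ i ∈ s, X i) ≤ ∑ i ∈ s, traceNorm (X i) := by
  classical
  induction s using Finset.induction_on with
  | empty => simp [traceNorm_zero]
  | insert a s ha ih =>
    rw [Finset.sum_insert ha, Finset.sum_insert ha]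
    exact (traceNorm_add_le _ _).trans (by gcongr)

lemma traceNorm_smul_le {c : ℝ} (hc : 0 ≤ c) (X : Matrix n n ℂ) :
    traceNorm (c • X) ≤ c * traceNorm X := by
  obtain ⟨U, hU, h⟩ := exists_re_trace_mul_eq_traceNorm (c • X)
  rw [← h, Matrix.mul_smul, trace_smul, Complex.smul_re, smul_eq_mul]
  exact mul_le_mul_of_nonneg_left (re_trace_mul_le_traceNorm hU X) hc

lemma traceNorm_le_sum_norm (X : Matrix n n ℂ) : traceNorm X ≤ ∑ i, ∑ j, ‖X i j‖ := by
  obtain ⟨U, hU, h⟩ := exists_re_trace_mul_eq_traceNorm X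
  rw [← h, Matrix.trace_mul_comm, Matrix.trace, Complex.re_sum]
  refine Finset.sum_le_sum fun i _ => ?_
  rw [diag_apply, Matrix.mul_apply]
  refine (Complex.re_le_norm _).trans ((norm_sum_le _ _).trans ?_)
  refine Finset.sum_le_sum fun j _ => ?_
  rw [norm_mul]
  exact mul_le_of_le_one_right (norm_nonneg _) (norm_entry_le_one hU _ _)

lemma continuous_traceNorm_of_entries {Z : Type*} [TopologicalSpace Z] {F : Z → Matrix n n ℂ}
    (hF : ∀ i j, Continuous fun z => F z i j) : Continuous fun z => traceNorm (F z) := by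
  rw [continuous_iff_continuousAt]
  intro z
  have h0 : Filter.Tendsto (fun y => ∑ i, ∑ j, ‖F y i j - F z i j‖) (nhds z) (nhds 0) := by
    have : Continuous fun y => ∑ i, ∑ j, ‖F y i j - F z i j‖ :=
      continuous_finsetSum _ fun i _ => continuous_finsetSum _ fun j _ =>
        ((hF i j).sub continuous_const).norm
    simpa using this.tendsto z
  rw [ContinuousAt, tendsto_iff_norm_sub_tendsto_zero]
  refine squeeze_zero (fun _ => norm_nonneg _) (fun y => ?_) h0
  have hle : traceNorm (F y - F z) ≤ ∑ i, ∑ j, ‖F y i j - F z i j‖ := traceNorm_le_sum_norm _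
  have h1 := traceNorm_add_le (F y - F z) (F z)
  have h2 := traceNorm_add_le (-(F y - F z)) (F y)
  rw [traceNorm_neg] at h2
  rw [sub_add_cancel] at h1
  rw [show -(F y - F z) + F y = F z by abel] at h2
  rw [Real.norm_eq_abs, abs_le]
  constructor <;> linarith

/-- Random channels are measurable entry by entry; continuity of the trace norm makes the error a
measurable function. -/
lemma measurable_traceNorm_of_entries {Ω : Type*} [MeasurableSpace Ω] {F : Ω → Matrix n n ℂ}
    (hF : ∀ i j, Measurable fun z => F z i j) : Measurable fun z => traceNorm (F z) := by
  have hc : Continuous fun f : n → n → ℂ => traceNorm (Matrix.of f) :=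
    continuous_traceNorm_of_entries fun i j => 
      (continuous_apply j).comp (continuous_apply i)
  have hm : Measurable fun z => (fun i j => F z i j : n → n → ℂ) :=
    measurable_pi_lambda _ fun i => measurable_pi_lambda _ fun j => hF i j
  exact hc.measurable.comp hm

/-- The trace norm of a block diagonal matrix. -/
lemma traceNorm_block_le {m : Type*} [Fintype m] [DecidableEq m]
    (Z : Matrix (n × m) (n × m) ℂ) (X : m → Matrix n n ℂ)
    (hZ : ∀ p q, Z p q = if p.2 = q.2 then X p.2 p.1 q.1 else 0) :
    traceNorm Z ≤ ∑ y, traceNorm (X y) := by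
  obtain ⟨U, hU, h⟩ := exists_re_trace_mul_eq_traceNorm Z
  have h1 : (U * Z).trace = ∑ y, ((Matrix.of fun i j => U (i, y) (j, y)) * X y).trace := by
    simp only [Matrix.trace, diag_apply, Matrix.mul_apply, of_apply, Fintype.sum_prod_type, hZ]
    rw [Finset.sum_comm]
    refine Finset.sum_congr rfl fun y _ => Finset.sum_congr rfl fun i _ =>
      Finset.sum_congr rfl fun j _ => ?_
    simp
  rw [← h, h1, Complex.re_sum]
  refine Finset.sum_le_sum fun y _ => re_trace_mul_le_traceNorm ?_ _
  -- `J` embeds the block `y` isometrically, so the diagonal block `Jᴴ * U * J` of a contraction is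
  -- a contraction.
  let J : Matrix (n × m) n ℂ := Matrix.of fun p i => if p = (i, y) then 1 else 0
  have hJ : Jᴴ * J = 1 := by
    ext i j
    simp [J, Matrix.mul_apply, one_apply, Prod.ext_iff, Fintype.sum_prod_type, ite_and, eq_comm]
  have hJU : (Matrix.of fun i j => U (i, y) (j, y)) = Jᴴ * U * J := by
    ext i j
    simp [J, Matrix.mul_apply]
  rw [hJU]
  have hJn : ‖J‖ ≤ 1 := norm_le_one_of_isometry hJ
  exact norm_mul_le_one (norm_mul_le_one (by rw [l2_opNorm_conjTranspose]; exact hJn) hU) hJn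

/-- The signs of `d` form a diagonal contraction. This carries the matrix estimates over to
classical distributions. -/
lemma sum_abs_le_traceNorm_diagonal (d : n → ℝ) :
    ∑ i, |d i| ≤ traceNorm (diagonal fun i => (d i : ℂ)) := by
  have hU : ‖(diagonal fun i => ((SignType.sign (d i) : ℝ) : ℂ))‖ ≤ 1 := by
    rw [l2_opNorm_diagonal, pi_norm_le_iff_of_nonneg zero_le_one]
    intro i
    rw [Complex.norm_real]
    rcases lt_trichotomy (d i) 0 with h | h | h <;> simp [h]
  refine le_trans (le_of_eq ?_) (re_trace_mul_le_traceNorm hU _)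
  rw [diagonal_mul_diagonal, trace_diagonal, Complex.re_sum]
  refine Finset.sum_congr rfl fun i _ => ?_
  rw [← Complex.ofReal_mul, Complex.ofReal_re, sign_mul_self]

end TraceNorm

end QDF

end

noncomputable section

namespace QDF

open Matrix
open scoped Matrix.Norms.L2Operator

/-! ### Entropy, Pinsker's inequality and the gain from refining an ensemble -/

section Entropy

/-- Both sides vanish at `1`, and their difference has derivative `log x + x⁻¹ - 1 ≥ 0`. This gives
the sign of the derivative in `three_mul_sq_le`. -/
lemma two_mul_sub_le_add_one_mul_log {x : ℝ} (hx : 1 ≤ x) :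
    2 * (x - 1) ≤ (x + 1) * Real.log x := by
  have hm : MonotoneOn (fun x : ℝ => (x + 1) * Real.log x - 2 * (x - 1)) (Set.Ici 1) := by
    refine monotoneOn_of_hasDerivWithinAt_nonneg (convex_Ici 1)
      (f' := fun x => Real.log x + x⁻¹ - 1) ?_ ?_ ?_
    · refine ContinuousOn.sub (ContinuousOn.mul (by fun_prop)
        (Real.continuousOn_log.mono ?_)) (by fun_prop)
      intro y hy
      have : (1 : ℝ) ≤ y := hy
      simp only [Set.mem_compl_iff, Set.mem_singleton_iff]; linarith
    · intro y hy
      rw [interior_Ici] at hy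
      have hy0 : y ≠ 0 := by have : (1 : ℝ) < y := hy; linarith
      have h := (((hasDerivAt_id y).add_const 1).mul (Real.hasDerivAt_log hy0)).sub
        (((hasDerivAt_id y).sub_const 1).const_mul 2)
      refine (h.congr_deriv ?_).hasDerivWithinAt
      simp only [id]
      field_simp
      ring
    · intro y hy
      rw [interior_Ici] at hy
      have hy0 : 0 < y := by have : (1 : ℝ) < y := hy; linarith
      have := Real.one_sub_inv_le_log_of_pos hy0
      linarith
  have := hm (Set.mem_Ici.mpr le_rfl) (Set.mem_Ici.mpr hx) hx
  simp at this
  linarith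

/-- The previous inequality at `x⁻¹`, multiplied by `x`. -/
lemma add_one_mul_log_le_two_mul_sub {x : ℝ} (h0 : 0 < x) (hx : x ≤ 1) :
    (x + 1) * Real.log x ≤ 2 * (x - 1) := by
  have h := two_mul_sub_le_add_one_mul_log ((one_le_inv₀ h0).mpr hx)
  rw [Real.log_inv] at h
  have h2 := mul_le_mul_of_nonneg_left h h0.le
  have h3 : x * x⁻¹ = 1 := mul_inv_cancel₀ h0.ne'
  have e1 : x * (2 * (x⁻¹ - 1)) = 2 * (1 - x) := by linear_combination 2 * h3
  have e2 : x * ((x⁻¹ + 1) * -Real.log x) = -((x + 1) * Real.log x) := by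
    linear_combination (-Real.log x) * h3
  rw [e1, e2] at h2
  linarith

/-- The scalar inequality behind Pinsker's inequality. -/
lemma three_mul_sq_le {x : ℝ} (h0 : 0 < x) :
    3 * (x - 1) ^ 2 ≤ 2 * (x + 2) * (x * Real.log x - x + 1) := by
  -- `φ` vanishes at `1`, decreases before and increases after, by the two preceding lemmas.
  set φ : ℝ → ℝ := fun x => 2 * (x + 2) * (x * Real.log x - x + 1) - 3 * (x - 1) ^ 2 with hφ
  have hd : ∀ y : ℝ, y ≠ 0 →
      HasDerivAt φ (4 * ((y + 1) * Real.log y - 2 * (y - 1))) y := by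
    intro y hy
    have h1 := ((hasDerivAt_id y).add_const 2).const_mul 2
    have h2 := (((hasDerivAt_id y).mul (Real.hasDerivAt_log hy)).sub (hasDerivAt_id y)).add_const 1
    have h3 := (((hasDerivAt_id y).sub_const 1).pow 2).const_mul 3
    refine ((h1.mul h2).sub h3).congr_deriv ?_
    simp only [id, Pi.sub_apply, Pi.mul_apply]
    field_simp
    simp
    ring
  have h1 : φ 1 = 0 := by simp [hφ]
  suffices 0 ≤ φ x by simp only [hφ] at this; linarith
  rw [← h1]
  rcases le_total 1 x with hx | hx
  · have hm : MonotoneOn φ (Set.Ici 1) := by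
      refine monotoneOn_of_hasDerivWithinAt_nonneg (convex_Ici 1)
        (f' := fun y => 4 * ((y + 1) * Real.log y - 2 * (y - 1))) ?_ ?_ ?_
      · intro y hy
        have hy1 : (1 : ℝ) ≤ y := hy
        exact (hd y (by linarith)).continuousAt.continuousWithinAt
      · intro y hy
        rw [interior_Ici] at hy
        have hy1 : (1 : ℝ) < y := hy
        exact (hd y (by linarith)).hasDerivWithinAt
      · intro y hy
        rw [interior_Ici] at hy
        have hy1 : (1 : ℝ) < y := hy
        have := two_mul_sub_le_add_one_mul_log hy1.le
        linarith
    exact hm (Set.mem_Ici.mpr le_rfl) hx hx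
  · have hm : AntitoneOn φ (Set.Ioc 0 1) := by
      refine antitoneOn_of_hasDerivWithinAt_nonpos (convex_Ioc 0 1)
        (f' := fun y => 4 * ((y + 1) * Real.log y - 2 * (y - 1))) ?_ ?_ ?_
      · intro y hy
        exact (hd y hy.1.ne').continuousAt.continuousWithinAt
      · intro y hy
        rw [interior_Ioc] at hy
        exact (hd y hy.1.ne').hasDerivWithinAt
      · intro y hy
        rw [interior_Ioc] at hy
        have := add_one_mul_log_le_two_mul_sub hy.1 hy.2.le
        linarith
    exact hm ⟨h0, hx⟩ ⟨one_pos, le_rfl⟩ hx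

/-- The homogeneous form, with `x = l / m`. At `l = 0` it reads `3 m² ≤ 4 m²`. -/
lemma three_mul_sub_sq_le {l m : ℝ} (hl : 0 ≤ l) (hm : 0 < m) :
    3 * (l - m) ^ 2 ≤
      2 * (l + 2 * m) * (l * Real.log l - l * Real.log m - l + m) := by
  rcases hl.eq_or_lt with rfl | hl
  · simp; nlinarith
  · have h := three_mul_sq_le (div_pos hl hm)
    rw [Real.log_div hl.ne' hm.ne'] at h
    have h2 := mul_le_mul_of_nonneg_left h (sq_nonneg m)
    have e : l / m * m = l := div_mul_cancel₀ l hm.ne'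
    calc 3 * (l - m) ^ 2 = m ^ 2 * (3 * (l / m - 1) ^ 2) := by
          conv_lhs => rw [← e]
          ring
      _ ≤ _ := h2
      _ = 2 * (l / m * m + 2 * m) *
            ((l / m * m) * (Real.log l - Real.log m) - (l / m * m) + m) := by
          ring
      _ = _ := by rw [e]; ring

lemma klTerm_nonneg {l m : ℝ} (hl : 0 ≤ l) (hm : 0 < m) :
    0 ≤ l * Real.log l - l * Real.log m - l + m := by
  have h := three_mul_sub_sq_le hl hm
  by_contra hc
  push Not at hc
  have : 2 * (l + 2 * m) * (l * Real.log l - l * Real.log m - l + m) < 0 :=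
    mul_neg_of_pos_of_neg (by linarith) hc
  nlinarith [sq_nonneg (l - m)]

lemma PosSemidef.trace_re_nonneg {n : Type*} [Fintype n] {X : Matrix n n ℂ} (hX : X.PosSemidef) :
    0 ≤ X.trace.re :=
  (Complex.nonneg_iff.mp hX.trace_nonneg).1

lemma PosSemidef.trace_eq_re {n : Type*} [Fintype n] {X : Matrix n n ℂ} (hX : X.PosSemidef) :
    X.trace = (X.trace.re : ℂ) :=
  Complex.ext rfl (by simpa using (Complex.nonneg_iff.mp hX.trace_nonneg).2.symm)

lemma PosSemidef.eq_zero_of_trace_re {n : Type*} [Fintype n] {X : Matrix n n ℂ} (hX : X.PosSemidef)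
    (h : X.trace.re = 0) : X = 0 := by
  rw [← hX.trace_eq_zero_iff, PosSemidef.trace_eq_re hX, h, Complex.ofReal_zero]

variable {n : Type*} [Fintype n] [DecidableEq n]

/-- `tr X log X`, the negative of the von Neumann entropy. -/
def negEntropy (X : Matrix n n ℂ) : ℝ :=
  if h : X.IsHermitian then ∑ i, h.eigenvalues i * Real.log (h.eigenvalues i) else 0

/-- The negative entropy of an unnormalised state, weighted with its trace. -/
def weightedNegEntropy (X : Matrix n n ℂ) : ℝ :=
  negEntropy X - X.trace.re * Real.log X.trace.re

lemma sum_eigenvalues {X : Matrix n n ℂ} (hX : X.IsHermitian) :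
    ∑ i, hX.eigenvalues i = X.trace.re := by
  rw [hX.trace_eq_sum_eigenvalues, Complex.re_sum]; simp

lemma weightedNegEntropy_nonpos {X : Matrix n n ℂ} (hX : X.PosSemidef) :
    weightedNegEntropy X ≤ 0 := by
  rw [weightedNegEntropy, negEntropy, dif_pos hX.1, ← sum_eigenvalues hX.1, sub_nonpos,
    Finset.sum_mul]
  refine Finset.sum_le_sum fun i _ => ?_
  rcases (hX.eigenvalues_nonneg i).eq_or_lt with h | h
  · rw [← h]; simp
  · exact mul_le_mul_of_nonneg_left (Real.log_le_log h (Finset.single_le_sum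
      (fun i _ => hX.eigenvalues_nonneg i) (Finset.mem_univ i))) h.le

/-- Entropy is at most the logarithm of the dimension: the spectrum is compared with the uniform
one, term by term, by `1 - 1/x ≤ log x` at `x = l i * |n| / t`. -/
lemma neg_trace_mul_log_card_le_weightedNegEntropy {X : Matrix n n ℂ} (hX : X.PosSemidef) :
    -(X.trace.re * Real.log (Fintype.card n)) ≤ weightedNegEntropy X := by
  have hs := sum_eigenvalues hX.1
  rw [weightedNegEntropy, negEntropy, dif_pos hX.1]
  have hl := hX.eigenvalues_nonneg
  set l := hX.1.eigenvalues with hldef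
  set t := X.trace.re with ht
  rcases (PosSemidef.trace_re_nonneg hX).eq_or_lt with h0 | h0
  · rw [← ht] at h0
    rw [← h0, Finset.sum_eq_zero_iff_of_nonneg fun i _ => hl i] at hs
    have hz : ∑ i, l i * Real.log (l i) = 0 :=
      Finset.sum_eq_zero fun i hi => by rw [hs i hi, zero_mul]
    rw [hz, ← h0]; simp
  rw [← ht] at h0
  have hne : Nonempty n := by
    by_contra h
    rw [not_nonempty_iff] at h
    simp at hs
    linarith
  have hd : (0 : ℝ) < Fintype.card n := by exact_mod_cast Fintype.card_pos
  have key : ∀ i, l i - t * (Fintype.card n : ℝ)⁻¹ ≤ l i * Real.log (l i) +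
      l i * (Real.log (Fintype.card n) - Real.log t) := by
    intro i
    rcases (hl i).eq_or_lt with h | h
    · rw [← h]
      have : 0 ≤ t * (Fintype.card n : ℝ)⁻¹ := by positivity
      simp; positivity
    · have h1 := mul_le_mul_of_nonneg_left
        (Real.one_sub_inv_le_log_of_pos (mul_pos h (div_pos hd h0))) h.le
      rw [Real.log_mul h.ne' (div_pos hd h0).ne', Real.log_div hd.ne' h0.ne', mul_sub, mul_inv,
        ← mul_assoc, mul_inv_cancel₀ h.ne', one_mul, inv_div, div_eq_mul_inv] at h1
      linarith
  have h2 := Finset.sum_le_sum fun i (_ : i ∈ Finset.univ) => key i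
  rw [Finset.sum_add_distrib, ← Finset.sum_mul, Finset.sum_sub_distrib, hs] at h2
  simp only [Finset.sum_const, Finset.card_univ, nsmul_eq_mul] at h2
  have h3 : (Fintype.card n : ℝ) * (t * (Fintype.card n : ℝ)⁻¹) = t := by field_simp
  rw [h3] at h2
  linarith

lemma sum_normSq_col {U : Matrix n n ℂ} (hU : Uᴴ * U = 1) (j : n) :
    ∑ i, ‖U i j‖ ^ 2 = 1 := by
  have := congrFun (congrFun hU j) j
  rw [Matrix.mul_apply, one_apply_eq] at this
  have h2 : ((∑ i, ‖U i j‖ ^ 2 : ℝ) : ℂ) = 1 := by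
    rw [← this]; push_cast
    refine Finset.sum_congr rfl fun l _ => ?_
    rw [← Complex.conj_mul']; rfl
  exact_mod_cast h2

lemma sum_normSq_row {U : Matrix n n ℂ} (hU : U * Uᴴ = 1) (i : n) :
    ∑ j, ‖U i j‖ ^ 2 = 1 := by
  have := sum_normSq_col (U := Uᴴ) (by rw [conjTranspose_conjTranspose]; exact hU) i
  simpa using this

/-- Quantum Pinsker inequality for `X` and `Y = W diag(μ) Wᴴ` of equal trace. -/
lemma pinsker {X W : Matrix n n ℂ} {μ : n → ℝ} (hX : X.PosSemidef)
    (hW1 : Wᴴ * W = 1) (hW2 : W * Wᴴ = 1) (hμ : ∀ j, 0 ≤ μ j) (ht : ∑ j, μ j = X.trace.re)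
    (hker : ∀ j, μ j = 0 → ((Wᴴ * X * W) j j).re = 0) :
    0 ≤ negEntropy X - ∑ j, ((Wᴴ * X * W) j j).re * Real.log (μ j) ∧
    traceNorm (X - W * diagonal (fun j => (μ j : ℂ)) * Wᴴ) ^ 2 ≤
      X.trace.re * (2 * (negEntropy X - ∑ j, ((Wᴴ * X * W) j j).re * Real.log (μ j))) := by
  obtain ⟨V, hV1, hV2, hs⟩ := exists_spectral hX.1
  rw [negEntropy, dif_pos hX.1]
  have hl := hX.eigenvalues_nonneg
  have htr := sum_eigenvalues hX.1
  set l := hX.1.eigenvalues with hldef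
  -- The squares `‖K i j‖ ^ 2` of the overlaps of the two eigenbases form a doubly stochastic
  -- matrix. It expresses the relative entropy as a weighted sum of the scalar terms `D i j`.
  set K := Vᴴ * W with hK
  have hK1 : Kᴴ * K = 1 := by
    calc Kᴴ * K = Wᴴ * (V * Vᴴ) * W := by
          rw [hK, conjTranspose_mul, conjTranspose_conjTranspose]; simp only [Matrix.mul_assoc]
      _ = 1 := by rw [hV2, Matrix.mul_one, hW1]
  have hK2 : K * Kᴴ = 1 := mul_eq_one_comm.mp hK1
  have hdiag : ∀ j, ((Wᴴ * X * W) j j).re = ∑ i, ‖K i j‖ ^ 2 * l i := by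
    intro j
    have e : Wᴴ * X * W = Kᴴ * (diagonal (fun i => (l i : ℂ)) * K) := by
      conv_lhs => rw [hs]
      rw [hK, conjTranspose_mul, conjTranspose_conjTranspose]
      simp only [Matrix.mul_assoc]
    rw [e, Matrix.mul_apply, Complex.re_sum]
    refine Finset.sum_congr rfl fun i _ => ?_
    rw [diagonal_mul, conjTranspose_apply, mul_left_comm]
    have : star (K i j) * K i j = ((‖K i j‖ ^ 2 : ℝ) : ℂ) := by
      push_cast; rw [← Complex.conj_mul']; rfl
    rw [this, ← Complex.ofReal_mul, Complex.ofReal_re, mul_comm]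
  -- The support condition removes the pairs for which the true relative entropy would be infinite;
  -- `Real.log 0 = 0` would give a wrong value there.
  have hK0 : ∀ i j, μ j = 0 → l i ≠ 0 → K i j = 0 := by
    intro i j hj hi
    have h := hker j hj
    rw [hdiag, Finset.sum_eq_zero_iff_of_nonneg
      (fun i _ => mul_nonneg (sq_nonneg _) (hl i))] at h
    have := h i (Finset.mem_univ i)
    simpa [hi] using this
  set D : n → n → ℝ := fun i j => l i * Real.log (l i) - l i * Real.log (μ j) - l i + μ j with hD
  -- The terms `- l i + μ j` of `D i j` make each summand nonnegative and cancel in the sum because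
  -- the traces agree.
  have hsum : ∑ i, l i * Real.log (l i) - ∑ j, ((Wᴴ * X * W) j j).re * Real.log (μ j) =
      ∑ p : n × n, ‖K p.1 p.2‖ ^ 2 * D p.1 p.2 := by
    have e1 : ∑ i, l i * Real.log (l i) =
        ∑ i, ∑ j, ‖K i j‖ ^ 2 * (l i * Real.log (l i)) :=
      Finset.sum_congr rfl fun i _ => by rw [← Finset.sum_mul, sum_normSq_row hK2, one_mul]
    have e2 : ∑ j, ((Wᴴ * X * W) j j).re * Real.log (μ j) =
        ∑ i, ∑ j, ‖K i j‖ ^ 2 * (l i * Real.log (μ j)) := by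
      rw [Finset.sum_comm]
      refine Finset.sum_congr rfl fun j _ => ?_
      rw [hdiag, Finset.sum_mul]
      exact Finset.sum_congr rfl fun i _ => by ring
    have e3 : ∑ i, ∑ j, ‖K i j‖ ^ 2 * l i = X.trace.re := by
      rw [← htr]
      exact Finset.sum_congr rfl fun i _ => by rw [← Finset.sum_mul, sum_normSq_row hK2, one_mul]
    have e4 : ∑ i, ∑ j, ‖K i j‖ ^ 2 * μ j = X.trace.re := by
      rw [← ht, Finset.sum_comm]
      exact Finset.sum_congr rfl fun j _ => by rw [← Finset.sum_mul, sum_normSq_col hK1, one_mul]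
    rw [Fintype.sum_prod_type, e1, e2]
    have e5 : ∑ i, ∑ j, ‖K i j‖ ^ 2 * D i j =
        ∑ i, ∑ j, ‖K i j‖ ^ 2 * (l i * Real.log (l i)) -
        ∑ i, ∑ j, ‖K i j‖ ^ 2 * (l i * Real.log (μ j)) - ∑ i, ∑ j, ‖K i j‖ ^ 2 * l i +
        ∑ i, ∑ j, ‖K i j‖ ^ 2 * μ j := by
      simp only [← Finset.sum_sub_distrib, ← Finset.sum_add_distrib]
      exact Finset.sum_congr rfl fun i _ => Finset.sum_congr rfl fun j _ => by
        simp only [hD]; ring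
    rw [e5, e3, e4]; ring
  rw [hsum]
  have hDn : ∀ p : n × n, 0 ≤ ‖K p.1 p.2‖ ^ 2 * D p.1 p.2 := by
    rintro ⟨i, j⟩
    rcases (hμ j).eq_or_lt with h | h
    · by_cases hi : l i = 0
      · simp [hD, ← h, hi]
      · simp [hK0 i j h.symm hi]
    · exact mul_nonneg (sq_nonneg _) (klTerm_nonneg (hl i) h)
  refine ⟨Finset.sum_nonneg fun p _ => hDn p, ?_⟩
  obtain ⟨U, hU, hUt⟩ :=
    exists_re_trace_mul_eq_traceNorm (X - W * diagonal (fun j => (μ j : ℂ)) * Wᴴ)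
  -- In the two eigenbases the optimal pairing becomes the sum of `G j i * K i j * (l i - μ j)`,
  -- which reduces the noncommutative problem to scalars.
  set G := Wᴴ * U * V with hG
  have hGn : ‖G‖ ≤ 1 := norm_mul_le_one (norm_mul_le_one
    (by rw [l2_opNorm_conjTranspose]; exact norm_le_one_of_isometry hW1) hU)
    (norm_le_one_of_isometry hV1)
  have htrace : (U * (X - W * diagonal (fun j => (μ j : ℂ)) * Wᴴ)).trace =
      (G * (diagonal (fun i => (l i : ℂ)) * K - K * diagonal (fun j => (μ j : ℂ)))).trace := by
    have e : X - W * diagonal (fun j => (μ j : ℂ)) * Wᴴ =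
        V * (diagonal (fun i => (l i : ℂ)) * K - K * diagonal (fun j => (μ j : ℂ))) * Wᴴ := by
      have h1 : V * (diagonal (fun i => (l i : ℂ)) * K) * Wᴴ = X := by
        calc _ = V * diagonal (fun i => (l i : ℂ)) * Vᴴ * (W * Wᴴ) := by
              rw [hK]; simp only [Matrix.mul_assoc]
          _ = X := by rw [hW2, Matrix.mul_one, ← hs]
      have h2 : V * (K * diagonal (fun j => (μ j : ℂ))) * Wᴴ =
          W * diagonal (fun j => (μ j : ℂ)) * Wᴴ := by
        calc _ = (V * Vᴴ) * W * diagonal (fun j => (μ j : ℂ)) * Wᴴ := by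
              rw [hK]; simp only [Matrix.mul_assoc]
          _ = _ := by rw [hV2, Matrix.one_mul]
      rw [Matrix.mul_sub, Matrix.sub_mul, h1, h2]
    rw [e, ← Matrix.mul_assoc, Matrix.trace_mul_comm, hG]
    simp only [Matrix.mul_assoc]
  have hle : traceNorm (X - W * diagonal (fun j => (μ j : ℂ)) * Wᴴ) ≤
      ∑ p : n × n, ‖G p.2 p.1‖ * (‖K p.1 p.2‖ * |l p.1 - μ p.2|) := by
    rw [← hUt, htrace, Matrix.trace_mul_comm, Matrix.trace, Complex.re_sum, Fintype.sum_prod_type]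
    refine Finset.sum_le_sum fun i _ => ?_
    rw [diag_apply, Matrix.mul_apply]
    refine (Complex.re_le_norm _).trans ((norm_sum_le _ _).trans (le_of_eq ?_))
    refine Finset.sum_congr rfl fun j _ => ?_
    rw [Matrix.sub_apply, diagonal_mul, mul_diagonal, mul_comm (K i j), ← sub_mul, norm_mul,
      norm_mul, ← Complex.ofReal_sub, Complex.norm_real, Real.norm_eq_abs]
    ring
  have hw : ∑ p : n × n, ‖G p.2 p.1‖ ^ 2 * ((l p.1 + 2 * μ p.2) / 3) ≤ X.trace.re := by
    have e1 : ∑ i, ∑ j, ‖G j i‖ ^ 2 * l i ≤ X.trace.re := by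
      rw [← htr]
      refine Finset.sum_le_sum fun i _ => ?_
      rw [← Finset.sum_mul]
      exact mul_le_of_le_one_left (hl i) (sum_normSq_col_le_one hGn i)
    have e2 : ∑ i, ∑ j, ‖G j i‖ ^ 2 * μ j ≤ X.trace.re := by
      rw [← ht, Finset.sum_comm]
      refine Finset.sum_le_sum fun j _ => ?_
      rw [← Finset.sum_mul]
      exact mul_le_of_le_one_left (hμ j) (sum_normSq_row_le_one hGn j)
    have e3 : ∑ p : n × n, ‖G p.2 p.1‖ ^ 2 * ((l p.1 + 2 * μ p.2) / 3) =
        (∑ i, ∑ j, ‖G j i‖ ^ 2 * l i + 2 * ∑ i, ∑ j, ‖G j i‖ ^ 2 * μ j) / 3 := by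
      rw [Fintype.sum_prod_type, Finset.mul_sum, ← Finset.sum_add_distrib, Finset.sum_div]
      refine Finset.sum_congr rfl fun i _ => ?_
      rw [Finset.mul_sum, ← Finset.sum_add_distrib, Finset.sum_div]
      exact Finset.sum_congr rfl fun j _ => by ring
    rw [e3]; linarith
  -- Cauchy–Schwarz. The weight `(l + 2 μ) / 3` is the prefactor in the scalar inequality; by `hw`
  -- its total is at most the trace, because `G` is a contraction.
  have hcs : (∑ p : n × n, ‖G p.2 p.1‖ * (‖K p.1 p.2‖ * |l p.1 - μ p.2|)) ^ 2 ≤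
      (∑ p : n × n, ‖G p.2 p.1‖ ^ 2 * ((l p.1 + 2 * μ p.2) / 3)) *
      ∑ p : n × n, 2 * (‖K p.1 p.2‖ ^ 2 * D p.1 p.2) := by
    refine Finset.sum_sq_le_sum_mul_sum_of_sq_le_mul _ ?_ ?_ ?_
    · rintro ⟨i, j⟩ _
      have := hl i
      have := hμ j
      positivity
    · rintro p _
      have := hDn p
      positivity
    · rintro ⟨i, j⟩ _
      have hi := hl i
      simp only
      by_cases hKz : K i j = 0
      · simp [hKz]
      · rw [mul_pow, mul_pow, sq_abs]
        have key : 3 * (l i - μ j) ^ 2 ≤ 2 * (l i + 2 * μ j) * D i j := by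
          rcases (hμ j).eq_or_lt with h | h
          · have hi0 : l i = 0 := by
              by_contra hne
              exact hKz (hK0 i j h.symm hne)
            simp [hi0, ← h]
          · exact three_mul_sub_sq_le hi h
        have h2 := mul_le_mul_of_nonneg_left key
          (mul_nonneg (sq_nonneg ‖G j i‖) (sq_nonneg ‖K i j‖))
        nlinarith [h2]
  calc _ ≤ (∑ p : n × n, ‖G p.2 p.1‖ * (‖K p.1 p.2‖ * |l p.1 - μ p.2|)) ^ 2 :=
        pow_le_pow_left₀ (traceNorm_nonneg _) hle 2
    _ ≤ _ := hcs
    _ ≤ _ := by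
        rw [← Finset.mul_sum]
        refine mul_le_mul_of_nonneg_right hw (mul_nonneg zero_le_two ?_)
        exact Finset.sum_nonneg fun p _ => hDn p

/-- `D y` is the relative entropy between `ω y` and its proportional share of the total. The shares
are all diagonal in one eigenbasis of the total, so their logarithms split and the sum of the `D y`
is the Holevo quantity of the ensemble. -/
lemma exists_divergence {ι : Type*} [Fintype ι] {ω : ι → Matrix n n ℂ}
    (hω : ∀ y, (ω y).PosSemidef) :
    ∃ D : ι → ℝ, (∀ y, 0 ≤ D y ∧
      traceNorm (ω y - ((ω y).trace.re / (∑ z, ω z).trace.re) • ∑ z, ω z) ^ 2 ≤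
        (ω y).trace.re * (2 * D y)) ∧
      ∑ y, D y = ∑ y, weightedNegEntropy (ω y) - weightedNegEntropy (∑ y, ω y) := by
  have hΩ : (∑ z, ω z).PosSemidef := posSemidef_sum _ fun z _ => hω z
  set Ω := ∑ z, ω z with hΩdef
  obtain ⟨W, hW1, hW2, hs⟩ := exists_spectral hΩ.1
  have hμ := hΩ.eigenvalues_nonneg
  have htr := sum_eigenvalues hΩ.1
  have hent : negEntropy Ω = ∑ i, hΩ.1.eigenvalues i * Real.log (hΩ.1.eigenvalues i) := by
    rw [negEntropy, dif_pos hΩ.1]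
  set μ := hΩ.1.eigenvalues with hμdef
  set t : ι → ℝ := fun y => (ω y).trace.re with ht
  have htn : ∀ y, 0 ≤ t y := fun y => PosSemidef.trace_re_nonneg (hω y)
  set s := Ω.trace.re with hsdef
  have hst : ∑ y, t y = s := by rw [hsdef, hΩdef, trace_sum, Complex.re_sum]
  set x : ι → n → ℝ := fun y j => ((Wᴴ * ω y * W) j j).re with hx
  have hxn : ∀ y j, 0 ≤ x y j := fun y j =>
    (Complex.nonneg_iff.mp ((hω y).conjTranspose_mul_mul_same W).diag_nonneg).1
  have hxt : ∀ y, ∑ j, x y j = t y := by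
    intro y
    have : (Wᴴ * ω y * W).trace = (ω y).trace := by
      rw [Matrix.trace_mul_comm, ← Matrix.mul_assoc, hW2, Matrix.one_mul]
    have h2 : t y = (Wᴴ * ω y * W).trace.re := by rw [this]
    rw [h2, Matrix.trace, Complex.re_sum]; rfl
  have hxμ : ∀ j, ∑ y, x y j = μ j := by
    intro j
    have e : Wᴴ * Ω * W = diagonal (fun i => (μ i : ℂ)) := by
      conv_lhs => rw [hs]
      calc _ = (Wᴴ * W) * diagonal (fun i => (μ i : ℂ)) * (Wᴴ * W) := by
            simp only [Matrix.mul_assoc]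
        _ = _ := by rw [hW1, Matrix.one_mul, Matrix.mul_one]
    have e2 : ∑ y, x y j = ((Wᴴ * Ω * W) j j).re := by
      rw [hΩdef, Matrix.mul_sum, Matrix.sum_mul, Matrix.sum_apply, Complex.re_sum]
    rw [e2, e, diagonal_apply_eq, Complex.ofReal_re]
  have hx0 : ∀ y j, t y = 0 → x y j = 0 := by
    intro y j h
    have := hxt y
    rw [h, Finset.sum_eq_zero_iff_of_nonneg fun j _ => hxn y j] at this
    exact this j (Finset.mem_univ j)
  have hx1 : ∀ y j, μ j = 0 → x y j = 0 := by
    intro y j h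
    have := hxμ j
    rw [h, Finset.sum_eq_zero_iff_of_nonneg fun y _ => hxn y j] at this
    exact this y (Finset.mem_univ y)
  have hts : ∀ y, s = 0 → t y = 0 := by
    intro y h
    rw [h, Finset.sum_eq_zero_iff_of_nonneg fun y _ => htn y] at hst
    exact hst y (Finset.mem_univ y)
  refine ⟨fun y => negEntropy (ω y) - ∑ j, x y j * Real.log (t y / s * μ j), fun y => ?_, ?_⟩
  · have hsn : 0 ≤ s := hst ▸ Finset.sum_nonneg fun y _ => htn y
    have hp := pinsker (hω y) hW1 hW2 (μ := fun j => t y / s * μ j)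
      (fun j => mul_nonneg (div_nonneg (htn y) hsn) (hμ j)) (by
        rw [← Finset.mul_sum, htr]
        by_cases h : s = 0
        · rw [h, mul_zero]; exact (hts y h).symm
        · rw [div_mul_cancel₀ _ h]) (by
        intro j hj
        rcases mul_eq_zero.mp hj with h | h
        · rcases div_eq_zero_iff.mp h with h | h
          · exact hx0 y j h
          · exact hx0 y j (hts y h)
        · exact hx1 y j h)
    have e : W * diagonal (fun j => ((t y / s * μ j : ℝ) : ℂ)) * Wᴴ = (t y / s) • Ω := by
      conv_rhs => rw [hs]
      have : diagonal (fun j => ((t y / s * μ j : ℝ) : ℂ)) =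
          (t y / s) • diagonal (fun j => (μ j : ℂ)) := by
        rw [← diagonal_smul]; congr 1; ext j; simp
      rw [this, Matrix.mul_smul, Matrix.smul_mul]
    rw [e] at hp
    exact hp
  -- Where `t y` or `μ j` vanishes, `x y j` vanishes too, so the logarithm of the product is only
  -- split at nonzero arguments.
  · have hlog : ∀ y j, x y j * Real.log (t y / s * μ j) =
        x y j * Real.log (t y) - x y j * Real.log s + x y j * Real.log (μ j) := by
      intro y j
      by_cases h1 : t y = 0
      · simp [hx0 y j h1]
      by_cases h2 : μ j = 0
      · simp [hx1 y j h2]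
      have h3 : s ≠ 0 := fun h => h1 (hts y h)
      rw [Real.log_mul (div_ne_zero h1 h3) h2, Real.log_div h1 h3]
      ring
    have h4 : ∀ y, ∑ j, x y j * Real.log (t y / s * μ j) =
        t y * Real.log (t y) - t y * Real.log s + ∑ j, x y j * Real.log (μ j) := by
      intro y
      simp only [hlog, Finset.sum_add_distrib, Finset.sum_sub_distrib, ← Finset.sum_mul, hxt]
    have h5 : ∑ y, ∑ j, x y j * Real.log (μ j) = ∑ j, μ j * Real.log (μ j) := by
      rw [Finset.sum_comm]
      exact Finset.sum_congr rfl fun j _ => by rw [← Finset.sum_mul, hxμ]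
    simp only [h4, weightedNegEntropy, Finset.sum_sub_distrib, Finset.sum_add_distrib, h5, hent,
      ← Finset.sum_mul, hst]
    ring

/-- Refining an ensemble: the increase of the average negative entropy controls the correlations
with the new outcome. -/
lemma sq_sum_traceNorm_le {T Z : Type*} [Fintype T] [Fintype Z] {ω : T → Z → Matrix n n ℂ}
    (hω : ∀ t z, (ω t z).PosSemidef) (htr : ∑ t, ∑ z, (ω t z).trace.re ≤ 1) :
    (∑ t, ∑ z, traceNorm (ω t z -
      ((ω t z).trace.re / (∑ z, ω t z).trace.re) • ∑ z, ω t z)) ^ 2 ≤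
      2 * (∑ t, ∑ z, weightedNegEntropy (ω t z) - ∑ t, weightedNegEntropy (∑ z, ω t z)) := by
  choose D hD hDs using fun t => exists_divergence (hω t)
  have e1 : 2 * (∑ t, ∑ z, weightedNegEntropy (ω t z) - ∑ t, weightedNegEntropy (∑ z, ω t z)) =
      ∑ p : T × Z, 2 * D p.1 p.2 := by
    rw [Fintype.sum_prod_type, ← Finset.sum_sub_distrib, Finset.mul_sum]
    exact Finset.sum_congr rfl fun t _ => by rw [← hDs, Finset.mul_sum]
  have hnn : 0 ≤ ∑ p : T × Z, 2 * D p.1 p.2 :=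
    Finset.sum_nonneg fun p _ => mul_nonneg zero_le_two (hD p.1 p.2).1
  rw [e1, ← Fintype.sum_prod_type']
  -- Cauchy–Schwarz with the probabilities as weights.
  refine (Finset.sum_sq_le_sum_mul_sum_of_sq_le_mul Finset.univ
    (f := fun p : T × Z => (ω p.1 p.2).trace.re) (g := fun p => 2 * D p.1 p.2)
    (fun p _ => PosSemidef.trace_re_nonneg (hω _ _))
    (fun p _ => mul_nonneg zero_le_two (hD p.1 p.2).1) (fun p _ => (hD p.1 p.2).2)).trans ?_
  refine mul_le_of_le_one_left hnn ?_
  rw [Fintype.sum_prod_type]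
  exact htr

end Entropy

end QDF

end

noncomputable section

namespace QDF

open Matrix

set_option linter.unusedSectionVars false

/-! ### Bipartite states as positive maps, and one conditioning step -/

section PositiveMaps

/-- A matrix whose quadratic form is nonnegative is positive semidefinite. -/
lemma posSemidef_of_dotProduct {n : Type*} [Fintype n] {X : Matrix n n ℂ}
    (h : ∀ x : n → ℂ, 0 ≤ star x ⬝ᵥ (X *ᵥ x)) : X.PosSemidef := by
  classical
  rw [← Matrix.isPositive_toEuclideanLin_iff, LinearMap.isPositive_iff_complex]
  intro x
  have hx := h x.ofLp
  have e : inner ℂ (X.toEuclideanLin x) x = star (star x.ofLp ⬝ᵥ (X *ᵥ x.ofLp)) := by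
    rw [EuclideanSpace.inner_eq_star_dotProduct, dotProduct_comm, star_dotProduct]
    rfl
  rw [e]
  obtain ⟨h1, h2⟩ := Complex.nonneg_iff.mp hx
  constructor
  · apply Complex.ext <;> simp [← h2]
  · simpa using h1

lemma PosSemidef.exists_eq_conjTranspose_mul_self {n : Type*} [Fintype n] [DecidableEq n]
    {X : Matrix n n ℂ} (hX : X.PosSemidef) : ∃ N : Matrix n n ℂ, X = Nᴴ * N := by
  obtain ⟨V, hV1, hV2, hs⟩ := exists_spectral hX.1
  refine ⟨diagonal (fun i => ((√(hX.1.eigenvalues i) : ℝ) : ℂ)) * Vᴴ, ?_⟩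
  rw [conjTranspose_mul, conjTranspose_conjTranspose, diagonal_conjTranspose]
  conv_lhs => rw [hs]
  have : (diagonal fun i => (hX.1.eigenvalues i : ℂ)) =
      diagonal (star fun i => ((√(hX.1.eigenvalues i) : ℝ) : ℂ)) *
        diagonal (fun i => ((√(hX.1.eigenvalues i) : ℝ) : ℂ)) := by
    rw [diagonal_mul_diagonal]
    congr 1; ext i
    simp only [Pi.star_apply, RCLike.star_def, Complex.conj_ofReal]
    rw [← Complex.ofReal_mul, Real.mul_self_sqrt (hX.eigenvalues_nonneg i)]
  rw [this]
  simp only [Matrix.mul_assoc]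

variable {A B A' Y : Type*} [Fintype A] [Fintype B] [DecidableEq B] [Fintype A'] [Fintype Y]

lemma IsChannel.posSemidef {E : Matrix A A ℂ →ₗ[ℂ] Matrix A' A' ℂ} (hE : IsChannel E)
    {X : Matrix A A ℂ} (hX : X.PosSemidef) : (E X).PosSemidef := by
  have h := (hE.1 1 (X.submatrix Prod.fst Prod.fst) (hX.submatrix _)).submatrix
    (fun a : A' => (a, (0 : Fin 1)))
  exact h

/-- `tr_B[(1 ⊗ N) X]`. -/
def partialTraceMul (N : Matrix B B ℂ) (X : Matrix (A × B) (A × B) ℂ) : Matrix A A ℂ :=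
  Matrix.of fun i j => ∑ v, ∑ u, N v u * X (i, u) (j, v)

/-- The image is block diagonal in the outcome, which reduces its trace norm to a sum over outcomes
of norms on `A'`. -/
lemma mapTensor_measMap_apply [DecidableEq Y] (E : Matrix A A ℂ →ₗ[ℂ] Matrix A' A' ℂ)
    (M : Y → Matrix B B ℂ) (X : Matrix (A × B) (A × B) ℂ) (p q : A' × Y) :
    mapTensor E (measMap M) X p q =
      if p.2 = q.2 then E (partialTraceMul (M p.2) X) p.1 q.1 else 0 := by
  have h : partialTraceMul (M p.2) X =
      ∑ v, ∑ u, M p.2 v u • Matrix.of (fun i j => X (i, u) (j, v)) := by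
    ext i j
    simp [partialTraceMul, Matrix.sum_apply]
  simp only [mapTensor, mapSnd, measMap, LinearMap.coe_mk, AddHom.coe_mk, of_apply,
    diagonal_apply]
  congr 1
  rw [h]
  simp only [map_sum, map_smul, Matrix.sum_apply, Matrix.smul_apply, smul_eq_mul, Matrix.trace,
    diag_apply, Matrix.mul_apply, mapFst, of_apply]

/-- The matrix on `A ⊗ B` whose contractions with `N` on `B` are the values `Θ N`. -/
def pairMatrix (Θ : Matrix B B ℂ →ₗ[ℂ] Matrix A A ℂ) : Matrix (A × B) (A × B) ℂ :=
  Matrix.of fun p q => Θ (Matrix.single q.2 p.2 1) p.1 q.1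

/-- The product of the two marginals of `pairMatrix Θ`, divided by the trace. -/
def marginalProduct (Θ : Matrix B B ℂ →ₗ[ℂ] Matrix A A ℂ) : Matrix (A × B) (A × B) ℂ :=
  Matrix.of fun p q => Θ 1 p.1 q.1 * (Θ (Matrix.single q.2 p.2 1)).trace / (Θ 1).trace

lemma map_eq_sum_single (Θ : Matrix B B ℂ →ₗ[ℂ] Matrix A A ℂ) (N : Matrix B B ℂ) :
    Θ N = ∑ v, ∑ u, N v u • Θ (Matrix.single v u 1) := by
  conv_lhs => rw [matrix_eq_sum_single N]
  simp only [map_sum]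
  refine Finset.sum_congr rfl fun v _ => Finset.sum_congr rfl fun u _ => ?_
  rw [← map_smul, smul_single, smul_eq_mul, mul_one]

lemma partialTraceMul_pairMatrix (Θ : Matrix B B ℂ →ₗ[ℂ] Matrix A A ℂ) (N : Matrix B B ℂ) :
    partialTraceMul N (pairMatrix Θ) = Θ N := by
  rw [map_eq_sum_single Θ N]
  ext i j
  simp [partialTraceMul, pairMatrix, Matrix.sum_apply]

lemma partialTraceMul_marginalProduct (Θ : Matrix B B ℂ →ₗ[ℂ] Matrix A A ℂ) (N : Matrix B B ℂ) :
    partialTraceMul N (marginalProduct Θ) = ((Θ N).trace / (Θ 1).trace) • Θ 1 := by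
  rw [map_eq_sum_single Θ N]
  ext i j
  simp only [partialTraceMul, marginalProduct, of_apply, Matrix.smul_apply, trace_sum, trace_smul,
    smul_eq_mul, Finset.sum_div, Finset.sum_mul]
  exact Finset.sum_congr rfl fun v _ => Finset.sum_congr rfl fun u _ => by ring

lemma partialTraceMul_sub (N : Matrix B B ℂ) (X X' : Matrix (A × B) (A × B) ℂ) :
    partialTraceMul N (X - X') = partialTraceMul N X - partialTraceMul N X' := by
  ext i j
  simp [partialTraceMul, mul_sub]

lemma partialTraceMul_sum {ι : Type*} (s : Finset ι) (N : Matrix B B ℂ)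
    (X : ι → Matrix (A × B) (A × B) ℂ) :
    partialTraceMul N (∑ t ∈ s, X t) = ∑ t ∈ s, partialTraceMul N (X t) := by
  classical
  induction s using Finset.induction_on with
  | empty => ext i j; simp [partialTraceMul]
  | insert a s ha ih =>
    rw [Finset.sum_insert ha, Finset.sum_insert ha, ← ih]
    ext i j
    simp [partialTraceMul, mul_add, Finset.sum_add_distrib]

lemma traceNorm_mapTensor_measMap_le [DecidableEq A'] [DecidableEq Y]
    (E : Matrix A A ℂ →ₗ[ℂ] Matrix A' A' ℂ) (M : Y → Matrix B B ℂ)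
    (X : Matrix (A × B) (A × B) ℂ) :
    traceNorm (mapTensor E (measMap M) X) ≤ ∑ y, traceNorm (E (partialTraceMul (M y) X)) :=
  traceNorm_block_le _ _ fun p q => mapTensor_measMap_apply E M X p q

/-- Positive linear maps between matrix algebras. -/
def IsPositiveMap (Θ : Matrix B B ℂ →ₗ[ℂ] Matrix A A ℂ) : Prop :=
  ∀ N, N.PosSemidef → (Θ N).PosSemidef

lemma sum_isPOVM_map {M : Y → Matrix B B ℂ} (hM : IsPOVM M)
    (Θ : Matrix B B ℂ →ₗ[ℂ] Matrix A A ℂ) : ∑ y, Θ (M y) = Θ 1 := by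
  rw [← map_sum, hM.2]

/-- One conditioning step: correlations with the outcome of a measurement are controlled by the
increase of the average negative entropy. -/
lemma sq_traceNorm_le_of_conditioning [DecidableEq A'] [DecidableEq Y] {T : Type*} [Fintype T]
    {Θ : T → Matrix B B ℂ →ₗ[ℂ] Matrix A A ℂ} (hΘ : ∀ t, IsPositiveMap (Θ t))
    (htr : ∑ t, (Θ t 1).trace = 1)
    {E : Matrix A A ℂ →ₗ[ℂ] Matrix A' A' ℂ} (hE : IsChannel E)
    {M : Y → Matrix B B ℂ} (hM : IsPOVM M) :
    traceNorm (mapTensor E (measMap M)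
      (∑ t, pairMatrix (Θ t) - ∑ t, marginalProduct (Θ t))) ^ 2 ≤
    2 * (∑ t, ∑ y, weightedNegEntropy (E (Θ t (M y))) -
      ∑ t, weightedNegEntropy (E (Θ t 1))) := by
  have hpos : ∀ t y, (E (Θ t (M y))).PosSemidef := fun t y =>
    hE.posSemidef (hΘ t _ (hM.1 y))
  have hsum : ∀ t, ∑ y, E (Θ t (M y)) = E (Θ t 1) := fun t => by
    rw [← map_sum, sum_isPOVM_map hM]
  have hmain := sq_sum_traceNorm_le hpos (by
    simp only [← Complex.re_sum, ← trace_sum (s := (Finset.univ : Finset Y)), hE.2,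
      sum_isPOVM_map hM]
    rw [htr, Complex.one_re])
  simp only [hsum] at hmain
  refine le_trans (pow_le_pow_left₀ (traceNorm_nonneg _) ?_ 2) hmain
  refine (traceNorm_mapTensor_measMap_le E M _).trans ?_
  rw [Finset.sum_comm]
  refine Finset.sum_le_sum fun y _ => ?_
  -- Contracted with `M y`, the product of marginals becomes the share of the outcome `y` in `E (Θ t
  -- 1)`. Since `E` preserves traces, these are the differences bounded in `sq_sum_traceNorm_le`.
  have e : E (partialTraceMul (M y) (∑ t, pairMatrix (Θ t) - ∑ t, marginalProduct (Θ t))) =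
      ∑ t, (E (Θ t (M y)) -
        ((E (Θ t (M y))).trace.re / (E (Θ t 1)).trace.re) • E (Θ t 1)) := by
    rw [partialTraceMul_sub, partialTraceMul_sum, partialTraceMul_sum, ← Finset.sum_sub_distrib,
      map_sum]
    refine Finset.sum_congr rfl fun t _ => ?_
    rw [partialTraceMul_pairMatrix, partialTraceMul_marginalProduct, map_sub, map_smul, hE.2, hE.2,
      PosSemidef.trace_eq_re (hΘ t _ (hM.1 y)), PosSemidef.trace_eq_re (hΘ t _ PosSemidef.one),
      ← Complex.ofReal_div, Complex.coe_smul, Complex.ofReal_re, Complex.ofReal_re]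
  rw [e]
  exact traceNorm_sum_le _ _

/-- The functional `N ↦ tr Θ(N) / tr Θ(1)` is positive and normalised, hence comes from a density
matrix. Its quadratic form at `x` is the value of the functional on the rank-one matrix of `x`. -/
lemma isState_trace_map {Θ : Matrix B B ℂ →ₗ[ℂ] Matrix A A ℂ} (hΘ : IsPositiveMap Θ)
    (h : (Θ 1).trace.re ≠ 0) :
    IsState (Matrix.of fun u v => (Θ (Matrix.single v u 1)).trace / (Θ 1).trace) := by
  have h1 := PosSemidef.trace_eq_re (hΘ 1 PosSemidef.one)
  have h0 := PosSemidef.trace_re_nonneg (hΘ 1 PosSemidef.one)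
  constructor
  · refine posSemidef_of_dotProduct fun x => ?_
    have e : star x ⬝ᵥ ((Matrix.of fun u v => (Θ (Matrix.single v u 1)).trace / (Θ 1).trace) *ᵥ x)
        = (Θ (vecMulVec x (star x))).trace / (Θ 1).trace := by
      rw [map_eq_sum_single Θ (vecMulVec x (star x))]
      simp only [dotProduct, mulVec, of_apply, trace_sum, trace_smul, smul_eq_mul, vecMulVec_apply,
        Pi.star_apply, Finset.mul_sum, Finset.sum_div]
      rw [Finset.sum_comm]
      exact Finset.sum_congr rfl fun v _ => Finset.sum_congr rfl fun u _ => by ring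
    rw [e, h1, PosSemidef.trace_eq_re (hΘ _ (posSemidef_vecMulVec_self_star x)),
      ← Complex.ofReal_div]
    exact_mod_cast div_nonneg
      (PosSemidef.trace_re_nonneg (hΘ _ (posSemidef_vecMulVec_self_star x))) h0
  · have hne : (Θ 1).trace ≠ 0 := fun hc => h (by rw [hc]; rfl)
    have e : (1 : Matrix B B ℂ) = ∑ u, Matrix.single u u 1 := by
      rw [← diagonal_one]
      exact (sum_single_eq_diagonal _).symm
    have h2 : (Matrix.of fun u v => (Θ (Matrix.single v u 1)).trace / (Θ 1).trace).trace =
        ∑ u, (Θ (Matrix.single u u 1)).trace / (Θ 1).trace := rfl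
    rw [h2, ← Finset.sum_div, div_eq_one_iff_eq hne]
    have : (Θ 1).trace = ∑ u, (Θ (Matrix.single u u 1)).trace := by
      conv_lhs => rw [e, map_sum, trace_sum]
    exact this.symm

lemma sum_marginalProduct_mem_sepStates {T : Type*} [Fintype T]
    {Θ : T → Matrix B B ℂ →ₗ[ℂ] Matrix A A ℂ} (hΘ : ∀ t, IsPositiveMap (Θ t))
    (htr : ∑ t, (Θ t 1).trace = 1) :
    ∑ t, marginalProduct (Θ t) ∈ SepStates A B := by
  classical
  have h0 := fun t => PosSemidef.trace_re_nonneg (hΘ t 1 PosSemidef.one)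
  have hs : ∑ t, (Θ t 1).trace.re = 1 := by rw [← Complex.re_sum, htr, Complex.one_re]
  set α : T → Matrix A A ℂ := fun t => ((Θ t 1).trace.re)⁻¹ • Θ t 1
  set β : T → Matrix B B ℂ := fun t =>
    Matrix.of fun u v => (Θ t (Matrix.single v u 1)).trace / (Θ t 1).trace
  have hα : ∀ t, (Θ t 1).trace.re ≠ 0 → IsState (α t) := by
    intro t ht
    refine ⟨(hΘ t 1 PosSemidef.one).smul (inv_nonneg.mpr (h0 t)), ?_⟩
    rw [trace_smul, PosSemidef.trace_eq_re (hΘ t 1 PosSemidef.one), Complex.ofReal_re,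
      Complex.real_smul, ← Complex.ofReal_mul, inv_mul_cancel₀ ht, Complex.ofReal_one]
  obtain ⟨t₀, ht₀⟩ : ∃ t, (Θ t 1).trace.re ≠ 0 := by
    by_contra hc
    push Not at hc
    simp [hc] at hs
  -- Outcomes of probability zero contribute nothing; a product state from some other outcome stands
  -- in with weight zero.
  have hz : ∀ t, marginalProduct (Θ t) = (Θ t 1).trace.re •
      (if (Θ t 1).trace.re = 0 then α t₀ ⊗ₖ β t₀ else α t ⊗ₖ β t) := by
    intro t
    by_cases h : (Θ t 1).trace.re = 0
    · rw [h, zero_smul]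
      have hz := PosSemidef.eq_zero_of_trace_re (hΘ t 1 PosSemidef.one) h
      ext p q
      simp [marginalProduct, hz]
    · rw [if_neg h]
      ext p q
      rw [Matrix.smul_apply, kroneckerMap_apply]
      simp only [marginalProduct, of_apply, Matrix.smul_apply, α, β, Complex.real_smul]
      have h2 : (((Θ t 1).trace.re : ℝ) : ℂ) ≠ 0 := by exact_mod_cast h
      push_cast
      field_simp
  rw [Finset.sum_congr rfl fun t _ => hz t]
  refine (convex_convexHull ℝ _).sum_mem (fun t _ => h0 t) hs fun t _ => ?_
  refine subset_convexHull ℝ _ ?_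
  split_ifs with h
  · exact ⟨_, _, hα t₀ ht₀, isState_trace_map (hΘ t₀) ht₀, rfl⟩
  · exact ⟨_, _, hα t h, isState_trace_map (hΘ t) h, rfl⟩

end PositiveMaps

/-! ### Conditioning an extension on effects of the `B` systems -/

section Conditioning

variable {A B : Type*} [Fintype A] [Fintype B] [DecidableEq B] {k : ℕ}

/-- The unnormalised state of `A` after the effects `F i` have been observed on the `B_i`. -/
def condState (R : Matrix (A × (Fin k → B)) (A × (Fin k → B)) ℂ) (F : Fin k → Matrix B B ℂ) :
    Matrix A A ℂ :=
  Matrix.of fun p q => ∑ f, ∑ g, R (p, f) (q, g) * ∏ i, F i (g i) (f i)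

lemma prod_update_apply (F : Fin k → Matrix B B ℂ) (j : Fin k) (N : Matrix B B ℂ)
    (f g : Fin k → B) :
    ∏ i, Function.update F j N i (g i) (f i) =
      N (g j) (f j) * ∏ i ∈ Finset.univ.erase j, F i (g i) (f i) := by
  rw [← Finset.mul_prod_erase _ _ (Finset.mem_univ j), Function.update_self]
  congr 1
  refine Finset.prod_congr rfl fun i hi => ?_
  rw [Function.update_of_ne (Finset.ne_of_mem_erase hi)]

/-- `condState` as a function of the effect on `B_j`. -/
def condMap (R : Matrix (A × (Fin k → B)) (A × (Fin k → B)) ℂ) (F : Fin k → Matrix B B ℂ)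
    (j : Fin k) : Matrix B B ℂ →ₗ[ℂ] Matrix A A ℂ where
  toFun N := condState R (Function.update F j N)
  map_add' N N' := by
    ext p q
    simp only [condState, of_apply, prod_update_apply, Matrix.add_apply, ← Finset.sum_add_distrib]
    exact Finset.sum_congr rfl fun f _ => Finset.sum_congr rfl fun g _ => by ring
  map_smul' c N := by
    ext p q
    simp only [condState, of_apply, prod_update_apply, Matrix.smul_apply, smul_eq_mul,
      Finset.mul_sum, RingHom.id_apply]
    exact Finset.sum_congr rfl fun f _ => Finset.sum_congr rfl fun g _ => by ring

lemma condMap_apply (R : Matrix (A × (Fin k → B)) (A × (Fin k → B)) ℂ)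
    (F : Fin k → Matrix B B ℂ) (j : Fin k) (N : Matrix B B ℂ) :
    condMap R F j N = condState R (Function.update F j N) := rfl

/-- Factoring every effect as `Nᴴ * N` gives a Kraus form `∑ h, Z h * R * (Z h)ᴴ`, one term for each
multi-index `h`. -/
lemma condState_posSemidef {R : Matrix (A × (Fin k → B)) (A × (Fin k → B)) ℂ}
    (hR : R.PosSemidef) {F : Fin k → Matrix B B ℂ} (hF : ∀ i, (F i).PosSemidef) :
    (condState R F).PosSemidef := by
  classical
  choose N hN using fun i => PosSemidef.exists_eq_conjTranspose_mul_self (hF i)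
  let w : (Fin k → B) → (Fin k → B) → ℂ := fun h f => ∏ i, N i (h i) (f i)
  let Z : (Fin k → B) → Matrix A (A × (Fin k → B)) ℂ := fun h =>
    Matrix.of fun p q => if q.1 = p then w h q.2 else 0
  have hprod : ∀ f g : Fin k → B, ∏ i, F i (g i) (f i) = ∑ h, star (w h g) * w h f := by
    intro f g
    have e : ∀ i, F i (g i) (f i) = ∑ h, star (N i h (g i)) * N i h (f i) := by
      intro i
      conv_lhs => rw [hN i]
      rw [Matrix.mul_apply]; rfl
    simp only [e]
    rw [Finset.prod_univ_sum, Fintype.piFinset_univ]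
    refine Finset.sum_congr rfl fun h _ => ?_
    rw [Finset.prod_mul_distrib, star_prod]
  have e : condState R F = ∑ h, Z h * R * (Z h)ᴴ := by
    ext p q
    rw [Matrix.sum_apply]
    have e1 : ∀ h, (Z h * R * (Z h)ᴴ) p q =
        ∑ g, ∑ f, w h f * R (p, f) (q, g) * star (w h g) := by
      intro h
      simp only [Matrix.mul_apply, conjTranspose_apply, Z, of_apply, Fintype.sum_prod_type]
      rw [Finset.sum_eq_single q]
      · refine Finset.sum_congr rfl fun g _ => ?_
        rw [Finset.sum_mul, Finset.sum_eq_single p]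
        · rw [Finset.sum_mul]
          simp
        · intro b _ hb
          simp [hb]
        · simp
      · intro b _ hb
        simp [hb]
      · simp
    simp only [e1, condState, of_apply, hprod, Finset.mul_sum]
    rw [Finset.sum_comm]
    conv_lhs => enter [2, g]; rw [Finset.sum_comm]
    rw [Finset.sum_comm]
    refine Finset.sum_congr rfl fun h _ => Finset.sum_congr rfl fun g _ =>
      Finset.sum_congr rfl fun f _ => by ring
  rw [e]
  exact posSemidef_sum _ fun h _ => hR.mul_mul_conjTranspose_same _

lemma condMap_isPositiveMap {R : Matrix (A × (Fin k → B)) (A × (Fin k → B)) ℂ}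
    (hR : R.PosSemidef) {F : Fin k → Matrix B B ℂ} (hF : ∀ i, (F i).PosSemidef) (j : Fin k) :
    IsPositiveMap (condMap R F j) := by
  intro N hN
  refine condState_posSemidef hR fun i => ?_
  by_cases h : i = j
  · subst h; simpa using hN
  · simpa [h] using hF i

lemma prod_one_apply (s : Finset (Fin k)) (f g : Fin k → B) :
    ∏ i ∈ s, (1 : Fin k → Matrix B B ℂ) i (g i) (f i) = if ∀ i ∈ s, g i = f i then 1 else 0 := by
  simp only [Pi.one_apply, one_apply]
  rw [Finset.prod_ite_zero]
  simp

lemma trace_condState_one (R : Matrix (A × (Fin k → B)) (A × (Fin k → B)) ℂ) :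
    (condState R 1).trace = R.trace := by
  simp only [Matrix.trace, condState, diag_apply, of_apply, prod_one_apply, Fintype.sum_prod_type]
  refine Finset.sum_congr rfl fun p _ => Finset.sum_congr rfl fun f _ => ?_
  rw [Finset.sum_eq_single f]
  · simp
  · intro g _ hg
    rw [if_neg, mul_zero]
    intro h
    exact hg (funext fun i => h i (Finset.mem_univ i))
  · simp

/-- Identity effects force `g` to agree with `f` away from `j`, which is the partial trace over the
other systems. -/
lemma pairMatrix_condMap_one (R : Matrix (A × (Fin k → B)) (A × (Fin k → B)) ℂ) (j : Fin k) :
    pairMatrix (condMap R 1 j) = reducedTo R j := by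
  ext p q
  simp only [pairMatrix, reducedTo, of_apply, condMap_apply, condState, prod_update_apply,
    prod_one_apply]
  refine Finset.sum_congr rfl fun f _ => ?_
  rw [Finset.sum_eq_single (Function.update f j q.2)]
  · have h : ∀ i ∈ Finset.univ.erase j, Function.update f j q.2 i = f i := fun i hi => by
      rw [Function.update_of_ne (Finset.ne_of_mem_erase hi)]
    rw [if_pos h, Function.update_self, single_apply]
    simp [eq_comm]
  · intro g _ hg
    rw [single_apply]
    by_cases h1 : q.2 = g j
    · rw [if_neg (c := ∀ i ∈ _, _), mul_zero, mul_zero]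
      intro h
      refine hg (funext fun i => ?_)
      by_cases hi : i = j
      · subst hi; simp [h1]
      · rw [Function.update_of_ne hi]
        exact h i (Finset.mem_erase.mpr ⟨hi, Finset.mem_univ i⟩)
    · simp [h1]
  · simp

/-- A family of effects on the first `j` of the systems `B_i` that describes all outcomes of a
measurement. -/
structure IsInstrument (R : Matrix (A × (Fin k → B)) (A × (Fin k → B)) ℂ) (j : ℕ)
    {T : Type*} [Fintype T] (F : T → Fin k → Matrix B B ℂ) : Prop where
  posSemidef : ∀ t (i : Fin k), (F t i).PosSemidef
  eq_one : ∀ t (i : Fin k), j ≤ (i : ℕ) → F t i = 1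
  -- Completeness is imposed on the conditional maps of the unmeasured systems, not on the effects
  -- themselves. It yields total probability one and the right average state of `A B_i`, and is
  -- vacuous once `j = k`.
  sum_condMap : ∀ i : Fin k, j ≤ (i : ℕ) → ∀ N, ∑ t, condMap R (F t) i N = condMap R 1 i N

/-- Any one-point index type is allowed, because both `PUnit` and the empty strings `Fin 0 → Fin n`
serve as starting points. -/
lemma isInstrument_one (R : Matrix (A × (Fin k → B)) (A × (Fin k → B)) ℂ) {T : Type*} [Unique T]
    [Fintype T] :
    IsInstrument R 0 (fun _ : T => (1 : Fin k → Matrix B B ℂ)) where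
  posSemidef _ _ := PosSemidef.one
  eq_one _ _ _ := rfl
  sum_condMap _ _ _ := by simp

variable {R : Matrix (A × (Fin k → B)) (A × (Fin k → B)) ℂ}
  {T : Type*} [Fintype T] {F : T → Fin k → Matrix B B ℂ}

lemma IsInstrument.condMap_one {j : Fin k} (hF : IsInstrument R j F) (t : T) :
    condMap R (F t) j 1 = condState R (F t) := by
  rw [condMap_apply, Function.update_eq_self_iff.mpr]
  exact (hF.eq_one t j le_rfl).symm

/-- Updates at different systems commute, and summing over the new outcomes restores the identity
effect that stood at `j`. -/
lemma IsInstrument.refine {Y : Type*} [Fintype Y] {j : Fin k} (hF : IsInstrument R j F)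
    {M : Y → Matrix B B ℂ} (hM : IsPOVM M) :
    IsInstrument R (j + 1) fun p : T × Y => Function.update (F p.1) j (M p.2) where
  posSemidef p i := by
    by_cases h : i = j
    · subst h; simpa using hM.1 p.2
    · simpa [h] using hF.posSemidef p.1 i
  eq_one p i hi := by
    have h : i ≠ j := fun h => by subst h; omega
    rw [Function.update_of_ne h, hF.eq_one p.1 i (by omega)]
  sum_condMap i hi N := by
    have h : j ≠ i := fun h => by subst h; omega
    rw [Fintype.sum_prod_type, ← hF.sum_condMap i (by omega)]
    refine Finset.sum_congr rfl fun t _ => ?_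
    simp only [condMap_apply, Function.update_comm h]
    simp only [← condMap_apply R (Function.update (F t) i N) j]
    rw [sum_isPOVM_map hM, condMap_apply, Function.update_eq_self_iff.mpr]
    rw [Function.update_of_ne h, hF.eq_one t j le_rfl]

lemma IsInstrument.sum_trace {j : Fin k} (hF : IsInstrument R j F) (hR : R.trace = 1) :
    ∑ t, (condMap R (F t) j 1).trace = 1 := by
  rw [← trace_sum, hF.sum_condMap j le_rfl, condMap_apply,
    Function.update_eq_self_iff.mpr (by rfl), trace_condState_one, hR]

lemma IsInstrument.sum_pairMatrix {j : Fin k} (hF : IsInstrument R j F) :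
    ∑ t, pairMatrix (condMap R (F t) j) = reducedTo R j := by
  rw [← pairMatrix_condMap_one]
  ext p q
  simp only [Matrix.sum_apply, pairMatrix, of_apply]
  rw [← Matrix.sum_apply, hF.sum_condMap j le_rfl]

/-- The separable approximation of the state of `A B_j` given by conditioning on the outcomes of an
instrument. -/
def conditionedState (R : Matrix (A × (Fin k → B)) (A × (Fin k → B)) ℂ)
    (F : T → Fin k → Matrix B B ℂ) (j : Fin k) : Matrix (A × B) (A × B) ℂ :=
  ∑ t, marginalProduct (condMap R (F t) j)

lemma IsInstrument.conditionedState_mem {j : Fin k} (hF : IsInstrument R j F) (hR : IsState R) :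
    conditionedState R F j ∈ SepStates A B :=
  sum_marginalProduct_mem_sepStates (fun t => condMap_isPositiveMap hR.1 (hF.posSemidef t) j)
    (hF.sum_trace hR.2)

/-- The two sums are the same quantity after and before measuring `B_j`, so the bounds for
successive `j` telescope. The bound concerns `ρ` for every `j` because all reduced states of the
extension coincide. -/
lemma IsInstrument.sq_traceNorm_le {A' Y : Type*} [Fintype A'] [DecidableEq A'] [Fintype Y]
    [DecidableEq Y] {ρ : Matrix (A × B) (A × B) ℂ} {j : Fin k} (hF : IsInstrument R j F)
    (hR : IsExtension k ρ R) {E : Matrix A A ℂ →ₗ[ℂ] Matrix A' A' ℂ} (hE : IsChannel E)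
    {M : Y → Matrix B B ℂ} (hM : IsPOVM M) :
    traceNorm (mapTensor E (measMap M) (ρ - conditionedState R F j)) ^ 2 ≤
    2 * (∑ p : T × Y, weightedNegEntropy
        (E (condState R (Function.update (F p.1) j (M p.2)))) -
      ∑ t, weightedNegEntropy (E (condState R (F t)))) := by
  have h := sq_traceNorm_le_of_conditioning
    (fun t => condMap_isPositiveMap hR.1.1 (hF.posSemidef t) j) (hF.sum_trace hR.1.2) hE hM
  rw [hF.sum_pairMatrix, hR.2 j] at h
  simp only [hF.condMap_one] at h
  rw [Fintype.sum_prod_type]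
  exact h

lemma IsInstrument.sum_weightedNegEntropy_nonpos {A' : Type*} [Fintype A'] [DecidableEq A'] {j : ℕ}
    (hF : IsInstrument R j F)
    (hR : IsState R) {E : Matrix A A ℂ →ₗ[ℂ] Matrix A' A' ℂ} (hE : IsChannel E) :
    ∑ t, weightedNegEntropy (E (condState R (F t))) ≤ 0 :=
  Finset.sum_nonpos fun t _ => weightedNegEntropy_nonpos
    (hE.posSemidef (condState_posSemidef hR.1 (hF.posSemidef t)))

lemma IsInstrument.neg_log_card_le {A' : Type*} [Fintype A'] [DecidableEq A'] {j : Fin k}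
    (hF : IsInstrument R j F) (hR : IsState R) {E : Matrix A A ℂ →ₗ[ℂ] Matrix A' A' ℂ}
    (hE : IsChannel E) :
    -Real.log (Fintype.card A') ≤ ∑ t, weightedNegEntropy (E (condState R (F t))) := by
  have h := hF.sum_trace hR.2
  simp only [hF.condMap_one] at h
  have h1 : ∑ t, (E (condState R (F t))).trace.re = 1 := by
    rw [← Complex.re_sum]; simp only [hE.2]; rw [h, Complex.one_re]
  calc -Real.log (Fintype.card A') =
      ∑ t, -((E (condState R (F t))).trace.re * Real.log (Fintype.card A')) := by
        rw [Finset.sum_neg_distrib, ← Finset.sum_mul, h1, one_mul]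
    _ ≤ _ := Finset.sum_le_sum fun t _ => neg_trace_mul_log_card_le_weightedNegEntropy
        (hE.posSemidef (condState_posSemidef hR.1 (hF.posSemidef t)))

lemma IsInstrument.comp_equiv {T' : Type*} [Fintype T'] {j : ℕ} (hF : IsInstrument R j F)
    (e : T' ≃ T) : IsInstrument R j (F ∘ e) where
  posSemidef t := hF.posSemidef (e t)
  eq_one t := hF.eq_one (e t)
  sum_condMap i hi N := by
    rw [← hF.sum_condMap i hi N]
    exact e.sum_comp fun t => condMap R (F t) i N

end Conditioning

end QDF

end

noncomputable section

namespace QDF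

open Matrix MeasureTheory

set_option linter.unusedSectionVars false

/-! ### Random channels, and one separable state for all measurements -/

section LocalMeasurements

/-- The variance is nonnegative. -/
lemma sq_integral_le_integral_sq {Ω : Type*} [MeasurableSpace Ω] {μ : Measure Ω}
    [IsProbabilityMeasure μ] {f : Ω → ℝ} (hf : Integrable f μ)
    (hf2 : Integrable (fun m => f m ^ 2) μ) : (∫ m, f m ∂μ) ^ 2 ≤ ∫ m, f m ^ 2 ∂μ := by
  set I := ∫ m, f m ∂μ with hI
  have h1 : 0 ≤ ∫ m, (f m - I) ^ 2 ∂μ := integral_nonneg fun m => sq_nonneg _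
  have h2 : (fun m => (f m - I) ^ 2) = fun m => (f m ^ 2 - 2 * I * f m) + I ^ 2 := by
    ext m; ring
  have h3 : Integrable (fun m => 2 * I * f m) μ := hf.const_mul _
  have h4 : Integrable (fun m => f m ^ 2 - 2 * I * f m) μ := hf2.sub h3
  rw [h2, integral_add h4 (integrable_const _), integral_sub hf2 h3, integral_const_mul,
    ← hI] at h1
  simp at h1
  nlinarith

variable {A B A' Ω Y : Type*} [Fintype A] [Fintype B] [DecidableEq B] [Fintype A'] [DecidableEq A']
  [MeasurableSpace Ω] [Fintype Y] [DecidableEq Y] {k : ℕ}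

lemma measurable_traceNorm_mapTensor {E : Ω → Matrix A A ℂ →ₗ[ℂ] Matrix A' A' ℂ}
    (hEm : ∀ X i j, Measurable fun m => E m X i j) (M : Y → Matrix B B ℂ)
    (X : Matrix (A × B) (A × B) ℂ) :
    Measurable fun m => traceNorm (mapTensor (E m) (measMap M) X) := by
  refine measurable_traceNorm_of_entries fun p q => ?_
  simp only [mapTensor_measMap_apply]
  split_ifs
  · exact hEm _ _ _
  · exact measurable_const

section

variable {R : Matrix (A × (Fin k → B)) (A × (Fin k → B)) ℂ} {ρ : Matrix (A × B) (A × B) ℂ}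
  {E : Ω → Matrix A A ℂ →ₗ[ℂ] Matrix A' A' ℂ} {T : Type*} [Fintype T]
  {F : T → Fin k → Matrix B B ℂ} {j : Fin k} {M : Y → Matrix B B ℂ}

/-- A bound uniform in the channel, which supplies integrability. -/
lemma IsInstrument.sq_traceNorm_le_log_card (hF : IsInstrument R j F) (hR : IsExtension k ρ R)
    {E : Matrix A A ℂ →ₗ[ℂ] Matrix A' A' ℂ} (hE : IsChannel E) (hM : IsPOVM M) :
    traceNorm (mapTensor E (measMap M) (ρ - conditionedState R F j)) ^ 2 ≤
      2 * Real.log (Fintype.card A') := by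
  have h1 := hF.sq_traceNorm_le hR hE hM
  have h2 := (hF.refine hM).sum_weightedNegEntropy_nonpos hR.1 hE
  have h3 := hF.neg_log_card_le hR.1 hE
  linarith

lemma IsInstrument.integrable_traceNorm_sq (hF : IsInstrument R j F) (hR : IsExtension k ρ R)
    (μ : Measure Ω) [IsProbabilityMeasure μ] (hE : ∀ m, IsChannel (E m))
    (hEm : ∀ X i j, Measurable fun m => E m X i j) (hM : IsPOVM M) :
    Integrable (fun m =>
      traceNorm (mapTensor (E m) (measMap M) (ρ - conditionedState R F j)) ^ 2) μ := by
  refine (integrable_const (2 * Real.log (Fintype.card A'))).mono'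
    ((measurable_traceNorm_mapTensor hEm M _).pow_const 2).aestronglyMeasurable
    (Filter.Eventually.of_forall fun m => ?_)
  rw [Real.norm_of_nonneg (sq_nonneg _)]
  exact hF.sq_traceNorm_le_log_card hR (hE m) hM

lemma IsInstrument.integrable_traceNorm (hF : IsInstrument R j F) (hR : IsExtension k ρ R)
    (μ : Measure Ω) [IsProbabilityMeasure μ] (hE : ∀ m, IsChannel (E m))
    (hEm : ∀ X i j, Measurable fun m => E m X i j) (hM : IsPOVM M) :
    Integrable (fun m =>
      traceNorm (mapTensor (E m) (measMap M) (ρ - conditionedState R F j))) μ := by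
  refine (integrable_const √(2 * Real.log (Fintype.card A'))).mono'
    (measurable_traceNorm_mapTensor hEm M _).aestronglyMeasurable
    (Filter.Eventually.of_forall fun m => ?_)
  rw [Real.norm_of_nonneg (traceNorm_nonneg _)]
  exact Real.le_sqrt_of_sq_le (hF.sq_traceNorm_le_log_card hR (hE m) hM)

end

universe w

/-- The de Finetti theorem for local measurements: one separable state for all measurements. -/
theorem exists_sepState_forall_measurement (hk : 1 ≤ k) {ρ : Matrix (A × B) (A × B) ℂ}
    {μ : Measure Ω} [IsProbabilityMeasure μ] {E : Ω → Matrix A A ℂ →ₗ[ℂ] Matrix A' A' ℂ}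
    (hρ : IsExtendible k ρ) (hE : ∀ m, IsChannel (E m))
    (hEm : ∀ X i j, Measurable fun m => E m X i j) :
    ∃ σ ∈ SepStates A B, ∀ (Y : Type w) [Fintype Y] [DecidableEq Y] (M : Y → Matrix B B ℂ),
      IsPOVM M →
      Integrable (fun m => traceNorm (mapTensor (E m) (measMap M) (ρ - σ))) μ ∧
      ∫ m, traceNorm (mapTensor (E m) (measMap M) (ρ - σ)) ∂μ
        ≤ √(2 * Real.log (Fintype.card A') / k) := by
  obtain ⟨hρs, R, hR⟩ := hρ
  by_contra hcon
  push Not at hcon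
  have hk0 : (0 : ℝ) < k := by exact_mod_cast hk
  have hlog : 0 ≤ Real.log (Fintype.card A') := Real.log_natCast_nonneg _
  have hcsq : √(2 * Real.log (Fintype.card A') / k) ^ 2 = 2 * Real.log (Fintype.card A') / k :=
    Real.sq_sqrt (by positivity)
  have hc0 := Real.sqrt_nonneg (2 * Real.log (Fintype.card A') / k)
  set c := √(2 * Real.log (Fintype.card A') / k) with hc
  -- `G` accumulates the squared errors of the candidates refuted so far, and is controlled channel
  -- by channel by the entropy gained. Strictness starts with the first round.
  have key : ∀ j : ℕ, j ≤ k → ∃ (T : Type w) (_ : Fintype T) (F : T → Fin k → Matrix B B ℂ)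
      (G : Ω → ℝ), IsInstrument R j F ∧ Integrable G μ ∧ j * c ^ 2 ≤ ∫ m, G m ∂μ ∧
      (0 < j → j * c ^ 2 < ∫ m, G m ∂μ) ∧
      ∀ m, G m ≤ 2 * (∑ t, weightedNegEntropy (E m (condState R (F t))) +
        Real.log (Fintype.card A')) := by
    intro j
    induction j with
    | zero =>
      intro _
      have h0 := isInstrument_one R (T := PUnit.{w + 1})
      refine ⟨PUnit, inferInstance, _, fun _ => 0, h0, integrable_const _, by simp, by simp,
        fun m => ?_⟩
      have := IsInstrument.neg_log_card_le (j := ⟨0, hk⟩) h0 hR.1 (hE m)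
      linarith
    | succ j ih =>
      intro hj
      obtain ⟨T, _, F, G, hF, hG, hGi, -, hGm⟩ := ih (by omega)
      have hF' : IsInstrument R ((⟨j, hj⟩ : Fin k) : ℕ) F := hF
      -- The measurement that refutes the current candidate is the one performed on the next system.
      obtain ⟨Y, _, _, M, hM, hbad⟩ := hcon _ (hF'.conditionedState_mem hR.1)
      have hi1 := hF'.integrable_traceNorm hR μ hE hEm hM
      have hi2 := hF'.integrable_traceNorm_sq hR μ hE hEm hM
      have hlt := hbad hi1
      have hsq := sq_integral_le_integral_sq hi1 hi2
      have hcs : c ^ 2 < _ := lt_of_lt_of_le (pow_lt_pow_left₀ hlt hc0 two_ne_zero) hsq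
      refine ⟨T × Y, inferInstance, _, _, hF'.refine hM, hG.add hi2, ?_, fun _ => ?_, fun m => ?_⟩
      · rw [integral_add' hG hi2]; push_cast; linarith
      · rw [integral_add' hG hi2]; push_cast; linarith
      · have h1 := hF'.sq_traceNorm_le hR (hE m) hM
        have h2 := hGm m
        simp only [Pi.add_apply]
        linarith
  obtain ⟨T, _, F, G, hF, hG, -, hGi, hGm⟩ := key k le_rfl
  -- After `k` rounds the total strictly exceeds `k * c ^ 2 = 2 log |A'|`, the largest possible
  -- value.
  have h1 := hGi hk
  have h2 : ∫ m, G m ∂μ ≤ 2 * Real.log (Fintype.card A') := by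
    have := integral_mono hG (integrable_const (2 * Real.log (Fintype.card A'))) fun m => by
      have h3 := hGm m
      have h4 := hF.sum_weightedNegEntropy_nonpos hR.1 (hE m)
      simp only
      linarith
    simpa using this
  rw [hcsq, mul_div_cancel₀ _ hk0.ne'] at h1
  linarith

/-! ### A fixed measurement and the average over prefixes -/

section FixedMeasurement

variable {n : ℕ}

/-- The effects of the outcomes `y` of the measurement `M` on the first `j` systems. -/
def prefixEffects (M : Fin n → Matrix B B ℂ) (k j : ℕ) (y : Fin j → Fin n) :
    Fin k → Matrix B B ℂ :=
  fun i => if h : (i : ℕ) < j then M (y ⟨i, h⟩) else 1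

lemma prefixEffects_snoc (M : Fin n → Matrix B B ℂ) (j : Fin k) (y : Fin j → Fin n) (z : Fin n) :
    prefixEffects M k (j + 1) (Fin.snoc y z) =
      Function.update (prefixEffects M k j y) j (M z) := by
  ext1 i
  rcases lt_trichotomy (i : ℕ) j with h | h | h
  · rw [Function.update_of_ne (by intro hc; subst hc; omega)]
    simp only [prefixEffects, h, dif_pos, show (i : ℕ) < j + 1 by omega, Fin.snoc]
    rfl
  · have : i = j := Fin.ext h
    subst this
    simp [prefixEffects, Fin.snoc]
  · rw [Function.update_of_ne (by intro hc; subst hc; omega)]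
    simp only [prefixEffects, show ¬ (i : ℕ) < j by omega, show ¬ (i : ℕ) < j + 1 by omega,
      dif_neg, not_false_eq_true]

lemma isInstrument_prefixEffects (R : Matrix (A × (Fin k → B)) (A × (Fin k → B)) ℂ)
    {M : Fin n → Matrix B B ℂ} (hM : IsPOVM M) (j : ℕ) (hj : j ≤ k) :
    IsInstrument R j (prefixEffects M k j) := by
  induction j with
  | zero =>
    have : prefixEffects M k 0 = fun _ => 1 := by
      ext1 y; ext1 i; simp [prefixEffects]
    rw [this]
    exact isInstrument_one R (T := Fin 0 → Fin n)
  | succ j ih =>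
    have h := (IsInstrument.refine (j := ⟨j, hj⟩) (ih (by omega)) hM).comp_equiv
      ((Fin.snocEquiv fun _ : Fin (j + 1) => Fin n).symm.trans (Equiv.prodComm _ _))
    convert h using 1
    ext1 y
    obtain ⟨⟨z, y⟩, rfl⟩ := (Fin.snocEquiv fun _ : Fin (j + 1) => Fin n).surjective y
    simp only [Function.comp_apply, Equiv.trans_apply, Equiv.symm_apply_apply,
      Equiv.prodComm_apply, Prod.swap]
    exact prefixEffects_snoc M ⟨j, hj⟩ y z

lemma sum_prefixEffects_succ {α : Type*} [AddCommMonoid α] (M : Fin n → Matrix B B ℂ) (j : Fin k)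
    (φ : (Fin k → Matrix B B ℂ) → α) :
    ∑ y, φ (prefixEffects M k (j + 1) y) =
      ∑ p : (Fin j → Fin n) × Fin n, φ (Function.update (prefixEffects M k j p.1) j (M p.2)) := by
  rw [← (Fin.snocEquiv fun _ : Fin (j + 1) => Fin n).sum_comp,
    ← (Equiv.prodComm (Fin n) (Fin j → Fin n)).sum_comp]
  refine Finset.sum_congr rfl fun p _ => ?_
  rw [← prefixEffects_snoc]
  rfl

/-- The average over `j` of the separable states obtained by measuring the first `j` systems. -/
def averageState (R : Matrix (A × (Fin k → B)) (A × (Fin k → B)) ℂ) (M : Fin n → Matrix B B ℂ) :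
    Matrix (A × B) (A × B) ℂ :=
  (k : ℝ)⁻¹ • ∑ j : Fin k, conditionedState R (prefixEffects M k j) j

variable {R : Matrix (A × (Fin k → B)) (A × (Fin k → B)) ℂ} {ρ : Matrix (A × B) (A × B) ℂ}
  {M : Fin n → Matrix B B ℂ}

lemma averageState_mem (hk : 1 ≤ k) (hR : IsState R) (hM : IsPOVM M) :
    averageState R M ∈ SepStates A B := by
  have hk0 : (0 : ℝ) < k := by exact_mod_cast hk
  rw [averageState, Finset.smul_sum]
  refine (convex_convexHull ℝ _).sum_mem (fun _ _ => by positivity) ?_ fun j _ =>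
    (isInstrument_prefixEffects R hM j j.2.le).conditionedState_mem hR
  simp [hk0.ne']

/-- The gains telescope from a value that is at least `-log |A'|` to one that is at most `0`. -/
lemma sum_sq_traceNorm_le (hk : 1 ≤ k) (hR : IsExtension k ρ R) (hM : IsPOVM M)
    {E : Matrix A A ℂ →ₗ[ℂ] Matrix A' A' ℂ} (hE : IsChannel E) :
    ∑ j : Fin k, traceNorm (mapTensor E (measMap M)
      (ρ - conditionedState R (prefixEffects M k j) j)) ^ 2 ≤ 2 * Real.log (Fintype.card A') := by
  set H : ℕ → ℝ := fun j => ∑ y, weightedNegEntropy (E (condState R (prefixEffects M k j y)))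
  have h1 : ∀ j : Fin k, traceNorm (mapTensor E (measMap M)
      (ρ - conditionedState R (prefixEffects M k j) j)) ^ 2 ≤ 2 * (H (j + 1) - H j) := by
    intro j
    refine ((isInstrument_prefixEffects R hM j j.2.le).sq_traceNorm_le hR hE hM).trans ?_
    simp only [H]
    rw [sum_prefixEffects_succ M j fun F => weightedNegEntropy (E (condState R F))]
  have h2 := Finset.sum_le_sum fun j (_ : j ∈ Finset.univ) => h1 j
  rw [← Finset.mul_sum, Fin.sum_univ_eq_sum_range (fun j => H (j + 1) - H j),
    Finset.sum_range_sub] at h2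
  have h3 := (isInstrument_prefixEffects R hM k le_rfl).sum_weightedNegEntropy_nonpos hR.1 hE
  have h4 := IsInstrument.neg_log_card_le (j := ⟨0, hk⟩)
    (isInstrument_prefixEffects R hM 0 (Nat.zero_le _)) hR.1 hE
  simp only [H] at h2
  linarith

lemma traceNorm_averageState_le (hk : 1 ≤ k) (E : Matrix A A ℂ →ₗ[ℂ] Matrix A' A' ℂ) :
    traceNorm (mapTensor E (measMap M) (ρ - averageState R M)) ≤
      (k : ℝ)⁻¹ * ∑ j : Fin k, traceNorm (mapTensor E (measMap M)
        (ρ - conditionedState R (prefixEffects M k j) j)) := by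
  have hk0 : (k : ℝ) ≠ 0 := by positivity
  have e : mapTensor E (measMap M) (ρ - averageState R M) = (k : ℝ)⁻¹ • ∑ j : Fin k,
      mapTensor E (measMap M) (ρ - conditionedState R (prefixEffects M k j) j) := by
    have e0 : ρ - averageState R M = ((k : ℝ)⁻¹ : ℂ) •
        ∑ j : Fin k, (ρ - conditionedState R (prefixEffects M k j) j) := by
      rw [averageState, Finset.sum_sub_distrib, smul_sub]
      congr 1
      · simp only [Finset.sum_const, Finset.card_univ, Fintype.card_fin]
        rw [← Nat.cast_smul_eq_nsmul ℂ, smul_smul]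
        have : (k : ℂ) ≠ 0 := by exact_mod_cast hk0
        push_cast
        rw [inv_mul_cancel₀ this, one_smul]
      · rw [← Complex.ofReal_inv, Complex.coe_smul]
    rw [e0]
    ext p q
    rw [Matrix.smul_apply, Matrix.sum_apply]
    simp only [mapTensor_measMap_apply]
    split_ifs
    · have e1 : ∀ X : Matrix (A × B) (A × B) ℂ, ∀ c : ℂ, ∀ N,
          partialTraceMul N (c • X) = c • partialTraceMul N X := by
        intro X c N
        ext i j
        simp only [partialTraceMul, of_apply, Matrix.smul_apply, smul_eq_mul, Finset.mul_sum]
        exact Finset.sum_congr rfl fun _ _ => Finset.sum_congr rfl fun _ _ => by ring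
      rw [e1, map_smul, partialTraceMul_sum, map_sum, Matrix.smul_apply, Matrix.sum_apply,
        ← Complex.ofReal_inv, Complex.coe_smul]
    · simp
  rw [e]
  exact (traceNorm_smul_le (by positivity) _).trans
    (mul_le_mul_of_nonneg_left (traceNorm_sum_le _ _) (by positivity))

/-- The de Finetti theorem for a fixed measurement, with an explicit separable state. -/
theorem averageState_spec (hk : 1 ≤ k) (hR : IsExtension k ρ R) (hM : IsPOVM M)
    {μ : Measure Ω} [IsProbabilityMeasure μ] {E : Ω → Matrix A A ℂ →ₗ[ℂ] Matrix A' A' ℂ}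
    (hE : ∀ m, IsChannel (E m)) (hEm : ∀ X i j, Measurable fun m => E m X i j) :
    Integrable (fun m => traceNorm (mapTensor (E m) (measMap M) (ρ - averageState R M))) μ ∧
    ∫ m, traceNorm (mapTensor (E m) (measMap M) (ρ - averageState R M)) ∂μ
      ≤ √(2 * Real.log (Fintype.card A') / k) := by
  have hk0 : (0 : ℝ) < k := by exact_mod_cast hk
  set f : Fin k → Ω → ℝ := fun j m => traceNorm (mapTensor (E m) (measMap M)
        (ρ - conditionedState R (prefixEffects M k j) j)) with hf
  have hi1 : ∀ j, Integrable (f j) μ := fun j =>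
    (isInstrument_prefixEffects R hM j j.2.le).integrable_traceNorm hR μ hE hEm hM
  have hi2 : ∀ j, Integrable (fun m => f j m ^ 2) μ := fun j =>
    (isInstrument_prefixEffects R hM j j.2.le).integrable_traceNorm_sq hR μ hE hEm hM
  have hs : Integrable (fun m => (k : ℝ)⁻¹ * ∑ j, f j m) μ :=
    (integrable_finsetSum _ fun j _ => hi1 j).const_mul _
  have hle : ∀ m, traceNorm (mapTensor (E m) (measMap M) (ρ - averageState R M)) ≤
      (k : ℝ)⁻¹ * ∑ j, f j m := fun m => traceNorm_averageState_le hk (E m)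
  have hint : Integrable
      (fun m => traceNorm (mapTensor (E m) (measMap M) (ρ - averageState R M))) μ := by
    refine hs.mono' (measurable_traceNorm_mapTensor hEm M _).aestronglyMeasurable
      (Filter.Eventually.of_forall fun m => ?_)
    rw [Real.norm_of_nonneg (traceNorm_nonneg _)]
    exact hle m
  refine ⟨hint, ?_⟩
  have h1 := integral_mono hint hs hle
  rw [integral_const_mul, integral_finsetSum _ fun j _ => hi1 j] at h1
  refine h1.trans (Real.le_sqrt_of_sq_le ?_)
  -- Cauchy–Schwarz over `j` costs a factor `k`; the average carries `k⁻²` after squaring, which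
  -- leaves `1 / k`.
  have h2 : (∑ j, ∫ m, f j m ∂μ) ^ 2 ≤ k * ∑ j, (∫ m, f j m ∂μ) ^ 2 := by
    simpa using sq_sum_le_card_mul_sum_sq (s := Finset.univ) (f := fun j => ∫ m, f j m ∂μ)
  have h3 : ∑ j, (∫ m, f j m ∂μ) ^ 2 ≤ ∑ j, ∫ m, f j m ^ 2 ∂μ :=
    Finset.sum_le_sum fun j _ => sq_integral_le_integral_sq (hi1 j) (hi2 j)
  have h4 : ∑ j, ∫ m, f j m ^ 2 ∂μ ≤ 2 * Real.log (Fintype.card A') := by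
    rw [← integral_finsetSum _ fun j _ => hi2 j]
    have := integral_mono (integrable_finsetSum _ fun j _ => hi2 j)
      (integrable_const (2 * Real.log (Fintype.card A'))) fun m =>
        sum_sq_traceNorm_le hk hR hM (hE m)
    simpa using this
  rw [mul_pow]
  calc ((k : ℝ)⁻¹) ^ 2 * (∑ j, ∫ m, f j m ∂μ) ^ 2
      ≤ ((k : ℝ)⁻¹) ^ 2 * (k * (2 * Real.log (Fintype.card A'))) := by
        refine mul_le_mul_of_nonneg_left ?_ (by positivity)
        exact h2.trans (mul_le_mul_of_nonneg_left (h3.trans h4) hk0.le)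
    _ = _ := by field_simp

end FixedMeasurement

end LocalMeasurements

end QDF

end

noncomputable section

namespace QDF

open Matrix

set_option linter.unusedSectionVars false

/-! ### Non-signaling conditional distributions -/

section NonSignaling

universe w

variable {X A B : Type*} {Y : Type w} [Fintype X] [Fintype Y] [DecidableEq Y] {k : ℕ}

/-- The weight of the output `x` and of the effects `e i` on the outputs `y_i`. -/
def condWeight (P : X × (Fin k → Y) → A × (Fin k → B) → ℝ) (e : Fin k → Y → ℝ) (x : X) (a : A)
    (b : Fin k → B) : ℝ :=
  ∑ y, P (x, y) (a, b) * ∏ i, e i (y i)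

/-- The effect of the output `z`. -/
def indicatorEffect (z : Y) : Y → ℝ := fun y => if y = z then 1 else 0

lemma sum_indicatorEffect (y : Y) : ∑ z, indicatorEffect z y = 1 := by
  simp [indicatorEffect]

lemma prod_update_eq (e : Fin k → Y → ℝ) (j : Fin k) (g : Y → ℝ) (y : Fin k → Y) :
    ∏ i, Function.update e j g i (y i) = g (y j) * ∏ i ∈ Finset.univ.erase j, e i (y i) := by
  rw [← Finset.mul_prod_erase _ _ (Finset.mem_univ j), Function.update_self]
  congr 1
  exact Finset.prod_congr rfl fun i hi => by
    rw [Function.update_of_ne (Finset.ne_of_mem_erase hi)]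

lemma prod_update_of_eq_one {e : Fin k → Y → ℝ} {j : Fin k} (he : e j = 1) (g : Y → ℝ)
    (y : Fin k → Y) :
    ∏ i, Function.update e j g i (y i) = g (y j) * ∏ i, e i (y i) := by
  rw [prod_update_eq, ← Finset.mul_prod_erase Finset.univ (fun i => e i (y i))
    (Finset.mem_univ j), he, Pi.one_apply, one_mul]

/-- Exchanging `y j` with `z` is an involution on the pairs `(y, z)`. It exposes a free sum over the
output `j`, to which non-signaling applies. -/
lemma sum_update_eq (j : Fin k) (g : (Fin k → Y) → ℝ) :
    ∑ y, ∑ z, g (Function.update y j z) = Fintype.card Y * ∑ y, g y := by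
  have hinv : Function.Involutive
      (fun p : (Fin k → Y) × Y => (Function.update p.1 j p.2, p.1 j)) := by
    rintro ⟨y, z⟩
    simp
  have h := Equiv.sum_comp hinv.toPerm (fun p : (Fin k → Y) × Y => g p.1)
  rw [Fintype.sum_prod_type, Fintype.sum_prod_type] at h
  simp only [Function.Involutive.coe_toPerm, Finset.sum_const, Finset.card_univ,
    nsmul_eq_mul] at h
  rw [h, Finset.mul_sum]

section

variable {P : X × (Fin k → Y) → A × (Fin k → B) → ℝ}

lemma condWeight_nonneg (hP : IsCondDist P) {e : Fin k → Y → ℝ} (he : ∀ i y, 0 ≤ e i y)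
    (x : X) (a : A) (b : Fin k → B) : 0 ≤ condWeight P e x a b :=
  Finset.sum_nonneg fun _ _ => mul_nonneg (hP.1 _ _) (Finset.prod_nonneg fun _ _ => he _ _)

lemma sum_condWeight_eq (hP : IsNonSignaling P) (e : Fin k → Y → ℝ) (a a' : A) (b : Fin k → B) :
    ∑ x, condWeight P e x a b = ∑ x, condWeight P e x a' b := by
  simp only [condWeight]
  rw [Finset.sum_comm, Finset.sum_comm (s := (Finset.univ : Finset X))]
  refine Finset.sum_congr rfl fun y _ => ?_
  rw [← Finset.sum_mul, ← Finset.sum_mul, hP.1 y a a' b]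

/-- An unobserved output is summed over, so by non-signaling its input is irrelevant.
`sum_update_eq` isolates that sum at the price of the factor `|Y|`, which is cancelled. -/
lemma condWeight_update (hP : IsNonSignaling P) {e : Fin k → Y → ℝ} {j : Fin k} (he : e j = 1)
    (x : X) (a : A) (b : Fin k → B) (β : B) :
    condWeight P e x a (Function.update b j β) = condWeight P e x a b := by
  rcases isEmpty_or_nonempty Y with hY | hY
  · have : IsEmpty (Fin k → Y) := ⟨fun y => hY.elim (y j)⟩
    simp [condWeight]
  have hc : (Fintype.card Y : ℝ) ≠ 0 := by
    have : 0 < Fintype.card Y := Fintype.card_pos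
    positivity
  refine mul_left_cancel₀ hc ?_
  simp only [condWeight]
  rw [← sum_update_eq j, ← sum_update_eq j]
  refine Finset.sum_congr rfl fun y _ => ?_
  have hw : ∀ z, ∏ i, e i (Function.update y j z i) = ∏ i ∈ Finset.univ.erase j, e i (y i) := by
    intro z
    rw [← Finset.mul_prod_erase _ _ (Finset.mem_univ j), he, Pi.one_apply, one_mul]
    exact Finset.prod_congr rfl fun i hi => by
      rw [Function.update_of_ne (Finset.ne_of_mem_erase hi)]
  simp only [hw, ← Finset.sum_mul]
  rw [hP.2 j x y a (Function.update b j β) b fun i hi => Function.update_of_ne hi _ _]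

lemma sum_condWeight_update_indicator {e : Fin k → Y → ℝ} {j : Fin k} (he : e j = 1)
    (x : X) (a : A) (b : Fin k → B) :
    ∑ z, condWeight P (Function.update e j (indicatorEffect z)) x a b = condWeight P e x a b := by
  simp only [condWeight]
  rw [Finset.sum_comm]
  refine Finset.sum_congr rfl fun y _ => ?_
  simp only [prod_update_of_eq_one he]
  rw [← Finset.mul_sum, ← Finset.sum_mul, sum_indicatorEffect, one_mul]

end

/-- A family of effects on the first `j` outputs that describes all outcomes of an observation. -/
structure IsOutcomeFamily (j : ℕ) {T : Type*} [Fintype T] (e : T → Fin k → Y → ℝ) : Prop where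
  nonneg : ∀ t i y, 0 ≤ e t i y
  eq_one : ∀ t (i : Fin k), j ≤ (i : ℕ) → e t i = 1
  sum_prod : ∀ y : Fin k → Y, ∑ t, ∏ i, e t i (y i) = 1

lemma isOutcomeFamily_one {T : Type*} [Unique T] [Fintype T] :
    IsOutcomeFamily 0 (fun _ : T => (1 : Fin k → Y → ℝ)) where
  nonneg _ _ _ := zero_le_one
  eq_one _ _ _ := rfl
  sum_prod _ := by simp

variable {P : X × (Fin k → Y) → A × (Fin k → B) → ℝ} {p : X × Y → A × B → ℝ}
  {T : Type*} [Fintype T] {e : T → Fin k → Y → ℝ}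

lemma IsOutcomeFamily.refine {j : Fin k} (he : IsOutcomeFamily j e) :
    IsOutcomeFamily (j + 1) fun s : T × Y => Function.update (e s.1) j (indicatorEffect s.2) where
  nonneg s i y := by
    by_cases h : i = j
    · subst h
      simp only [Function.update_self, indicatorEffect]
      split_ifs <;> norm_num
    · simpa [h] using he.nonneg s.1 i y
  eq_one s i hi := by
    have h : i ≠ j := fun h => by subst h; omega
    rw [Function.update_of_ne h, he.eq_one s.1 i (by omega)]
  sum_prod y := by
    rw [Fintype.sum_prod_type, ← he.sum_prod y]
    refine Finset.sum_congr rfl fun t _ => ?_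
    simp only [prod_update_of_eq_one (he.eq_one t j le_rfl)]
    rw [← Finset.sum_mul, sum_indicatorEffect, one_mul]

lemma IsOutcomeFamily.sum_condWeight {j : ℕ} (he : IsOutcomeFamily j e) (hP : IsCondDist P)
    (a : A) (b : Fin k → B) : ∑ t, ∑ x, condWeight P (e t) x a b = 1 := by
  rw [← hP.2 (a, b), Fintype.sum_prod_type, Finset.sum_comm]
  refine Finset.sum_congr rfl fun x _ => ?_
  simp only [condWeight]
  rw [Finset.sum_comm]
  refine Finset.sum_congr rfl fun y _ => ?_
  rw [← Finset.mul_sum, he.sum_prod, mul_one]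

lemma IsOutcomeFamily.sum_condWeight_indicator {j : Fin k} (he : IsOutcomeFamily j e)
    (hp : ∀ x y a (b : Fin k → B),
      ∑ y' : Fin k → Y, (if y' j = y then P (x, y') (a, b) else 0) = p (x, y) (a, b j))
    (x : X) (z : Y) (a : A) (b : Fin k → B) :
    ∑ t, condWeight P (Function.update (e t) j (indicatorEffect z)) x a b = p (x, z) (a, b j) := by
  rw [← hp]
  simp only [condWeight]
  rw [Finset.sum_comm]
  refine Finset.sum_congr rfl fun y _ => ?_
  simp only [prod_update_of_eq_one (he.eq_one _ j le_rfl)]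
  rw [← Finset.mul_sum, ← Finset.mul_sum, he.sum_prod, mul_one, indicatorEffect]
  simp

/-- The weights as a diagonal matrix. -/
def boxMatrix [DecidableEq X] (P : X × (Fin k → Y) → A × (Fin k → B) → ℝ) (e : Fin k → Y → ℝ)
    (a : A) (b : Fin k → B) : Matrix X X ℂ :=
  diagonal fun x => (condWeight P e x a b : ℂ)

lemma boxMatrix_posSemidef [DecidableEq X] (hP : IsCondDist P) {e : Fin k → Y → ℝ}
    (he : ∀ i y, 0 ≤ e i y) (a : A) (b : Fin k → B) : (boxMatrix P e a b).PosSemidef := by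
  rw [boxMatrix, posSemidef_diagonal_iff]
  intro x
  exact_mod_cast condWeight_nonneg hP he x a b

lemma trace_boxMatrix_re [DecidableEq X] (e : Fin k → Y → ℝ) (a : A) (b : Fin k → B) :
    (boxMatrix P e a b).trace.re = ∑ x, condWeight P e x a b := by
  rw [boxMatrix, trace_diagonal, Complex.re_sum]; simp

/-- The local hidden variable distribution given by conditioning on the effects. -/
def conditionedBox (P : X × (Fin k → Y) → A × (Fin k → B) → ℝ) (e : T → Fin k → Y → ℝ)
    (j : Fin k) (b : Fin k → B) (o : X × Y) (i : A × B) : ℝ :=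
  ∑ t, (∑ x, condWeight P (Function.update (e t) j (indicatorEffect o.2)) x i.1
      (Function.update b j i.2)) /
    (∑ x, condWeight P (e t) x i.1 (Function.update b j i.2)) *
    condWeight P (e t) o.1 i.1 (Function.update b j i.2)

lemma IsOutcomeFamily.isLHV_conditionedBox [Nonempty A] [Nonempty B] {j : Fin k}
    (he : IsOutcomeFamily j e) (hP : IsCondDist P) (hns : IsNonSignaling P) (b : Fin k → B) :
    IsLHV (conditionedBox P e j b) := by
  obtain ⟨a₀⟩ := ‹Nonempty A›
  obtain ⟨b₀⟩ := ‹Nonempty B›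
  have hupd : ∀ t z i y, 0 ≤ Function.update (e t) j (indicatorEffect z) i y := fun t z =>
    he.refine.nonneg (t, z)
  have hXY : Nonempty (X × (Fin k → Y)) := by
    by_contra hc
    rw [not_nonempty_iff] at hc
    have := hP.2 (a₀, fun _ => b₀)
    simp at this
  have hX : Nonempty X := ⟨hXY.some.1⟩
  have hY : Nonempty Y := ⟨hXY.some.2 j⟩
  set V : T → ℝ := fun t => ∑ x, condWeight P (e t) x a₀ b with hV
  have hVn : ∀ t, 0 ≤ V t := fun t =>
    Finset.sum_nonneg fun x _ => condWeight_nonneg hP (he.nonneg t) _ _ _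
  have hVa : ∀ t a, ∑ x, condWeight P (e t) x a b = V t := fun t a =>
    sum_condWeight_eq hns _ _ _ _
  have hW0 : ∀ t x a, V t = 0 → condWeight P (e t) x a b = 0 := by
    intro t x a h
    rw [← hVa t a, Finset.sum_eq_zero_iff_of_nonneg fun x _ =>
      condWeight_nonneg hP (he.nonneg t) _ _ _] at h
    exact h x (Finset.mem_univ x)
  have hU : ∀ t β, ∑ z, ∑ x, condWeight P (Function.update (e t) j (indicatorEffect z)) x a₀
      (Function.update b j β) = V t := by
    intro t β
    rw [Finset.sum_comm]
    simp only [sum_condWeight_update_indicator (he.eq_one t j le_rfl),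
      condWeight_update hns (he.eq_one t j le_rfl), hV]
  -- The hidden variable is the outcome `t`, of probability `V t`. By non-signaling `V t` does not
  -- depend on the inputs `a` and `β`, the response `q` not on `β`, and `r` not on `a`. Outcomes of
  -- probability zero get uniform responses.
  let q : T → X → A → ℝ := fun t x a =>
    if V t = 0 then (Fintype.card X : ℝ)⁻¹ else condWeight P (e t) x a b / V t
  let r : T → Y → B → ℝ := fun t z β =>
    if V t = 0 then (Fintype.card Y : ℝ)⁻¹ else
      (∑ x, condWeight P (Function.update (e t) j (indicatorEffect z)) x a₀
        (Function.update b j β)) / V t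
  have hq : ∀ t, IsCondDist (q t) := by
    intro t
    refine ⟨fun x a => ?_, fun a => ?_⟩
    · simp only [q]
      split_ifs
      · positivity
      · exact div_nonneg (condWeight_nonneg hP (he.nonneg t) _ _ _) (hVn t)
    · simp only [q]
      split_ifs with h
      · simp
      · rw [← Finset.sum_div, hVa, div_self h]
  have hr : ∀ t, IsCondDist (r t) := by
    intro t
    refine ⟨fun z β => ?_, fun β => ?_⟩
    · simp only [r]
      split_ifs
      · positivity
      · exact div_nonneg (Finset.sum_nonneg fun x _ =>
          condWeight_nonneg hP (hupd t z) _ _ _) (hVn t)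
    · simp only [r]
      split_ifs with h
      · simp
      · rw [← Finset.sum_div, hU, div_self h]
  have hsum : ∑ t, V t = 1 := he.sum_condWeight hP a₀ b
  let φ := (Fintype.equivFin T).symm
  refine ⟨Fintype.card T, V ∘ φ, q ∘ φ, r ∘ φ, fun i => hVn _, ?_, fun i => hq _,
    fun i => hr _, fun x z a β => ?_⟩
  · rw [← hsum]; exact φ.sum_comp V
  · rw [show ∑ i, (V ∘ φ) i * (q ∘ φ) i x a * (r ∘ φ) i z β = ∑ t, V t * q t x a * r t z β from
      φ.sum_comp fun t => V t * q t x a * r t z β]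
    simp only [conditionedBox]
    refine Finset.sum_congr rfl fun t _ => ?_
    rw [condWeight_update hns (he.eq_one t j le_rfl)]
    simp only [condWeight_update hns (he.eq_one t j le_rfl)]
    rw [hVa, sum_condWeight_eq hns _ a a₀]
    by_cases h : V t = 0
    · rw [hW0 t x a h, h]; simp
    · simp only [q, r, if_neg h]
      field_simp

/-- The ensemble estimate for diagonal matrices. The input `β` may also be inserted into the
entropies before the observation, because the output `j` is not yet observed there. -/
lemma IsOutcomeFamily.sq_sum_abs_le [DecidableEq X] {j : Fin k} (he : IsOutcomeFamily j e)
    (hP : IsCondDist P) (hns : IsNonSignaling P)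
    (hp : ∀ x y a (b : Fin k → B),
      ∑ y' : Fin k → Y, (if y' j = y then P (x, y') (a, b) else 0) = p (x, y) (a, b j))
    (a : A) (b : Fin k → B) (β : B) :
    (∑ x, ∑ y, |p (x, y) (a, β) - conditionedBox P e j b (x, y) (a, β)|) ^ 2 ≤
    2 * (∑ s : T × Y, weightedNegEntropy (boxMatrix P
        (Function.update (e s.1) j (indicatorEffect s.2)) a (Function.update b j β)) -
      ∑ t, weightedNegEntropy (boxMatrix P (e t) a b)) := by
  have hb : ∀ t, boxMatrix P (e t) a b = boxMatrix P (e t) a (Function.update b j β) := by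
    intro t
    simp only [boxMatrix, condWeight_update hns (he.eq_one t j le_rfl)]
  simp only [hb]
  set b' := Function.update b j β with hb'
  have hsum : ∀ t, ∑ z, boxMatrix P (Function.update (e t) j (indicatorEffect z)) a b' =
      boxMatrix P (e t) a b' := by
    intro t
    ext x x'
    rw [Matrix.sum_apply]
    by_cases h : x = x'
    · subst h
      simp only [boxMatrix, diagonal_apply_eq]
      rw [← sum_condWeight_update_indicator (he.eq_one t j le_rfl)]
      push_cast; rfl
    · simp [boxMatrix, h]
  have hmain := sq_sum_traceNorm_le (ω := fun t z =>
      boxMatrix P (Function.update (e t) j (indicatorEffect z)) a b')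
    (fun t z => boxMatrix_posSemidef hP (he.refine.nonneg (t, z)) a b') (by
      simp only [trace_boxMatrix_re]
      rw [← Fintype.sum_prod_type']
      exact (he.refine.sum_condWeight hP a b').le)
  simp only [hsum, trace_boxMatrix_re] at hmain
  rw [Fintype.sum_prod_type]
  refine le_trans (pow_le_pow_left₀ (Finset.sum_nonneg fun _ _ => Finset.sum_nonneg fun _ _ =>
    abs_nonneg _) ?_ 2) hmain
  have hle : ∀ t z, ∑ x, |condWeight P (Function.update (e t) j (indicatorEffect z)) x a b' -
      (∑ x, condWeight P (Function.update (e t) j (indicatorEffect z)) x a b') /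
        (∑ x, condWeight P (e t) x a b') * condWeight P (e t) x a b'| ≤
      traceNorm (boxMatrix P (Function.update (e t) j (indicatorEffect z)) a b' -
        ((∑ x, condWeight P (Function.update (e t) j (indicatorEffect z)) x a b') /
        (∑ x, condWeight P (e t) x a b')) • boxMatrix P (e t) a b') := by
    intro t z
    refine (sum_abs_le_traceNorm_diagonal _).trans (le_of_eq ?_)
    congr 1
    ext x x'
    by_cases h : x = x'
    · subst h
      simp [boxMatrix]
    · simp [boxMatrix, h]
  refine le_trans ?_ (Finset.sum_le_sum fun t _ => Finset.sum_le_sum fun z _ => hle t z)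
  have e1 : ∀ x z, p (x, z) (a, β) - conditionedBox P e j b (x, z) (a, β) =
      ∑ t, (condWeight P (Function.update (e t) j (indicatorEffect z)) x a b' -
      (∑ x, condWeight P (Function.update (e t) j (indicatorEffect z)) x a b') /
        (∑ x, condWeight P (e t) x a b') * condWeight P (e t) x a b') := by
    intro x z
    rw [Finset.sum_sub_distrib, he.sum_condWeight_indicator hp, hb', Function.update_self]
    rfl
  simp only [e1]
  calc _ ≤ ∑ x, ∑ z, ∑ t, |condWeight P (Function.update (e t) j (indicatorEffect z)) x a b' -
      (∑ x, condWeight P (Function.update (e t) j (indicatorEffect z)) x a b') /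
        (∑ x, condWeight P (e t) x a b') * condWeight P (e t) x a b'| :=
        Finset.sum_le_sum fun x _ => Finset.sum_le_sum fun z _ => Finset.abs_sum_le_sum_abs _ _
    _ = _ := by
        rw [Finset.sum_comm]
        conv_lhs => enter [2, z]; rw [Finset.sum_comm]
        rw [Finset.sum_comm]

/-- The de Finetti theorem for non-signaling conditional distributions. -/
theorem exists_isLHV_of_isNSExtendible [Fintype A] [Nonempty B] (hk : 1 ≤ k)
    (hp : IsNSExtendible k p) {μ : A → ℝ} (hμ : ∀ a, 0 ≤ μ a) (hμ1 : ∑ a, μ a = 1) :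
    ∃ q : X × Y → A × B → ℝ, IsLHV q ∧ ∀ b : B,
      ∑ a, μ a * ∑ x, ∑ y, |p (x, y) (a, b) - q (x, y) (a, b)|
        ≤ √(2 * Real.log (Fintype.card X) / k) := by
  classical
  obtain ⟨hpc, P, hP, hns, -, hmarg⟩ := hp
  have hA : Nonempty A := by
    by_contra h
    rw [not_nonempty_iff] at h
    simp at hμ1
  obtain ⟨b₀⟩ := id ‹Nonempty B›
  by_contra hcon
  push Not at hcon
  have hk0 : (0 : ℝ) < k := by exact_mod_cast hk
  have hlog : 0 ≤ Real.log (Fintype.card X) := Real.log_natCast_nonneg _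
  have hcsq : √(2 * Real.log (Fintype.card X) / k) ^ 2 = 2 * Real.log (Fintype.card X) / k :=
    Real.sq_sqrt (by positivity)
  have hc0 := Real.sqrt_nonneg (2 * Real.log (Fintype.card X) / k)
  set c := √(2 * Real.log (Fintype.card X) / k) with hc
  -- As for measurements, except that a refutation is now an input. `b` records the chosen inputs;
  -- its entries from `j` on are fillers, since those outputs are unobserved.
  have key : ∀ j : ℕ, j ≤ k → ∃ (T : Type w) (_ : Fintype T) (e : T → Fin k → Y → ℝ)
      (b : Fin k → B) (G : A → ℝ), IsOutcomeFamily j e ∧ j * c ^ 2 ≤ ∑ a, μ a * G a ∧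
      (0 < j → j * c ^ 2 < ∑ a, μ a * G a) ∧
      ∀ a, G a ≤ 2 * (∑ t, weightedNegEntropy (boxMatrix P (e t) a b) +
        Real.log (Fintype.card X)) := by
    intro j
    induction j with
    | zero =>
      intro _
      refine ⟨PUnit.{w + 1}, inferInstance, _, fun _ => b₀, fun _ => 0, isOutcomeFamily_one,
        by simp, by simp, fun a => ?_⟩
      have h0 := isOutcomeFamily_one (k := k) (Y := Y) (T := PUnit.{w + 1})
      have h1 := neg_trace_mul_log_card_le_weightedNegEntropy
        (boxMatrix_posSemidef hP (h0.nonneg default) a fun _ => b₀)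
      have h2 := h0.sum_condWeight hP a fun _ => b₀
      simp only [Finset.univ_unique, Finset.sum_singleton] at h2
      rw [trace_boxMatrix_re, h2] at h1
      simp only [Finset.univ_unique, Finset.sum_singleton]
      linarith
    | succ j ih =>
      intro hj
      obtain ⟨T, _, e, b, G, he, hG, -, hGm⟩ := ih (by omega)
      have he' : IsOutcomeFamily ((⟨j, hj⟩ : Fin k) : ℕ) e := he
      obtain ⟨β, hβ⟩ := hcon _ (he'.isLHV_conditionedBox hP hns b)
      set N : A → ℝ := fun a =>
        ∑ x, ∑ y, |p (x, y) (a, β) - conditionedBox P e ⟨j, hj⟩ b (x, y) (a, β)| with hN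
      have hsq : (∑ a, μ a * N a) ^ 2 ≤ ∑ a, μ a * N a ^ 2 := by
        have := Finset.sum_sq_le_sum_mul_sum_of_sq_le_mul Finset.univ (r := fun a => μ a * N a)
          (f := μ) (g := fun a => μ a * N a ^ 2) (fun a _ => hμ a)
          (fun a _ => mul_nonneg (hμ a) (sq_nonneg _)) (fun a _ => le_of_eq (by ring))
        rwa [hμ1, one_mul] at this
      have hcs : c ^ 2 < _ := lt_of_lt_of_le (pow_lt_pow_left₀ hβ hc0 two_ne_zero) hsq
      refine ⟨T × Y, inferInstance, _, Function.update b ⟨j, hj⟩ β, fun a => G a + N a ^ 2,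
        he'.refine, ?_, fun _ => ?_, fun a => ?_⟩
      · simp only [mul_add, Finset.sum_add_distrib]; push_cast; linarith
      · simp only [mul_add, Finset.sum_add_distrib]; push_cast; linarith
      · have h1 := he'.sq_sum_abs_le hP hns (hmarg ⟨j, hj⟩) a b β
        have h2 := hGm a
        simp only [hN]
        linarith
  obtain ⟨T, _, e, b, G, he, -, hGi, hGm⟩ := key k le_rfl
  have h1 := hGi hk
  have h2 : ∑ a, μ a * G a ≤ ∑ a, μ a * (2 * Real.log (Fintype.card X)) := by
    refine Finset.sum_le_sum fun a _ => mul_le_mul_of_nonneg_left ?_ (hμ a)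
    have h3 := hGm a
    have h4 : ∑ t, weightedNegEntropy (boxMatrix P (e t) a b) ≤ 0 :=
      Finset.sum_nonpos fun t _ => weightedNegEntropy_nonpos
        (boxMatrix_posSemidef hP (he.nonneg t) a b)
    linarith
  rw [← Finset.sum_mul, hμ1, one_mul] at h2
  rw [hcsq, mul_div_cancel₀ _ hk0.ne'] at h1
  linarith

end NonSignaling

end QDF

end

noncomputable section

namespace QDF

/-! ### Total correctness and polynomial running time of programs -/

section MachineLogic

/-- The registers of index at least `17` are not read. -/
def NExp.readsLow : NExp → Bool
  | lit _ => true
  | reg i => decide (i < 17)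
  | add e f => e.readsLow && f.readsLow
  | sub e f => e.readsLow && f.readsLow
  | mul e f => e.readsLow && f.readsLow
  | div e f => e.readsLow && f.readsLow
  | mod e f => e.readsLow && f.readsLow

def RExp.readsLow : RExp → Bool
  | nat e => e.readsLow
  | read _ e => e.readsLow
  | add e f => e.readsLow && f.readsLow
  | sub e f => e.readsLow && f.readsLow
  | mul e f => e.readsLow && f.readsLow
  | div e f => e.readsLow && f.readsLow

/-- A bound on the cost of an expression when the registers are at most `L`. -/
def NExp.costBound (L : ℕ) : NExp → ℕ
  | lit n => 1 + n.size
  | reg _ => 1 + L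
  | add e f => e.costBound L + f.costBound L + 1
  | sub e f => e.costBound L + f.costBound L + 1
  | mul e f => e.costBound L + f.costBound L + 1
  | div e f => e.costBound L + f.costBound L + 1
  | mod e f => e.costBound L + f.costBound L + 1

def RExp.costBound (L : ℕ) : RExp → ℕ
  | nat e => e.costBound L + 1
  | read _ e => e.costBound L + 1
  | add e f => e.costBound L + f.costBound L + 1
  | sub e f => e.costBound L + f.costBound L + 1
  | mul e f => e.costBound L + f.costBound L + 1
  | div e f => e.costBound L + f.costBound L + 1

def Test.costBound (L : ℕ) : Test → ℕ
  | ltN e f => e.costBound L + f.costBound L + 1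
  | ltR e f => e.costBound L + f.costBound L + 1

/-- A bound on the number of steps when registers and numbers of iterations are at most `L`. -/
def Prog.timeBound (L : ℕ) : Prog → ℕ
  | skip => 1
  | setReg _ e => e.costBound L + 1
  | setArr _ e f => e.costBound L + f.costBound L + 1
  | seq c d => c.timeBound L + d.timeBound L
  | cond t c d => t.costBound L + (c.timeBound L + d.timeBound L)
  | loop t c => (L + 1) * (t.costBound L + c.timeBound L)

/-- The registers below `17` hold numbers that are at most `L`. -/
def RegsLe (L : ℕ) (s : MState) : Prop := ∀ i < 17, s.reg i ≤ L

/-- A crude bound on binary lengths, sufficient for a polynomial estimate. -/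
lemma size_le_self (n : ℕ) : n.size ≤ n := by
  rw [Nat.size_le]
  exact Nat.lt_two_pow_self

lemma NExp.cost_le {L : ℕ} {s : MState} (hs : RegsLe L s) {e : NExp} (he : e.readsLow = true) :
    e.cost s ≤ e.costBound L := by
  induction e with
  | lit n => simp [cost, costBound]
  | reg i =>
    have hi : i < 17 := by simpa [readsLow] using he
    have h1 := hs i hi
    have h2 := size_le_self (s.reg i)
    simp only [cost, costBound]; omega
  | add e f ihe ihf | sub e f ihe ihf | mul e f ihe ihf | div e f ihe ihf | mod e f ihe ihf =>
    simp only [readsLow, Bool.and_eq_true] at he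
    have h1 := ihe he.1
    have h2 := ihf he.2
    simp only [cost, costBound]; omega

lemma RExp.cost_le {L : ℕ} {s : MState} (hs : RegsLe L s) {e : RExp} (he : e.readsLow = true) :
    e.cost s ≤ e.costBound L := by
  induction e with
  | nat e | read v e =>
    have := NExp.cost_le hs (e := e) he
    simp only [cost, costBound]; omega
  | add e f ihe ihf | sub e f ihe ihf | mul e f ihe ihf | div e f ihe ihf =>
    simp only [readsLow, Bool.and_eq_true] at he
    have h1 := ihe he.1
    have h2 := ihf he.2
    simp only [cost, costBound]; omega

/-- Total correctness with the generic time bound. -/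
def Exec (L : ℕ) (c : Prog) (s : MState) (Q : MState → Prop) : Prop :=
  ∃ t s', Runs c s t s' ∧ t ≤ c.timeBound L ∧ RegsLe L s' ∧ Q s'

variable {L : ℕ} {c d : Prog} {s : MState} {Q Q' : MState → Prop}

lemma Exec.mono (h : Exec L c s Q) (hQ : ∀ s', Q s' → Q' s') : Exec L c s Q' := by
  obtain ⟨t, s', h1, h2, h3, h4⟩ := h
  exact ⟨t, s', h1, h2, h3, hQ _ h4⟩

lemma Exec.seq (h : Exec L c s Q) (h' : ∀ s', RegsLe L s' → Q s' → Exec L d s' Q') :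
    Exec L (.seq c d) s Q' := by
  obtain ⟨t, s', h1, h2, h3, h4⟩ := h
  obtain ⟨t', s'', h1', h2', h3', h4'⟩ := h' s' h3 h4
  exact ⟨t + t', s'', .seq h1 h1', add_le_add h2 h2', h3', h4'⟩

lemma Exec.setReg (hs : RegsLe L s) (i : ℕ) {e : NExp} (he : e.readsLow = true) (x : ℕ)
    (hx : e.eval s = x) (hxL : x ≤ L) (hQ : Q ⟨Function.update s.reg i x, s.arr⟩) :
    Exec L (.setReg i e) s Q := by
  subst hx
  refine ⟨_, _, .setReg i e s, Nat.add_le_add_right (NExp.cost_le hs he) 1, fun j hj => ?_, hQ⟩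
  by_cases h : j = i
  · subst h; simpa using hxL
  · simpa [h] using hs j hj

lemma Exec.setArr (hs : RegsLe L s) (v : ℕ) {e : NExp} {f : RExp} (he : e.readsLow = true)
    (hf : f.readsLow = true) (m : ℕ) (x : ℝ) (hm : e.eval s = m) (hx : f.eval s = x)
    (hQ : Q ⟨s.reg, Function.update s.arr v (Function.update (s.arr v) m x)⟩) :
    Exec L (.setArr v e f) s Q := by
  subst hx hm
  exact ⟨_, _, .setArr v e f s, Nat.add_le_add_right
    (add_le_add (NExp.cost_le hs he) (RExp.cost_le hs hf)) 1, hs, hQ⟩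

lemma Exec.setReg_seq (hs : RegsLe L s) (i : ℕ) {e : NExp} (he : e.readsLow = true) (x : ℕ)
    (hx : e.eval s = x) (hxL : x ≤ L)
    (h : ∀ s', s' = ⟨Function.update s.reg i x, s.arr⟩ → RegsLe L s' → Exec L d s' Q) :
    Exec L (.seq (.setReg i e) d) s Q :=
  (Exec.setReg (Q := fun s' => s' = _) hs i he x hx hxL rfl).seq fun s' hs' h' => h s' h' hs'

lemma Exec.setArr_seq (hs : RegsLe L s) (v : ℕ) {e : NExp} {f : RExp} (he : e.readsLow = true)
    (hf : f.readsLow = true) (m : ℕ) (x : ℝ) (hm : e.eval s = m) (hx : f.eval s = x)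
    (h : ∀ s', s' = ⟨s.reg, Function.update s.arr v (Function.update (s.arr v) m x)⟩ →
      RegsLe L s' → Exec L d s' Q) :
    Exec L (.seq (.setArr v e f) d) s Q :=
  (Exec.setArr (Q := fun s' => s' = _) hs v he hf m x hm hx rfl).seq fun s' hs' h' => h s' h' hs'

/-- The registers and arrays that a program may change. -/
def Prog.regsWritten : Prog → List ℕ
  | skip => []
  | setReg i _ => [i]
  | setArr _ _ _ => []
  | seq c d => c.regsWritten ++ d.regsWritten
  | cond _ c d => c.regsWritten ++ d.regsWritten
  | loop _ c => c.regsWritten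

def Prog.arrsWritten : Prog → List ℕ
  | skip => []
  | setReg _ _ => []
  | setArr v _ _ => [v]
  | seq c d => c.arrsWritten ++ d.arrsWritten
  | cond _ c d => c.arrsWritten ++ d.arrsWritten
  | loop _ c => c.arrsWritten

/-- The states agree except on what the program may change. -/
def AgreeOff (c : Prog) (s s' : MState) : Prop :=
  (∀ i, i ∉ c.regsWritten → s'.reg i = s.reg i) ∧ ∀ v, v ∉ c.arrsWritten → s'.arr v = s.arr v

lemma AgreeOff.refl (c : Prog) (s : MState) : AgreeOff c s s := ⟨fun _ _ => rfl, fun _ _ => rfl⟩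

lemma AgreeOff.trans {c : Prog} {s s' s'' : MState} (h : AgreeOff c s s')
    (h' : AgreeOff c s' s'') : AgreeOff c s s'' :=
  ⟨fun i hi => (h'.1 i hi).trans (h.1 i hi), fun v hv => (h'.2 v hv).trans (h.2 v hv)⟩

lemma AgreeOff.of_subset {c d : Prog} {s s' : MState} (h : AgreeOff c s s')
    (hr : c.regsWritten ⊆ d.regsWritten) (ha : c.arrsWritten ⊆ d.arrsWritten) :
    AgreeOff d s s' :=
  ⟨fun i hi => h.1 i fun hc => hi (hr hc), fun v hv => h.2 v fun hc => hv (ha hc)⟩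

/-- A frame rule: what is written is read off the syntax, so preservation of memory reduces to
decidable list membership. -/
lemma Runs.agreeOff {c : Prog} {s s' : MState} {t : ℕ} (h : Runs c s t s') : AgreeOff c s s' := by
  induction h with
  | skip s => exact .refl _ _
  | setReg i e s =>
    refine ⟨fun j hj => ?_, fun _ _ => rfl⟩
    have : j ≠ i := by simpa [Prog.regsWritten] using hj
    simp [this]
  | setArr v e f s =>
    refine ⟨fun _ _ => rfl, fun u hu => ?_⟩
    have : u ≠ v := by simpa [Prog.arrsWritten] using hu
    simp [this]
  | seq h1 h2 ih1 ih2 =>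
    exact (ih1.of_subset (List.subset_append_left _ _) (List.subset_append_left _ _)).trans
      (ih2.of_subset (List.subset_append_right _ _) (List.subset_append_right _ _))
  | cond_true _ h ih =>
    exact ih.of_subset (List.subset_append_left _ _) (List.subset_append_left _ _)
  | cond_false _ h ih =>
    exact ih.of_subset (List.subset_append_right _ _) (List.subset_append_right _ _)
  | loop_true _ h1 h2 ih1 ih2 =>
    exact (ih1.of_subset (d := .loop _ _) (List.Subset.refl _) (List.Subset.refl _)).trans ih2
  | loop_false _ => exact .refl _ _

lemma Exec.agreeOff (h : Exec L c s Q) : Exec L c s fun s' => AgreeOff c s s' ∧ Q s' := by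
  obtain ⟨t, s', h1, h2, h3, h4⟩ := h
  exact ⟨t, s', h1, h2, h3, h1.agreeOff, h4⟩

/-- `for i := 0, …, e - 1 do c`. -/
def Prog.forLoop (i : ℕ) (e : NExp) (c : Prog) : Prog :=
  .seq (.setReg i (.lit 0))
    (.loop (.ltN (.reg i) e) (.seq c (.setReg i (.add (.reg i) (.lit 1)))))

/-- Induction on the number `r` of remaining iterations; `r + 1` counts the final failing test. -/
lemma Exec.forLoop_aux {i N : ℕ} {e : NExp} {body : Prog} (hi : i < 17)
    (hib : i ∉ body.regsWritten) (he : e.readsLow = true) (hN : N ≤ L) (Inv : ℕ → MState → Prop)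
    (hInv : ∀ m s' x, Inv m s' → Inv m ⟨Function.update s'.reg i x, s'.arr⟩)
    (heN : ∀ m s', Inv m s' → e.eval s' = N)
    (hbody : ∀ m < N, ∀ s', RegsLe L s' → s'.reg i = m → Inv m s' →
      Exec L body s' (Inv (m + 1))) (r : ℕ) :
    ∀ m s, m + r = N → RegsLe L s → s.reg i = m → Inv m s →
      ∃ t s', Runs (.loop (.ltN (.reg i) e) (.seq body (.setReg i (.add (.reg i) (.lit 1))))) s t s'
        ∧ t ≤ (r + 1) * ((Test.ltN (.reg i) e).costBound L +
          (Prog.seq body (.setReg i (.add (.reg i) (.lit 1)))).timeBound L) ∧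
        RegsLe L s' ∧ Inv N s' := by
  have hcost : ∀ s, RegsLe L s →
      (Test.ltN (.reg i) e).cost s ≤ (Test.ltN (.reg i) e).costBound L := by
    intro s hs
    have h1 := NExp.cost_le hs (e := .reg i) (by simp [NExp.readsLow, hi])
    have h2 := NExp.cost_le hs he
    simp only [Test.cost, Test.costBound]; omega
  induction r with
  | zero =>
    intro m s hm hs hsi hI
    have hmN : m = N := by omega
    subst hmN
    refine ⟨_, s, .loop_false ?_, ?_, hs, hI⟩
    · simp only [Test.Holds, NExp.eval, heN m s hI, hsi]; omega
    · have := hcost s hs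
      omega
  | succ r ih =>
    intro m s hm hs hsi hI
    obtain ⟨t1, s1, hr1, ht1, hs1, hI1⟩ := hbody m (by omega) s hs hsi hI
    have hreg : s1.reg i = m := (hr1.agreeOff.1 i hib).trans hsi
    have hset : Exec L (.setReg i (.add (.reg i) (.lit 1))) s1
        fun s' => s' = ⟨Function.update s1.reg i (m + 1), s1.arr⟩ :=
      Exec.setReg hs1 i (by simp [NExp.readsLow, hi]) (m + 1) (by simp [NExp.eval, hreg])
        (by omega) rfl
    obtain ⟨t2, s2, hr2, ht2, hs2, hI2⟩ := hset
    obtain ⟨t3, s3, hr3, ht3, hs3, hI3⟩ := ih (m + 1) s2 (by omega) hs2 (by rw [hI2]; simp)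
      (by rw [hI2]; exact hInv _ _ _ hI1)
    refine ⟨_, s3, .loop_true ?_ (.seq hr1 hr2) hr3, ?_, hs3, hI3⟩
    · simp only [Test.Holds, NExp.eval, heN m s hI, hsi]; omega
    · have h1 := hcost s hs
      have h2 : t1 + t2 ≤ (Prog.seq body (.setReg i (.add (.reg i) (.lit 1)))).timeBound L :=
        add_le_add ht1 ht2
      calc _ ≤ (Test.ltN (.reg i) e).costBound L +
            (Prog.seq body (.setReg i (.add (.reg i) (.lit 1)))).timeBound L + _ :=
            add_le_add (add_le_add h1 h2) ht3
        _ = _ := by ring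

/-- The frame condition is carried inside the invariant, so that `Inv` need only describe what the
loop computes. The bound `N ≤ L` is what makes the generic `timeBound` of a loop valid. -/
lemma Exec.forLoop {i N : ℕ} {e : NExp} {body : Prog} (hs : RegsLe L s) (hi : i < 17)
    (hib : i ∉ body.regsWritten) (he : e.readsLow = true) (hN : N ≤ L) (Inv : ℕ → MState → Prop)
    (hInv : ∀ m s' x, Inv m s' → Inv m ⟨Function.update s'.reg i x, s'.arr⟩)
    (heN : ∀ s', AgreeOff (.forLoop i e body) s s' → e.eval s' = N)
    (h0 : Inv 0 s)
    (hbody : ∀ m < N, ∀ s', RegsLe L s' → AgreeOff (.forLoop i e body) s s' → s'.reg i = m →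
      Inv m s' → Exec L body s' (Inv (m + 1))) :
    Exec L (.forLoop i e body) s (Inv N) := by
  have hset : Exec L (.setReg i (.lit 0)) s
      fun s' => s' = ⟨Function.update s.reg i 0, s.arr⟩ :=
    Exec.setReg hs i rfl 0 rfl (Nat.zero_le _) rfl
  obtain ⟨t1, s1, hr1, ht1, hs1, rfl⟩ := hset
  have hmem : i ∈ (Prog.forLoop i e body).regsWritten := by
    simp [Prog.forLoop, Prog.regsWritten]
  have hsub : body.regsWritten ⊆ (Prog.forLoop i e body).regsWritten := by
    intro x hx
    simp [Prog.forLoop, Prog.regsWritten, hx]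
  have hsub' : body.arrsWritten ⊆ (Prog.forLoop i e body).arrsWritten := by
    intro x hx
    simp [Prog.forLoop, Prog.arrsWritten, hx]
  have hupd : ∀ s' x, AgreeOff (.forLoop i e body) s s' →
      AgreeOff (.forLoop i e body) s ⟨Function.update s'.reg i x, s'.arr⟩ := by
    intro s' x h
    refine ⟨fun j hj => ?_, h.2⟩
    have : j ≠ i := fun hc => hj (hc ▸ hmem)
    simpa [this] using h.1 j hj
  obtain ⟨t2, s2, hr2, ht2, hs2, hI2⟩ := Exec.forLoop_aux hi hib he hN
    (fun m s' => AgreeOff (.forLoop i e body) s s' ∧ Inv m s')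
    (fun m s' x h => ⟨hupd s' x h.1, hInv m s' x h.2⟩) (fun m s' h => heN s' h.1)
    (fun m hm s' hs' hsi h => ((hbody m hm s' hs' h.1 hsi h.2).agreeOff).mono
      fun s'' h' => ⟨h.1.trans (h'.1.of_subset hsub hsub'), h'.2⟩)
    N 0 _ (by omega) hs1 (by simp) ⟨hupd s 0 (.refl _ _), hInv _ _ _ h0⟩
  refine ⟨t1 + t2, s2, .seq hr1 hr2, ?_, hs2, hI2.2⟩
  refine add_le_add ht1 (ht2.trans ?_)
  exact Nat.mul_le_mul_right _ (by omega)

lemma exists_poly_add {f g : ℕ → ℕ} (hf : ∃ K, ∀ L, 1 ≤ L → f L ≤ K * L ^ K)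
    (hg : ∃ K, ∀ L, 1 ≤ L → g L ≤ K * L ^ K) : ∃ K, ∀ L, 1 ≤ L → f L + g L ≤ K * L ^ K := by
  obtain ⟨K, hK⟩ := hf
  obtain ⟨K', hK'⟩ := hg
  refine ⟨K + K', fun L hL => ?_⟩
  have h1 : L ^ K ≤ L ^ (K + K') := Nat.pow_le_pow_right hL (by omega)
  have h2 : L ^ K' ≤ L ^ (K + K') := Nat.pow_le_pow_right hL (by omega)
  calc f L + g L ≤ K * L ^ K + K' * L ^ K' := add_le_add (hK L hL) (hK' L hL)
    _ ≤ K * L ^ (K + K') + K' * L ^ (K + K') := by gcongr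
    _ = _ := by ring

lemma exists_poly_const (m : ℕ) : ∃ K, ∀ L, 1 ≤ L → m ≤ K * L ^ K :=
  ⟨m, fun _ hL => Nat.le_mul_of_pos_right _ (Nat.pow_pos hL)⟩

lemma NExp.exists_poly (e : NExp) : ∃ K, ∀ L, 1 ≤ L → e.costBound L ≤ K * L ^ K := by
  induction e with
  | lit n => exact exists_poly_const _
  | reg i =>
    refine ⟨2, fun L hL => ?_⟩
    simp only [costBound]
    nlinarith
  | add e f he hf | sub e f he hf | mul e f he hf | div e f he hf | mod e f he hf =>
    exact exists_poly_add (exists_poly_add he hf) (exists_poly_const 1)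

lemma RExp.exists_poly (e : RExp) : ∃ K, ∀ L, 1 ≤ L → e.costBound L ≤ K * L ^ K := by
  induction e with
  | nat e | read v e => exact exists_poly_add e.exists_poly (exists_poly_const 1)
  | add e f he hf | sub e f he hf | mul e f he hf | div e f he hf =>
    exact exists_poly_add (exists_poly_add he hf) (exists_poly_const 1)

lemma Test.exists_poly (t : Test) : ∃ K, ∀ L, 1 ≤ L → t.costBound L ≤ K * L ^ K := by
  cases t with
  | ltN e f =>
    exact exists_poly_add (exists_poly_add e.exists_poly f.exists_poly) (exists_poly_const 1)
  | ltR e f =>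
    exact exists_poly_add (exists_poly_add e.exists_poly f.exists_poly) (exists_poly_const 1)

/-- The generic time bound of a program is polynomial. -/
lemma Prog.exists_poly (c : Prog) : ∃ K, ∀ L, 1 ≤ L → c.timeBound L ≤ K * L ^ K := by
  induction c with
  | skip => exact exists_poly_const 1
  | setReg i e => exact exists_poly_add e.exists_poly (exists_poly_const 1)
  | setArr v e f =>
    exact exists_poly_add (exists_poly_add e.exists_poly f.exists_poly) (exists_poly_const 1)
  | seq c d hc hd => exact exists_poly_add hc hd
  | cond t c d hc hd => exact exists_poly_add t.exists_poly (exists_poly_add hc hd)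
  | loop t c hc =>
    obtain ⟨K, hK⟩ := exists_poly_add t.exists_poly hc
    -- The factor `L + 1 ≤ 2 * L` doubles the coefficient and raises the exponent by one.
    refine ⟨2 * K + 1, fun L hL => ?_⟩
    simp only [timeBound]
    calc (L + 1) * (t.costBound L + c.timeBound L) ≤ (2 * L) * (K * L ^ K) :=
          Nat.mul_le_mul (by omega) (hK L hL)
      _ = 2 * K * L ^ (K + 1) := by ring
      _ ≤ (2 * K + 1) * L ^ (2 * K + 1) := by
          gcongr <;> omega

end MachineLogic

end QDF

end

noncomputable section

namespace QDF

/-! ### The program and the numbers that it computes -/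

section Program

/-- The number that is `1` if the values are equal, and `0` otherwise. -/
def NExp.eqInd (e f : NExp) : NExp := .sub (.lit 1) (.add (.sub e f) (.sub f e))

/-- The number that is `1` if the first value is smaller than the second, and `0` otherwise. -/
def NExp.ltInd (e f : NExp) : NExp := .sub (.lit 1) (.sub (.add e (.lit 1)) f)

lemma NExp.eval_eqInd (s : MState) (e f : NExp) :
    (eqInd e f).eval s = if e.eval s = f.eval s then 1 else 0 := by
  simp only [eqInd, eval]
  split_ifs <;> omega

lemma NExp.eval_ltInd (s : MState) (e f : NExp) :
    (ltInd e f).eval s = if e.eval s < f.eval s then 1 else 0 := by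
  simp only [ltInd, eval]
  split_ifs <;> omega

/-- A real variable, kept in cell `0` of an array. -/
def RExp.var (v : ℕ) : RExp := .read v (.lit 0)

def Prog.setVar (v : ℕ) (f : RExp) : Prog := .setArr v (.lit 0) f

/-- The digit of `e` at the place whose value is `w`, in the base kept in register `q`. -/
def NExp.digit (e w : NExp) (q : ℕ) : NExp := .mod (.div e w) (.reg q)

/-- Column and row of the current entry of `R`, split into the indices of `A` and of the `B_i`. -/
def fstRow : NExp := .div (.reg 12) (.reg 4)
def sndRow : NExp := .mod (.reg 12) (.reg 4)
def fstCol : NExp := .div (.reg 13) (.reg 4)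
def sndCol : NExp := .mod (.reg 13) (.reg 4)

/-- Register 11 encodes the outcome string in base `n`; registers 15 and 16 hold `b ^ i` and `n ^
i`. The column index of `R` selects the row of the effect, as in `condState`. -/
def effectIndex : NExp :=
  .add (.mul (.add (.mul (.digit (.reg 11) (.reg 16) 3) (.reg 1))
    (.digit sndCol (.reg 15) 1)) (.reg 1)) (.digit sndRow (.reg 15) 1)

/-- The nested subtractions encode a disjunction: from `i = j` on, the factor is one if `i = j` or
the two digits agree. The entry of the effect is then read but multiplied by zero. -/
def factorRe : RExp :=
  .add (.mul (.nat (.ltInd (.reg 14) (.reg 8))) (.read 2 effectIndex))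
    (.nat (.mul (.sub (.lit 1) (.ltInd (.reg 14) (.reg 8)))
      (.sub (.lit 1) (.mul (.sub (.lit 1) (.eqInd (.reg 14) (.reg 8)))
        (.sub (.lit 1) (.eqInd (.digit sndRow (.reg 15) 1) (.digit sndCol (.reg 15) 1)))))))

def factorIm : RExp := .mul (.nat (.ltInd (.reg 14) (.reg 8))) (.read 3 effectIndex)

def weightStep : Prog :=
  .seq (.setVar 8 factorRe) (.seq (.setVar 9 factorIm)
  -- The new real part waits in array 10, because the old one is still needed for the imaginary
  -- part.
  (.seq (.setVar 10 (.sub (.mul (.var 6) (.var 8)) (.mul (.var 7) (.var 9))))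
  (.seq (.setVar 7 (.add (.mul (.var 6) (.var 9)) (.mul (.var 7) (.var 8))))
  (.seq (.setVar 6 (.var 10))
  (.seq (.setReg 15 (.mul (.reg 15) (.reg 1))) (.setReg 16 (.mul (.reg 16) (.reg 3))))))))

/-- Computes the weight of an entry of `R`, the product of the entries of the effects. -/
def weightProg : Prog :=
  .seq (.setVar 6 (.nat (.lit 1))) (.seq (.setVar 7 (.nat (.lit 0)))
  (.seq (.setReg 15 (.lit 1)) (.seq (.setReg 16 (.lit 1)) (.forLoop 14 (.reg 2) weightStep))))

def entryIndex : NExp := .add (.mul (.reg 12) (.reg 6)) (.reg 13)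

def outRow : NExp := .div (.reg 7) (.reg 5)
def outCol : NExp := .mod (.reg 7) (.reg 5)

/-- `condA`, `condB` and `condP` select the entries of `R` that make up the three ingredients of
`marginalProduct`: an entry of `Θ 1`, the trace at a matrix unit, and the trace of `Θ 1`. The last
is real, so one accumulator is enough for it. -/
def condA : NExp := .mul (.mul (.eqInd fstRow (.div outRow (.reg 1)))
  (.eqInd fstCol (.div outCol (.reg 1))))
  (.eqInd (.digit sndRow (.reg 9) 1) (.digit sndCol (.reg 9) 1))

def condB : NExp := .mul (.mul (.eqInd fstRow fstCol)
  (.eqInd (.digit sndRow (.reg 9) 1) (.mod outRow (.reg 1))))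
  (.eqInd (.digit sndCol (.reg 9) 1) (.mod outCol (.reg 1)))

def condP : NExp := .mul (.eqInd fstRow fstCol)
  (.eqInd (.digit sndRow (.reg 9) 1) (.digit sndCol (.reg 9) 1))

def accumulate (v : ℕ) (e : NExp) (u : ℕ) : Prog :=
  .setVar v (.add (.var v) (.mul (.nat e) (.var u)))

def entryProg : Prog :=
  .seq weightProg
  (.seq (.setVar 16 (.sub (.mul (.read 0 entryIndex) (.var 6))
    (.mul (.read 1 entryIndex) (.var 7))))
  (.seq (.setVar 17 (.add (.mul (.read 0 entryIndex) (.var 7))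
    (.mul (.read 1 entryIndex) (.var 6))))
  (.seq (accumulate 11 condA 16) (.seq (accumulate 12 condA 17)
  (.seq (accumulate 13 condB 16) (.seq (accumulate 14 condB 17) (accumulate 15 condP 16)))))))

def rowProg : Prog := .forLoop 13 (.reg 6) entryProg

/-- Adds the contribution of one outcome to an entry of the output. -/
def outcomeProg : Prog :=
  .seq (.setVar 11 (.nat (.lit 0))) (.seq (.setVar 12 (.nat (.lit 0)))
  (.seq (.setVar 13 (.nat (.lit 0))) (.seq (.setVar 14 (.nat (.lit 0)))
  (.seq (.setVar 15 (.nat (.lit 0)))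
  (.seq (.forLoop 12 (.reg 6) rowProg)
  (.seq (.setArr 4 (.reg 7) (.add (.read 4 (.reg 7)) (.div (.div
    (.sub (.mul (.var 11) (.var 13)) (.mul (.var 12) (.var 14))) (.var 15)) (.nat (.reg 2)))))
  (.setArr 5 (.reg 7) (.add (.read 5 (.reg 7)) (.div (.div
    (.add (.mul (.var 11) (.var 14)) (.mul (.var 12) (.var 13))) (.var 15))
      (.nat (.reg 2)))))))))))

def prefixProg : Prog :=
  .seq (.forLoop 11 (.reg 10) outcomeProg)
  (.seq (.setReg 9 (.mul (.reg 9) (.reg 1))) (.setReg 10 (.mul (.reg 10) (.reg 3))))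

/-- Everything is recomputed for each output entry. Registers 9 and 10 hold `b ^ j` and `n ^ j`, the
latter being the number of outcome strings. -/
def outputEntryProg : Prog :=
  .seq (.setArr 4 (.reg 7) (.nat (.lit 0))) (.seq (.setArr 5 (.reg 7) (.nat (.lit 0)))
  (.seq (.setReg 9 (.lit 1)) (.seq (.setReg 10 (.lit 1)) (.forLoop 8 (.reg 2) prefixProg))))

def mainProg : Prog :=
  .seq (.setReg 4 (.lit 1))
  -- Register 7 counts the multiplications that form `b ^ k` here, and the output entries later.
  (.seq (.forLoop 7 (.reg 2) (.setReg 4 (.mul (.reg 4) (.reg 1))))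
  (.seq (.setReg 5 (.mul (.reg 0) (.reg 1))) (.seq (.setReg 6 (.mul (.reg 0) (.reg 4)))
  (.forLoop 7 (.mul (.reg 5) (.reg 5)) outputEntryProg))))

/-- The input of the program: the dimensions and the arrays. -/
structure ProgInput where
  a : ℕ
  b : ℕ
  k : ℕ
  n : ℕ
  x : ℕ → ℕ → ℝ

namespace ProgInput

variable (d : ProgInput)

def digit (q i f : ℕ) : ℕ := f / q ^ i % q

/-- The factor for `B_i` of the weight of an entry, when `B_j` is left out. -/
def factor (j y f g i : ℕ) : ℂ :=
  if i < j then
    ⟨d.x 2 ((digit d.n i y * d.b + digit d.b i g) * d.b + digit d.b i f),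
      d.x 3 ((digit d.n i y * d.b + digit d.b i g) * d.b + digit d.b i f)⟩
  else if i = j ∨ digit d.b i f = digit d.b i g then 1 else 0

def weight (j y f g m : ℕ) : ℂ := ∏ i ∈ Finset.range m, d.factor j y f g i

/-- A weighted entry of `R`. -/
def entry (j y r c : ℕ) : ℂ :=
  ⟨d.x 0 (r * (d.a * d.b ^ d.k) + c), d.x 1 (r * (d.a * d.b ^ d.k) + c)⟩ *
    d.weight j y (r % d.b ^ d.k) (c % d.b ^ d.k) d.k

def termA (j y o r c : ℕ) : ℂ :=
  if r / d.b ^ d.k = o / (d.a * d.b) / d.b ∧ c / d.b ^ d.k = o % (d.a * d.b) / d.b ∧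
    digit d.b j (r % d.b ^ d.k) = digit d.b j (c % d.b ^ d.k) then d.entry j y r c else 0

def termB (j y o r c : ℕ) : ℂ :=
  if r / d.b ^ d.k = c / d.b ^ d.k ∧ digit d.b j (r % d.b ^ d.k) = o / (d.a * d.b) % d.b ∧
    digit d.b j (c % d.b ^ d.k) = o % (d.a * d.b) % d.b then d.entry j y r c else 0

def termP (j y r c : ℕ) : ℂ :=
  if r / d.b ^ d.k = c / d.b ^ d.k ∧
    digit d.b j (r % d.b ^ d.k) = digit d.b j (c % d.b ^ d.k) then d.entry j y r c else 0

/-- The sum of a function of the entries of `R`. -/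
def total (φ : ℕ → ℕ → ℂ) : ℂ :=
  ∑ r ∈ Finset.range (d.a * d.b ^ d.k), ∑ c ∈ Finset.range (d.a * d.b ^ d.k), φ r c

/-- Division by zero gives zero here, on the machine and in `marginalProduct`, so outcomes of
probability zero need no test. -/
def outcomeTerm (o j y : ℕ) : ℂ :=
  d.total (d.termA j y o) * d.total (d.termB j y o) /
    ((d.total (d.termP j y)).re : ℂ) / (d.k : ℂ)

/-- The output of the program. -/
def output (o : ℕ) : ℂ :=
  ∑ j ∈ Finset.range d.k, ∑ y ∈ Finset.range (d.n ^ j), d.outcomeTerm o j y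

/-- The contents of the accumulators. -/
def accTerm (j y o r c v : ℕ) : ℝ :=
  if v = 11 then (d.termA j y o r c).re else
  if v = 12 then (d.termA j y o r c).im else
  if v = 13 then (d.termB j y o r c).re else
  if v = 14 then (d.termB j y o r c).im else (d.termP j y r c).re

/-- The memory during the computation. -/
structure Holds (s : MState) : Prop where
  r0 : s.reg 0 = d.a
  r1 : s.reg 1 = d.b
  r2 : s.reg 2 = d.k
  r3 : s.reg 3 = d.n
  r4 : s.reg 4 = d.b ^ d.k
  r5 : s.reg 5 = d.a * d.b
  r6 : s.reg 6 = d.a * d.b ^ d.k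
  x0 : s.arr 0 = d.x 0
  x1 : s.arr 1 = d.x 1
  x2 : s.arr 2 = d.x 2
  x3 : s.arr 3 = d.x 3

/-- `L` bounds all numbers that occur. -/
structure Bounded (L : ℕ) : Prop where
  b_pos : 1 ≤ d.b
  n_pos : 1 ≤ d.n
  k_le : d.k ≤ L
  size_le : d.a * d.b ^ d.k ≤ L
  pow_b_le : d.b ^ d.k ≤ L
  pow_n_le : d.n ^ d.k ≤ L
  ab_le : d.a * d.b ≤ L
  out_le : (d.a * d.b) * (d.a * d.b) ≤ L

variable {d} {L : ℕ} {s s' : MState}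

lemma Holds.of_agreeOff {c : Prog} (h : d.Holds s) (hA : AgreeOff c s s')
    (hr : ∀ i < 7, i ∉ c.regsWritten) (ha : ∀ v < 4, v ∉ c.arrsWritten) : d.Holds s' where
  r0 := (hA.1 0 (hr 0 (by norm_num))).trans h.r0
  r1 := (hA.1 1 (hr 1 (by norm_num))).trans h.r1
  r2 := (hA.1 2 (hr 2 (by norm_num))).trans h.r2
  r3 := (hA.1 3 (hr 3 (by norm_num))).trans h.r3
  r4 := (hA.1 4 (hr 4 (by norm_num))).trans h.r4
  r5 := (hA.1 5 (hr 5 (by norm_num))).trans h.r5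
  r6 := (hA.1 6 (hr 6 (by norm_num))).trans h.r6
  x0 := (hA.2 0 (ha 0 (by norm_num))).trans h.x0
  x1 := (hA.2 1 (ha 1 (by norm_num))).trans h.x1
  x2 := (hA.2 2 (ha 2 (by norm_num))).trans h.x2
  x3 := (hA.2 3 (ha 3 (by norm_num))).trans h.x3

lemma eval_effectIndex (hd : d.Holds s) {i y : ℕ}
    (hy : s.reg 11 = y) (hbi : s.reg 15 = d.b ^ i) (hni : s.reg 16 = d.n ^ i) :
    effectIndex.eval s = (digit d.n i y * d.b + digit d.b i (s.reg 13 % d.b ^ d.k)) * d.b +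
      digit d.b i (s.reg 12 % d.b ^ d.k) := by
  simp only [effectIndex, NExp.digit, sndCol, sndRow, NExp.eval, hd.r1, hd.r3, hd.r4, hbi, hni, hy,
    digit]

lemma eval_factorRe (hd : d.Holds s) {i j y : ℕ} (hi : s.reg 14 = i) (hj : s.reg 8 = j)
    (hy : s.reg 11 = y) (hbi : s.reg 15 = d.b ^ i) (hni : s.reg 16 = d.n ^ i) :
    factorRe.eval s =
      (d.factor j y (s.reg 12 % d.b ^ d.k) (s.reg 13 % d.b ^ d.k) i).re := by
  simp only [factorRe, RExp.eval, eval_effectIndex hd hy hbi hni, NExp.eval_ltInd, NExp.eval_eqInd,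
    NExp.eval, hi, hj, hd.x2, NExp.digit, sndRow, sndCol, hd.r1, hd.r4, hbi, factor]
  by_cases h1 : i < j
  · simp [h1]
  · by_cases h2 : i = j
    · simp [h2]
    · by_cases h3 : digit d.b i (s.reg 12 % d.b ^ d.k) = digit d.b i (s.reg 13 % d.b ^ d.k)
      · have h3' := h3
        simp only [digit] at h3'
        simp [h1, h3, h3']
      · have h3' := h3
        simp only [digit] at h3'
        simp [h1, h2, h3, h3']

lemma eval_factorIm (hd : d.Holds s) {i j y : ℕ} (hi : s.reg 14 = i) (hj : s.reg 8 = j)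
    (hy : s.reg 11 = y) (hbi : s.reg 15 = d.b ^ i) (hni : s.reg 16 = d.n ^ i) :
    factorIm.eval s =
      (d.factor j y (s.reg 12 % d.b ^ d.k) (s.reg 13 % d.b ^ d.k) i).im := by
  simp only [factorIm, RExp.eval, eval_effectIndex hd hy hbi hni, NExp.eval_ltInd,
    NExp.eval, hi, hj, hd.x3, factor]
  by_cases h1 : i < j
  · simp [h1]
  · simp only [h1, if_false]
    split_ifs <;> simp

lemma exec_weightStep (hL : d.Bounded L) (hs : RegsLe L s) (hd : d.Holds s) {i j y : ℕ} {w : ℂ}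
    (hik : i < d.k) (hi : s.reg 14 = i) (hj : s.reg 8 = j)
    (hy : s.reg 11 = y) (hbi : s.reg 15 = d.b ^ i) (hni : s.reg 16 = d.n ^ i)
    (hre : s.arr 6 0 = w.re) (him : s.arr 7 0 = w.im) :
    Exec L weightStep s fun s' =>
      s'.arr 6 0 =
        (w * d.factor j y (s.reg 12 % d.b ^ d.k) (s.reg 13 % d.b ^ d.k) i).re ∧
      s'.arr 7 0 =
        (w * d.factor j y (s.reg 12 % d.b ^ d.k) (s.reg 13 % d.b ^ d.k) i).im ∧
      s'.reg 15 = d.b ^ (i + 1) ∧ s'.reg 16 = d.n ^ (i + 1) := by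
  set z := d.factor j y (s.reg 12 % d.b ^ d.k) (s.reg 13 % d.b ^ d.k) i with hz
  refine Exec.setArr_seq hs 8 rfl rfl 0 z.re rfl (eval_factorRe hd hi hj hy hbi hni) ?_
  intro s1 h1 hs1
  have hd1 : d.Holds s1 := by
    subst h1
    exact ⟨hd.r0, hd.r1, hd.r2, hd.r3, hd.r4, hd.r5, hd.r6, by simpa using hd.x0,
      by simpa using hd.x1, by simpa using hd.x2, by simpa using hd.x3⟩
  have e1 : factorIm.eval s1 = z.im := by
    have := eval_factorIm hd1 (i := i) (j := j) (y := y) (by simpa [h1] using hi)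
      (by simpa [h1] using hj) (by simpa [h1] using hy) (by simpa [h1] using hbi)
      (by simpa [h1] using hni)
    rw [this, hz, h1]
  refine Exec.setArr_seq hs1 9 rfl rfl 0 z.im rfl e1 ?_
  intro s2 h2 hs2
  refine Exec.setArr_seq hs2 10 rfl rfl 0 (w * z).re rfl ?_ ?_
  · simp [RExp.var, RExp.eval, NExp.eval, h2, h1, hre, him]
  intro s3 h3 hs3
  refine Exec.setArr_seq hs3 7 rfl rfl 0 (w * z).im rfl ?_ ?_
  · simp [RExp.var, RExp.eval, NExp.eval, h3, h2, h1, hre, him]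
  intro s4 h4 hs4
  refine Exec.setArr_seq hs4 6 rfl rfl 0 (w * z).re rfl ?_ ?_
  · simp [RExp.var, RExp.eval, NExp.eval, h4, h3]
  intro s5 h5 hs5
  have hbL : d.b ^ (i + 1) ≤ L := (Nat.pow_le_pow_right hL.b_pos hik).trans hL.pow_b_le
  have hnL : d.n ^ (i + 1) ≤ L := (Nat.pow_le_pow_right hL.n_pos hik).trans hL.pow_n_le
  refine Exec.setReg_seq hs5 15 rfl (d.b ^ (i + 1)) ?_ hbL ?_
  · simp [NExp.eval, h5, h4, h3, h2, h1, hbi, hd.r1, pow_succ]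
  intro s6 h6 hs6
  refine Exec.setReg hs6 16 rfl (d.n ^ (i + 1)) ?_ hnL ?_
  · simp [NExp.eval, h6, h5, h4, h3, h2, h1, hni, hd.r3, pow_succ]
  · simp [h6, h5, h4]

lemma exec_weightProg (hL : d.Bounded L) (hs : RegsLe L s) (hd : d.Holds s) {j y : ℕ}
    (hj : s.reg 8 = j) (hy : s.reg 11 = y) :
    Exec L weightProg s fun s' =>
      s'.arr 6 0 =
        (d.weight j y (s.reg 12 % d.b ^ d.k) (s.reg 13 % d.b ^ d.k) d.k).re ∧
      s'.arr 7 0 =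
        (d.weight j y (s.reg 12 % d.b ^ d.k) (s.reg 13 % d.b ^ d.k) d.k).im := by
  have hL1 : 1 ≤ L := (Nat.one_le_pow _ _ hL.b_pos).trans hL.pow_b_le
  refine Exec.setArr_seq hs 6 rfl rfl 0 1 rfl (by simp [RExp.eval, NExp.eval]) ?_
  intro s1 h1 hs1
  refine Exec.setArr_seq hs1 7 rfl rfl 0 0 rfl (by simp [RExp.eval, NExp.eval]) ?_
  intro s2 h2 hs2
  refine Exec.setReg_seq hs2 15 rfl 1 rfl hL1 ?_
  intro s3 h3 hs3
  refine Exec.setReg_seq hs3 16 rfl 1 rfl hL1 ?_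
  intro s4 h4 hs4
  have hd4 : d.Holds s4 := by
    subst h4 h3 h2 h1
    exact ⟨by simpa using hd.r0, by simpa using hd.r1, by simpa using hd.r2, by simpa using hd.r3,
      by simpa using hd.r4, by simpa using hd.r5, by simpa using hd.r6, by simpa using hd.x0,
      by simpa using hd.x1, by simpa using hd.x2, by simpa using hd.x3⟩
  have e8 : s4.reg 8 = j := by simp [h4, h3, h2, h1, hj]
  have e11 : s4.reg 11 = y := by simp [h4, h3, h2, h1, hy]
  have e12 : s4.reg 12 = s.reg 12 := by simp [h4, h3, h2, h1]
  have e13 : s4.reg 13 = s.reg 13 := by simp [h4, h3, h2, h1]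
  refine (Exec.forLoop (N := d.k) hs4 (by norm_num) (by decide) rfl hL.k_le
    (fun m s' => s'.arr 6 0 =
        (d.weight j y (s.reg 12 % d.b ^ d.k) (s.reg 13 % d.b ^ d.k) m).re ∧
      s'.arr 7 0 =
        (d.weight j y (s.reg 12 % d.b ^ d.k) (s.reg 13 % d.b ^ d.k) m).im ∧
      s'.reg 15 = d.b ^ m ∧ s'.reg 16 = d.n ^ m) ?_ ?_ ?_ ?_).mono
      fun s' h => ⟨h.1, h.2.1⟩
  · intro m s' x h
    simpa using h
  · intro s' hA
    exact (hA.1 2 (by decide)).trans hd4.r2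
  · simp [h4, h3, h2, h1, weight]
  · intro m hm s' hs' hA hi hI
    have hd' := hd4.of_agreeOff hA (by decide) (by decide)
    have := exec_weightStep hL hs' hd' (w := d.weight j y (s.reg 12 % d.b ^ d.k)
      (s.reg 13 % d.b ^ d.k) m) hm hi ((hA.1 8 (by decide)).trans e8)
      ((hA.1 11 (by decide)).trans e11) hI.2.2.1 hI.2.2.2 hI.1 hI.2.1
    rw [(hA.1 12 (by decide)).trans e12, (hA.1 13 (by decide)).trans e13] at this
    simpa only [weight, Finset.prod_range_succ] using this

end ProgInput

end Program

end QDF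

end

noncomputable section

namespace QDF

/-! ### Correctness of the program, from the inner loops outwards -/

section ProgramCorrectness

namespace ProgInput

variable {d : ProgInput} {L : ℕ} {s s' : MState}

lemma eval_condA (hd : d.Holds s) {o j : ℕ} (ho : s.reg 7 = o) (hbj : s.reg 9 = d.b ^ j) :
    condA.eval s = if s.reg 12 / d.b ^ d.k = o / (d.a * d.b) / d.b ∧
      s.reg 13 / d.b ^ d.k = o % (d.a * d.b) / d.b ∧
      digit d.b j (s.reg 12 % d.b ^ d.k) = digit d.b j (s.reg 13 % d.b ^ d.k) then 1 else 0 := by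
  simp only [condA, NExp.eval, NExp.eval_eqInd, fstRow, fstCol, sndRow, sndCol, outRow, outCol,
    NExp.digit, hd.r1, hd.r4, hd.r5, ho, hbj, digit, mul_ite, mul_one, mul_zero, ← ite_and]
  congr 1
  exact propext ⟨fun h => ⟨h.2.2, h.2.1, h.1⟩, fun h => ⟨h.2.2, h.2.1, h.1⟩⟩

lemma eval_condB (hd : d.Holds s) {o j : ℕ} (ho : s.reg 7 = o) (hbj : s.reg 9 = d.b ^ j) :
    condB.eval s = if s.reg 12 / d.b ^ d.k = s.reg 13 / d.b ^ d.k ∧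
      digit d.b j (s.reg 12 % d.b ^ d.k) = o / (d.a * d.b) % d.b ∧
      digit d.b j (s.reg 13 % d.b ^ d.k) = o % (d.a * d.b) % d.b then 1 else 0 := by
  simp only [condB, NExp.eval, NExp.eval_eqInd, fstRow, fstCol, sndRow, sndCol, outRow, outCol,
    NExp.digit, hd.r1, hd.r4, hd.r5, ho, hbj, digit, mul_ite, mul_one, mul_zero, ← ite_and]
  congr 1
  exact propext ⟨fun h => ⟨h.2.2, h.2.1, h.1⟩, fun h => ⟨h.2.2, h.2.1, h.1⟩⟩

lemma eval_condP (hd : d.Holds s) {j : ℕ} (hbj : s.reg 9 = d.b ^ j) :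
    condP.eval s = if s.reg 12 / d.b ^ d.k = s.reg 13 / d.b ^ d.k ∧
      digit d.b j (s.reg 12 % d.b ^ d.k) = digit d.b j (s.reg 13 % d.b ^ d.k) then 1 else 0 := by
  simp only [condP, NExp.eval, NExp.eval_eqInd, fstRow, fstCol, sndRow, sndCol,
    NExp.digit, hd.r1, hd.r4, hbj, digit, mul_ite, mul_one, mul_zero, ← ite_and]
  congr 1
  exact propext ⟨fun h => ⟨h.2, h.1⟩, fun h => ⟨h.2, h.1⟩⟩

lemma Holds.update_arr (hd : d.Holds s) {v : ℕ} (hv : 4 ≤ v) (f : ℕ → ℝ) :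
    d.Holds ⟨s.reg, Function.update s.arr v f⟩ where
  r0 := hd.r0
  r1 := hd.r1
  r2 := hd.r2
  r3 := hd.r3
  r4 := hd.r4
  r5 := hd.r5
  r6 := hd.r6
  x0 := by simpa [show (0 : ℕ) ≠ v by omega] using hd.x0
  x1 := by simpa [show (1 : ℕ) ≠ v by omega] using hd.x1
  x2 := by simpa [show (2 : ℕ) ≠ v by omega] using hd.x2
  x3 := by simpa [show (3 : ℕ) ≠ v by omega] using hd.x3

lemma Holds.update_reg (hd : d.Holds s) {i : ℕ} (hi : 7 ≤ i) (x : ℕ) :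
    d.Holds ⟨Function.update s.reg i x, s.arr⟩ where
  r0 := by simpa [show (0 : ℕ) ≠ i by omega] using hd.r0
  r1 := by simpa [show (1 : ℕ) ≠ i by omega] using hd.r1
  r2 := by simpa [show (2 : ℕ) ≠ i by omega] using hd.r2
  r3 := by simpa [show (3 : ℕ) ≠ i by omega] using hd.r3
  r4 := by simpa [show (4 : ℕ) ≠ i by omega] using hd.r4
  r5 := by simpa [show (5 : ℕ) ≠ i by omega] using hd.r5
  r6 := by simpa [show (6 : ℕ) ≠ i by omega] using hd.r6
  x0 := hd.x0
  x1 := hd.x1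
  x2 := hd.x2
  x3 := hd.x3

/-- The effect is stated as increments of the accumulators, so that the loops over columns and rows
produce sums. -/
lemma exec_entryProg (hL : d.Bounded L) (hs : RegsLe L s) (hd : d.Holds s) {o j y r c : ℕ}
    (ho : s.reg 7 = o) (hj : s.reg 8 = j) (hbj : s.reg 9 = d.b ^ j) (hy : s.reg 11 = y)
    (hr : s.reg 12 = r) (hc : s.reg 13 = c) :
    Exec L entryProg s fun s' => ∀ v ∈ [11, 12, 13, 14, 15],
      s'.arr v 0 = s.arr v 0 + d.accTerm j y o r c v := by
  refine (exec_weightProg hL hs hd hj hy).agreeOff.seq ?_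
  rintro s1 hs1 ⟨hA, hre, him⟩
  have hd1 := hd.of_agreeOff hA (by decide) (by decide)
  rw [hr, hc] at hre him
  have r7 : s1.reg 7 = o := (hA.1 7 (by decide)).trans ho
  have r9 : s1.reg 9 = d.b ^ j := (hA.1 9 (by decide)).trans hbj
  have r12 : s1.reg 12 = r := (hA.1 12 (by decide)).trans hr
  have r13 : s1.reg 13 = c := (hA.1 13 (by decide)).trans hc
  have hacc : ∀ v ∈ [11, 12, 13, 14, 15], s1.arr v = s.arr v := fun v hv =>
    hA.2 v (by
      have : ∀ v ∈ [11, 12, 13, 14, 15], v ∉ weightProg.arrsWritten := by decide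
      exact this v hv)
  have a11 := hacc 11 (by decide)
  have a12 := hacc 12 (by decide)
  have a13 := hacc 13 (by decide)
  have a14 := hacc 14 (by decide)
  have a15 := hacc 15 (by decide)
  refine Exec.setArr_seq hs1 16 rfl rfl 0 (d.entry j y r c).re rfl ?_ ?_
  · simp [RExp.eval, RExp.var, NExp.eval, entryIndex, hd1.x0, hd1.x1, r12, r13, hd1.r6, hre, him,
      entry]
  intro s2 h2 hs2
  have hd2 : d.Holds s2 := h2 ▸ hd1.update_arr (by norm_num) _
  refine Exec.setArr_seq hs2 17 rfl rfl 0 (d.entry j y r c).im rfl ?_ ?_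
  · simp [RExp.eval, RExp.var, NExp.eval, entryIndex, h2, hd1.x0, hd1.x1, r12, r13, hd1.r6, hre,
      him, entry]
  intro s3 h3 hs3
  have hd3 : d.Holds s3 := h3 ▸ hd2.update_arr (by norm_num) _
  have hreg3 : s3.reg = s1.reg := by rw [h3, h2]
  have e16 : s3.arr 16 0 = (d.entry j y r c).re := by simp [h3, h2]
  have e17 : s3.arr 17 0 = (d.entry j y r c).im := by simp [h3, h2]
  have hA3 := eval_condA hd3 (o := o) (j := j) (by rw [hreg3, r7]) (by rw [hreg3, r9])
  have hB3 := eval_condB hd3 (o := o) (j := j) (by rw [hreg3, r7]) (by rw [hreg3, r9])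
  have hP3 := eval_condP hd3 (j := j) (by rw [hreg3, r9])
  rw [hreg3, r12, r13] at hA3 hB3 hP3
  -- Natural number expressions see only registers, so the selectors evaluated in `s3` keep their
  -- values while the accumulators change.
  have hcongr : ∀ (e : NExp) (s s' : MState), s.reg = s'.reg → e.eval s = e.eval s' := by
    intro e s s' h
    induction e <;> simp_all [NExp.eval]
  refine Exec.setArr_seq hs3 11 rfl rfl 0 (s.arr 11 0 + (d.termA j y o r c).re) rfl ?_ ?_
  · simp only [RExp.eval, RExp.var, NExp.eval, hA3, e16, termA]
    split_ifs <;> simp [h3, h2, a11]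
  intro s4 h4 hs4
  refine Exec.setArr_seq hs4 12 rfl rfl 0 (s.arr 12 0 + (d.termA j y o r c).im) rfl ?_ ?_
  · simp only [RExp.eval, RExp.var, NExp.eval, hcongr condA s4 s3 (by rw [h4]), hA3, termA]
    split_ifs <;> simp [h4, e17] <;> simp [h3, h2, a12]
  intro s5 h5 hs5
  refine Exec.setArr_seq hs5 13 rfl rfl 0 (s.arr 13 0 + (d.termB j y o r c).re) rfl ?_ ?_
  · simp only [RExp.eval, RExp.var, NExp.eval, hcongr condB s5 s3 (by rw [h5, h4]), hB3, termB]
    split_ifs <;> simp [h5, h4, e16] <;> simp [h3, h2, a13]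
  intro s6 h6 hs6
  refine Exec.setArr_seq hs6 14 rfl rfl 0 (s.arr 14 0 + (d.termB j y o r c).im) rfl ?_ ?_
  · simp only [RExp.eval, RExp.var, NExp.eval, hcongr condB s6 s3 (by rw [h6, h5, h4]), hB3,
      termB]
    split_ifs <;> simp [h6, h5, h4, e17] <;> simp [h3, h2, a14]
  intro s7 h7 hs7
  refine Exec.setArr hs7 15 rfl rfl 0 (s.arr 15 0 + (d.termP j y r c).re) rfl ?_ ?_
  · simp only [RExp.eval, RExp.var, NExp.eval, hcongr condP s7 s3 (by rw [h7, h6, h5, h4]), hP3,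
      termP]
    split_ifs <;> simp [h7, h6, h5, h4, e16] <;> simp [h3, h2, a15]
  · simp [h7, h6, h5, h4, accTerm]

lemma exec_rowProg (hL : d.Bounded L) (hs : RegsLe L s) (hd : d.Holds s) {o j y r : ℕ}
    (ho : s.reg 7 = o) (hj : s.reg 8 = j) (hbj : s.reg 9 = d.b ^ j) (hy : s.reg 11 = y)
    (hr : s.reg 12 = r) :
    Exec L rowProg s fun s' => ∀ v ∈ [11, 12, 13, 14, 15],
      s'.arr v 0 = s.arr v 0 +
        ∑ c ∈ Finset.range (d.a * d.b ^ d.k), d.accTerm j y o r c v := by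
  refine Exec.forLoop (N := d.a * d.b ^ d.k) hs (by norm_num) (by decide) rfl hL.size_le
    (fun m s' => ∀ v ∈ [11, 12, 13, 14, 15],
      s'.arr v 0 = s.arr v 0 + ∑ c ∈ Finset.range m, d.accTerm j y o r c v) ?_ ?_ ?_ ?_
  · intro m s' x h
    exact h
  · intro s' hA
    exact (hA.1 6 (by decide)).trans hd.r6
  · intro v _; simp
  · intro m hm s' hs' hA hi hI
    refine (exec_entryProg hL hs' (hd.of_agreeOff hA (by decide) (by decide))
      ((hA.1 7 (by decide)).trans ho) ((hA.1 8 (by decide)).trans hj)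
      ((hA.1 9 (by decide)).trans hbj) ((hA.1 11 (by decide)).trans hy)
      ((hA.1 12 (by decide)).trans hr) hi).mono fun s'' h v hv => ?_
    rw [h v hv, hI v hv, Finset.sum_range_succ, add_assoc]

lemma exec_outcomeProg (hL : d.Bounded L) (hs : RegsLe L s) (hd : d.Holds s) {o j y : ℕ}
    (ho : s.reg 7 = o) (hj : s.reg 8 = j) (hbj : s.reg 9 = d.b ^ j) (hy : s.reg 11 = y) :
    Exec L outcomeProg s fun s' =>
      s'.arr 4 = Function.update (s.arr 4) o (s.arr 4 o + (d.outcomeTerm o j y).re) ∧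
      s'.arr 5 = Function.update (s.arr 5) o (s.arr 5 o + (d.outcomeTerm o j y).im) := by
  have hz : ∀ s : MState, (RExp.nat (.lit 0)).eval s = 0 := fun s => by simp [RExp.eval, NExp.eval]
  refine Exec.setArr_seq hs 11 rfl rfl 0 0 rfl (hz _) ?_
  intro s1 h1 hs1
  refine Exec.setArr_seq hs1 12 rfl rfl 0 0 rfl (hz _) ?_
  intro s2 h2 hs2
  refine Exec.setArr_seq hs2 13 rfl rfl 0 0 rfl (hz _) ?_
  intro s3 h3 hs3
  refine Exec.setArr_seq hs3 14 rfl rfl 0 0 rfl (hz _) ?_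
  intro s4 h4 hs4
  refine Exec.setArr_seq hs4 15 rfl rfl 0 0 rfl (hz _) ?_
  intro s5 h5 hs5
  have hd5 : d.Holds s5 := by
    subst h5 h4 h3 h2 h1
    exact ((((hd.update_arr (by norm_num) _).update_arr (by norm_num) _).update_arr
      (by norm_num) _).update_arr (by norm_num) _).update_arr (by norm_num) _
  have hreg5 : s5.reg = s.reg := by rw [h5, h4, h3, h2, h1]
  have hacc5 : ∀ v ∈ [11, 12, 13, 14, 15], s5.arr v 0 = 0 := by
    simp [h5, h4, h3, h2, h1]
  have h45 : s5.arr 4 = s.arr 4 := by simp [h5, h4, h3, h2, h1]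
  have h55 : s5.arr 5 = s.arr 5 := by simp [h5, h4, h3, h2, h1]
  refine (Exec.forLoop (N := d.a * d.b ^ d.k) hs5 (by norm_num) (by decide) rfl hL.size_le
    (fun m s' => ∀ v ∈ [11, 12, 13, 14, 15],
      s'.arr v 0 = ∑ r ∈ Finset.range m,
        ∑ c ∈ Finset.range (d.a * d.b ^ d.k), d.accTerm j y o r c v) ?_ ?_ ?_ ?_).agreeOff.seq ?_
  · intro m s' x h
    exact h
  · intro s' hA
    exact (hA.1 6 (by decide)).trans hd5.r6
  · intro v hv; simpa using hacc5 v hv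
  · intro m hm s' hs' hA hi hI
    refine (exec_rowProg hL hs' (hd5.of_agreeOff hA (by decide) (by decide))
      ((hA.1 7 (by decide)).trans (hreg5 ▸ ho)) ((hA.1 8 (by decide)).trans (hreg5 ▸ hj))
      ((hA.1 9 (by decide)).trans (hreg5 ▸ hbj)) ((hA.1 11 (by decide)).trans (hreg5 ▸ hy))
      hi).mono fun s'' h v hv => ?_
    rw [h v hv, hI v hv, Finset.sum_range_succ]
  rintro s6 hs6 ⟨hA, hI⟩
  have hd6 := hd5.of_agreeOff hA (by decide) (by decide)
  have v11 : s6.arr 11 0 = (d.total (d.termA j y o)).re := by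
    rw [hI 11 (by decide), total]; simp [accTerm]
  have v12 : s6.arr 12 0 = (d.total (d.termA j y o)).im := by
    rw [hI 12 (by decide), total]; simp [accTerm]
  have v13 : s6.arr 13 0 = (d.total (d.termB j y o)).re := by
    rw [hI 13 (by decide), total]; simp [accTerm]
  have v14 : s6.arr 14 0 = (d.total (d.termB j y o)).im := by
    rw [hI 14 (by decide), total]; simp [accTerm]
  have v15 : s6.arr 15 0 = (d.total (d.termP j y)).re := by
    rw [hI 15 (by decide), total]; simp [accTerm]
  have r7 : s6.reg 7 = o := (hA.1 7 (by decide)).trans (hreg5 ▸ ho)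
  have h46 : s6.arr 4 = s.arr 4 := (hA.2 4 (by decide)).trans h45
  have h56 : s6.arr 5 = s.arr 5 := (hA.2 5 (by decide)).trans h55
  refine Exec.setArr_seq hs6 4 rfl rfl o (s.arr 4 o + (d.outcomeTerm o j y).re) r7 ?_ ?_
  · simp only [RExp.eval, RExp.var, NExp.eval, r7, v11, v12, v13, v14, v15, h46, hd6.r2,
      outcomeTerm, Complex.div_natCast_re, Complex.div_ofReal_re, Complex.mul_re]
  intro s7 h7 hs7
  refine Exec.setArr hs7 5 rfl rfl o (s.arr 5 o + (d.outcomeTerm o j y).im)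
    (by simp [h7, NExp.eval, r7]) ?_ ?_
  · simp [RExp.eval, RExp.var, NExp.eval, h7, r7, v11, v12, v13, v14, v15, h56, hd6.r2,
      outcomeTerm, Complex.div_natCast_im, Complex.div_ofReal_im, Complex.mul_im]
  · simp [h7, h46, h56]

lemma exec_prefixProg (hL : d.Bounded L) (hs : RegsLe L s) (hd : d.Holds s) {o j : ℕ}
    (hjk : j < d.k) (ho : s.reg 7 = o) (hj : s.reg 8 = j) (hbj : s.reg 9 = d.b ^ j)
    (hnj : s.reg 10 = d.n ^ j) :
    Exec L prefixProg s fun s' =>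
      s'.arr 4 = Function.update (s.arr 4) o
        (s.arr 4 o + (∑ y ∈ Finset.range (d.n ^ j), d.outcomeTerm o j y).re) ∧
      s'.arr 5 = Function.update (s.arr 5) o
        (s.arr 5 o + (∑ y ∈ Finset.range (d.n ^ j), d.outcomeTerm o j y).im) ∧
      s'.reg 9 = d.b ^ (j + 1) ∧ s'.reg 10 = d.n ^ (j + 1) := by
  have hnL : d.n ^ j ≤ L := (Nat.pow_le_pow_right hL.n_pos hjk.le).trans hL.pow_n_le
  refine (Exec.forLoop (N := d.n ^ j) hs (by norm_num) (by decide) rfl hnL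
    (fun m s' => s'.arr 4 = Function.update (s.arr 4) o
        (s.arr 4 o + (∑ y ∈ Finset.range m, d.outcomeTerm o j y).re) ∧
      s'.arr 5 = Function.update (s.arr 5) o
        (s.arr 5 o + (∑ y ∈ Finset.range m, d.outcomeTerm o j y).im))
    ?_ ?_ ?_ ?_).agreeOff.seq ?_
  · intro m s' x h
    exact h
  · intro s' hA
    exact (hA.1 10 (by decide)).trans hnj
  · simp
  · intro m hm s' hs' hA hi hI
    refine (exec_outcomeProg hL hs' (hd.of_agreeOff hA (by decide) (by decide))
      ((hA.1 7 (by decide)).trans ho) ((hA.1 8 (by decide)).trans hj)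
      ((hA.1 9 (by decide)).trans hbj) hi).mono fun s'' h => ?_
    rw [hI.1, hI.2] at h
    simpa [Finset.sum_range_succ, add_assoc] using h
  rintro s1 hs1 ⟨hA, h4, h5⟩
  have hd1 := hd.of_agreeOff hA (by decide) (by decide)
  have hbL : d.b ^ (j + 1) ≤ L := (Nat.pow_le_pow_right hL.b_pos hjk).trans hL.pow_b_le
  have hnL' : d.n ^ (j + 1) ≤ L := (Nat.pow_le_pow_right hL.n_pos hjk).trans hL.pow_n_le
  have r9 := (hA.1 9 (by decide)).trans hbj
  have r10 := (hA.1 10 (by decide)).trans hnj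
  refine Exec.setReg_seq hs1 9 rfl (d.b ^ (j + 1)) ?_ hbL ?_
  · simp [NExp.eval, r9, hd1.r1, pow_succ]
  intro s2 h2 hs2
  refine Exec.setReg hs2 10 rfl (d.n ^ (j + 1)) ?_ hnL' ?_
  · simp [NExp.eval, h2, r10, hd1.r3, pow_succ]
  · simp [h2, h4, h5]

lemma exec_outputEntryProg (hL : d.Bounded L) (hs : RegsLe L s) (hd : d.Holds s) {o : ℕ}
    (ho : s.reg 7 = o) :
    Exec L outputEntryProg s fun s' =>
      s'.arr 4 = Function.update (s.arr 4) o (d.output o).re ∧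
      s'.arr 5 = Function.update (s.arr 5) o (d.output o).im := by
  have hL1 : 1 ≤ L := (Nat.one_le_pow _ _ hL.b_pos).trans hL.pow_b_le
  refine Exec.setArr_seq hs 4 rfl rfl o 0 ho (by simp [RExp.eval, NExp.eval]) ?_
  intro s1 h1 hs1
  refine Exec.setArr_seq hs1 5 rfl rfl o 0 (by simp [NExp.eval, h1, ho])
    (by simp [RExp.eval, NExp.eval]) ?_
  intro s2 h2 hs2
  refine Exec.setReg_seq hs2 9 rfl 1 rfl hL1 ?_
  intro s3 h3 hs3
  refine Exec.setReg_seq hs3 10 rfl 1 rfl hL1 ?_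
  intro s4 h4 hs4
  have hd4 : d.Holds s4 := by
    subst h4 h3 h2 h1
    exact (((hd.update_arr (by norm_num) _).update_arr (by norm_num) _).update_reg
      (by norm_num) _).update_reg (by norm_num) _
  have a4 : s4.arr 4 = Function.update (s.arr 4) o 0 := by simp [h4, h3, h2, h1]
  have a5 : s4.arr 5 = Function.update (s.arr 5) o 0 := by simp [h4, h3, h2, h1]
  have r7 : s4.reg 7 = o := by simp [h4, h3, h2, h1, ho]
  refine (Exec.forLoop (N := d.k) hs4 (by norm_num) (by decide) rfl hL.k_le
    (fun m s' => s'.arr 4 = Function.update (s.arr 4) o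
        (∑ j ∈ Finset.range m, ∑ y ∈ Finset.range (d.n ^ j), d.outcomeTerm o j y).re ∧
      s'.arr 5 = Function.update (s.arr 5) o
        (∑ j ∈ Finset.range m, ∑ y ∈ Finset.range (d.n ^ j), d.outcomeTerm o j y).im ∧
      s'.reg 9 = d.b ^ m ∧ s'.reg 10 = d.n ^ m)
    ?_ ?_ ?_ ?_).mono fun s' h => ⟨h.1, h.2.1⟩
  · intro m s' x h
    simpa using h
  · intro s' hA
    exact (hA.1 2 (by decide)).trans hd4.r2
  · refine ⟨by simpa using a4, by simpa using a5, ?_, ?_⟩ <;> simp [h4, h3]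
  · intro m hm s' hs' hA hi hI
    refine (exec_prefixProg hL hs' (hd4.of_agreeOff hA (by decide) (by decide)) hm
      ((hA.1 7 (by decide)).trans r7) hi hI.2.2.1 hI.2.2.2).mono fun s'' h => ?_
    rw [hI.1, hI.2.1] at h
    rw [Finset.sum_range_succ]
    simpa using h

/-- The main program computes the output, provided that the numbers are bounded. -/
lemma exec_mainProg (hL : d.Bounded L) (hs : RegsLe L s)
    (hr0 : s.reg 0 = d.a) (hr1 : s.reg 1 = d.b) (hr2 : s.reg 2 = d.k) (hr3 : s.reg 3 = d.n)
    (hx : ∀ v < 4, s.arr v = d.x v) :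
    Exec L mainProg s fun s' => ∀ o < (d.a * d.b) * (d.a * d.b),
      s'.arr 4 o = (d.output o).re ∧ s'.arr 5 o = (d.output o).im := by
  have hL1 : 1 ≤ L := (Nat.one_le_pow _ _ hL.b_pos).trans hL.pow_b_le
  refine Exec.setReg_seq hs 4 rfl 1 rfl hL1 ?_
  intro s1 h1 hs1
  refine (Exec.forLoop (N := d.k) hs1 (by norm_num) (by decide) rfl hL.k_le
    (fun m s' => s'.reg 4 = d.b ^ m) ?_ ?_ ?_ ?_).agreeOff.seq ?_
  · intro m s' x h
    simpa using h
  · intro s' hA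
    exact (hA.1 2 (by decide)).trans (by simp [h1, hr2])
  · simp [h1]
  · intro m hm s' hs' hA hi hI
    have hbL : d.b ^ (m + 1) ≤ L := (Nat.pow_le_pow_right hL.b_pos hm).trans hL.pow_b_le
    have r1 : s'.reg 1 = d.b := (hA.1 1 (by decide)).trans (by simp [h1, hr1])
    refine Exec.setReg hs' 4 rfl (d.b ^ (m + 1)) ?_ hbL (by simp)
    simp [NExp.eval, hI, r1, pow_succ]
  rintro s2 hs2 ⟨hA, r4⟩
  have r0 : s2.reg 0 = d.a := (hA.1 0 (by decide)).trans (by simp [h1, hr0])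
  have r1 : s2.reg 1 = d.b := (hA.1 1 (by decide)).trans (by simp [h1, hr1])
  have r2 : s2.reg 2 = d.k := (hA.1 2 (by decide)).trans (by simp [h1, hr2])
  have r3 : s2.reg 3 = d.n := (hA.1 3 (by decide)).trans (by simp [h1, hr3])
  have hx2 : ∀ v < 4, s2.arr v = d.x v := fun v hv =>
    (hA.2 v (by simp [Prog.forLoop, Prog.arrsWritten])).trans (by simp [h1, hx v hv])
  refine Exec.setReg_seq hs2 5 rfl (d.a * d.b) (by simp [NExp.eval, r0, r1]) hL.ab_le ?_
  intro s3 h3 hs3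
  refine Exec.setReg_seq hs3 6 rfl (d.a * d.b ^ d.k) (by simp [NExp.eval, h3, r0, r4])
    hL.size_le ?_
  intro s4 h4 hs4
  have hd4 : d.Holds s4 := by
    subst h4 h3
    exact ⟨by simpa using r0, by simpa using r1, by simpa using r2, by simpa using r3,
      by simpa using r4, by simp, by simp, hx2 0 (by norm_num), hx2 1 (by norm_num),
      hx2 2 (by norm_num), hx2 3 (by norm_num)⟩
  refine Exec.forLoop (N := (d.a * d.b) * (d.a * d.b)) hs4 (by norm_num) (by decide) rfl hL.out_le
    (fun m s' => ∀ o < m, s'.arr 4 o = (d.output o).re ∧ s'.arr 5 o = (d.output o).im) ?_ ?_ ?_ ?_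
  · intro m s' x h
    exact h
  · intro s' hA
    have := (hA.1 5 (by decide)).trans hd4.r5
    simp [NExp.eval, this]
  · intro o ho; omega
  · intro m hm s' hs' hA hi hI
    refine (exec_outputEntryProg hL hs' (hd4.of_agreeOff hA (by decide) (by decide))
      hi).mono fun s'' h o ho => ?_
    rw [h.1, h.2]
    by_cases hom : o = m
    · subst hom; simp
    · simpa [hom] using hI o (by omega)

end ProgInput

end ProgramCorrectness

end QDF

end

noncomputable section

namespace QDF

open Matrix

/-! ### Positional encoding of basis vectors and identification of the output -/

section Encoding

variable {a b k n : ℕ}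

lemma position_eq (p : Fin a × (Fin k → Fin b)) :
    position p = p.1 * b ^ k + finFunctionFinEquiv p.2 := by
  rw [position, finFunctionFinEquiv_apply]

lemma position_div (p : Fin a × (Fin k → Fin b)) : position p / b ^ k = p.1 := by
  have h := (finFunctionFinEquiv p.2).2
  rw [position_eq, add_comm, Nat.add_mul_div_right _ _ (by omega), Nat.div_eq_of_lt h, zero_add]

lemma position_mod (p : Fin a × (Fin k → Fin b)) :
    position p % b ^ k = finFunctionFinEquiv p.2 := by
  rw [position_eq, add_comm, Nat.add_mul_mod_self_right, Nat.mod_eq_of_lt (Fin.is_lt _)]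

lemma digit_finFunctionFinEquiv (f : Fin k → Fin b) (i : Fin k) :
    ProgInput.digit b i (finFunctionFinEquiv f) = f i := by
  conv_rhs => rw [← finFunctionFinEquiv.symm_apply_apply f]
  rfl

/-- `position` is a mixed-radix bijection, so counting loops become sums over basis vectors. -/
lemma sum_range_position {α : Type*} [AddCommMonoid α] (φ : ℕ → α) :
    ∑ r ∈ Finset.range (a * b ^ k), φ r = ∑ p : Fin a × (Fin k → Fin b), φ (position p) := by
  rw [Finset.sum_range, ← (((Equiv.refl (Fin a)).prodCongr
    (finFunctionFinEquiv (m := b) (n := k))).trans finProdFinEquiv).sum_comp]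
  refine Finset.sum_congr rfl fun p _ => congrArg φ ?_
  rw [position_eq]
  simp [finProdFinEquiv, add_comm, mul_comm]

/-- The arrays `x` encode the matrix `R` and the measurement `M`. -/
structure ProgInput.Encodes (x : ℕ → ℕ → ℝ)
    (R : Matrix (Fin a × (Fin k → Fin b)) (Fin a × (Fin k → Fin b)) ℂ)
    (M : Fin n → Matrix (Fin b) (Fin b) ℂ) : Prop where
  matrix : ∀ p q, (⟨x 0 (position p * (a * b ^ k) + position q),
    x 1 (position p * (a * b ^ k) + position q)⟩ : ℂ) = R p q
  effects : ∀ (y : Fin n) (i j : Fin b),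
    (⟨x 2 (((y : ℕ) * b + i) * b + j), x 3 (((y : ℕ) * b + i) * b + j)⟩ : ℂ) = M y i j

namespace ProgInput

variable {x : ℕ → ℕ → ℝ} {R : Matrix (Fin a × (Fin k → Fin b)) (Fin a × (Fin k → Fin b)) ℂ}
  {M : Fin n → Matrix (Fin b) (Fin b) ℂ}

/-- The factor at `j` is one by design, which leaves the effect on `B_j` free as the argument of
`condMap`. -/
lemma Encodes.weight (h : Encodes x R M) (j : Fin k) (y : Fin j → Fin n) (f g : Fin k → Fin b) :
    weight ⟨a, b, k, n, x⟩ j (finFunctionFinEquiv y) (finFunctionFinEquiv f)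
      (finFunctionFinEquiv g) k =
      ∏ i ∈ Finset.univ.erase j, prefixEffects M k j y i (g i) (f i) := by
  rw [ProgInput.weight, Finset.prod_range, ← Finset.mul_prod_erase _ _ (Finset.mem_univ j)]
  have hj : factor ⟨a, b, k, n, x⟩ j (finFunctionFinEquiv y) (finFunctionFinEquiv f)
      (finFunctionFinEquiv g) j = 1 := by simp [factor]
  rw [hj, one_mul]
  refine Finset.prod_congr rfl fun i hi => ?_
  have hij : (i : ℕ) ≠ j := fun hc => Finset.ne_of_mem_erase hi (Fin.ext hc)
  simp only [factor, digit_finFunctionFinEquiv, prefixEffects, hij, false_or]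
  split_ifs with h1 h2
  · rw [digit_finFunctionFinEquiv y ⟨i, h1⟩]
    exact h.effects _ _ _
  · rw [Fin.ext h2, one_apply_eq]
  · rw [one_apply_ne fun hc => ‹¬ _› (congrArg Fin.val hc.symm)]

lemma Encodes.entry (h : Encodes x R M) (j : Fin k) (y : Fin j → Fin n)
    (p q : Fin a × (Fin k → Fin b)) :
    entry ⟨a, b, k, n, x⟩ j (finFunctionFinEquiv y) (position p) (position q) =
      R p q * ∏ i ∈ Finset.univ.erase j, prefixEffects M k j y i (q.2 i) (p.2 i) := by
  simp only [ProgInput.entry, position_mod, h.weight, h.matrix]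

lemma total_eq (φ : ℕ → ℕ → ℂ) :
    total ⟨a, b, k, n, x⟩ φ = ∑ p : Fin a × (Fin k → Fin b), ∑ q : Fin a × (Fin k → Fin b),
      φ (position p) (position q) := by
  simp only [total, sum_range_position]

lemma trace_condMap (R : Matrix (Fin a × (Fin k → Fin b)) (Fin a × (Fin k → Fin b)) ℂ)
    (F : Fin k → Matrix (Fin b) (Fin b) ℂ) (j : Fin k) (N : Matrix (Fin b) (Fin b) ℂ) :
    (condMap R F j N).trace = ∑ p : Fin a × (Fin k → Fin b), ∑ q : Fin a × (Fin k → Fin b),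
      if p.1 = q.1 then
        N (q.2 j) (p.2 j) * (R p q * ∏ i ∈ Finset.univ.erase j, F i (q.2 i) (p.2 i)) else 0 := by
  simp only [Matrix.trace, diag_apply, condMap_apply, condState, of_apply, prod_update_apply,
    Fintype.sum_prod_type]
  refine Finset.sum_congr rfl fun i _ => Finset.sum_congr rfl fun f _ => ?_
  rw [Finset.sum_eq_single i (fun i' _ hi' => Finset.sum_eq_zero fun g _ => if_neg hi'.symm)
    (by simp)]
  exact Finset.sum_congr rfl fun g _ => by rw [if_pos rfl]; ring

variable (p q : Fin a × Fin b)

/-- The index of an entry of the output. -/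
def outputIndex (p q : Fin a × Fin b) : ℕ :=
  ((p.1 : ℕ) * b + p.2) * (a * b) + ((q.1 : ℕ) * b + q.2)

lemma pair_lt (q : Fin a × Fin b) : (q.1 : ℕ) * b + q.2 < a * b := by
  have h1 := q.1.2
  have h2 := q.2.2
  calc (q.1 : ℕ) * b + q.2 < q.1 * b + b := by omega
    _ = (q.1 + 1) * b := by ring
    _ ≤ a * b := Nat.mul_le_mul_right _ h1

lemma outputIndex_div : outputIndex p q / (a * b) = p.1 * b + p.2 := by
  have h := pair_lt q
  rw [outputIndex, add_comm, Nat.add_mul_div_right _ _ (by omega), Nat.div_eq_of_lt h, zero_add]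

lemma outputIndex_mod : outputIndex p q % (a * b) = q.1 * b + q.2 := by
  rw [outputIndex, add_comm, Nat.add_mul_mod_self_right, Nat.mod_eq_of_lt (pair_lt q)]

lemma pair_div : ((p.1 : ℕ) * b + p.2) / b = p.1 := by
  have h := p.2.2
  rw [add_comm, Nat.add_mul_div_right _ _ (by omega), Nat.div_eq_of_lt h, zero_add]

lemma pair_mod : ((p.1 : ℕ) * b + p.2) % b = p.2 := by
  rw [add_comm, Nat.add_mul_mod_self_right, Nat.mod_eq_of_lt p.2.2]

lemma outputIndex_lt : outputIndex p q < a * b * (a * b) := by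
  have h1 := pair_lt p
  have h2 := pair_lt q
  calc outputIndex p q < ((p.1 : ℕ) * b + p.2) * (a * b) + a * b := by
        rw [outputIndex]; omega
    _ = ((p.1 : ℕ) * b + p.2 + 1) * (a * b) := by ring
    _ ≤ a * b * (a * b) := Nat.mul_le_mul_right _ h1

variable {p q}

lemma Encodes.total_termA (h : Encodes x R M) (j : Fin k) (y : Fin j → Fin n) :
    total ⟨a, b, k, n, x⟩ (termA ⟨a, b, k, n, x⟩ j (finFunctionFinEquiv y) (outputIndex p q)) =
      condMap R (prefixEffects M k j y) j 1 p.1 q.1 := by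
  simp only [total_eq, termA, position_div, position_mod, digit_finFunctionFinEquiv, h.entry,
    outputIndex_div, outputIndex_mod, pair_div, Fin.val_inj, condMap_apply, condState, of_apply,
    prod_update_apply, Fintype.sum_prod_type]
  rw [Finset.sum_eq_single p.1 (fun i _ hi => Finset.sum_eq_zero fun f _ =>
    Finset.sum_eq_zero fun _ _ => Finset.sum_eq_zero fun g _ => if_neg fun hc => hi hc.1) (by simp)]
  refine Finset.sum_congr rfl fun f _ => ?_
  rw [Finset.sum_eq_single q.1 (fun i _ hi =>
    Finset.sum_eq_zero fun g _ => if_neg fun hc => hi hc.2.1) (by simp)]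
  refine Finset.sum_congr rfl fun g _ => ?_
  by_cases hfg : f j = g j
  · have h1 : (1 : Matrix (Fin b) (Fin b) ℂ) (g j) (f j) = 1 := by rw [hfg, one_apply_eq]
    rw [if_pos ⟨rfl, rfl, hfg⟩, h1, one_mul]
  · simp [hfg, one_apply_ne (Ne.symm hfg)]

lemma Encodes.total_termB (h : Encodes x R M) (j : Fin k) (y : Fin j → Fin n) :
    total ⟨a, b, k, n, x⟩ (termB ⟨a, b, k, n, x⟩ j (finFunctionFinEquiv y) (outputIndex p q)) =
      (condMap R (prefixEffects M k j y) j (single q.2 p.2 1)).trace := by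
  simp only [total_eq, termB, position_div, position_mod, digit_finFunctionFinEquiv, h.entry,
    outputIndex_div, outputIndex_mod, pair_mod, Fin.val_inj, trace_condMap, single_apply]
  refine Finset.sum_congr rfl fun f _ => Finset.sum_congr rfl fun g _ => ?_
  rw [ite_and]
  congr 1
  rw [ite_mul, one_mul, zero_mul]
  congr 1
  rw [and_comm, eq_comm (b := q.2), eq_comm (b := p.2)]

lemma Encodes.total_termP (h : Encodes x R M) (j : Fin k) (y : Fin j → Fin n) :
    total ⟨a, b, k, n, x⟩ (termP ⟨a, b, k, n, x⟩ j (finFunctionFinEquiv y)) =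
      (condMap R (prefixEffects M k j y) j 1).trace := by
  simp only [total_eq, termP, position_div, position_mod, digit_finFunctionFinEquiv, h.entry,
    Fin.val_inj, trace_condMap, one_apply]
  refine Finset.sum_congr rfl fun f _ => Finset.sum_congr rfl fun g _ => ?_
  rw [ite_and]
  congr 1
  rw [ite_mul, one_mul, zero_mul]
  congr 1
  exact propext eq_comm

lemma Encodes.output (h : Encodes x R M) (hR : R.PosSemidef) (hM : IsPOVM M) :
    output ⟨a, b, k, n, x⟩ (outputIndex p q) = averageState R M p q := by
  -- Only the real part of the normalising trace is computed; positivity of the conditional map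
  -- makes it the whole trace.
  have hreal : ∀ (j : Fin k) (y : Fin j → Fin n),
      (((condMap R (prefixEffects M k j y) j 1).trace.re : ℝ) : ℂ) =
        (condMap R (prefixEffects M k j y) j 1).trace := fun j y =>
    (PosSemidef.trace_eq_re (condMap_isPositiveMap hR
      ((isInstrument_prefixEffects R hM j j.2.le).posSemidef y) j 1 PosSemidef.one)).symm
  rw [ProgInput.output, Finset.sum_range, averageState, Matrix.smul_apply, Matrix.sum_apply,
    Finset.smul_sum]
  refine Finset.sum_congr rfl fun j _ => ?_
  rw [conditionedState, Matrix.sum_apply, Finset.smul_sum, Finset.sum_range,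
    ← finFunctionFinEquiv.sum_comp]
  refine Finset.sum_congr rfl fun y _ => ?_
  rw [outcomeTerm, h.total_termA, h.total_termB, h.total_termP, hreal]
  simp only [marginalProduct, of_apply, Complex.real_smul, Complex.ofReal_inv,
    Complex.ofReal_natCast]
  rw [div_eq_inv_mul]

end ProgInput

end Encoding

end QDF

end

noncomputable section

namespace QDF

open Matrix MeasureTheory

/-! ### The degenerate case of a one-dimensional system `B` -/

section OneDimensional

variable {A B : Type*} [Fintype A] [Fintype B] [DecidableEq B] {k n : ℕ}

/-- All the `B` systems are trivial, so their number can be changed at will. -/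
lemma IsExtension.restrict_of_unique [Unique B] {ρ : Matrix (A × B) (A × B) ℂ}
    {R : Matrix (A × (Fin k → B)) (A × (Fin k → B)) ℂ} (hk : 1 ≤ k) (h : IsExtension k ρ R)
    (l : ℕ) :
    IsExtension l ρ (R.submatrix (Prod.map id fun _ => default)
      (Prod.map id fun _ => default)) := by
  refine ⟨⟨h.1.1.submatrix _, ?_⟩, fun j => ?_⟩
  · rw [← h.1.2]
    simp [Matrix.trace, Fintype.sum_prod_type]
  · rw [← h.2 ⟨0, hk⟩]
    ext p q
    simp only [reducedTo, of_apply, Fintype.sum_unique, submatrix_apply, Prod.map, id]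
    rw [if_pos (Subsingleton.elim _ _), if_pos (Subsingleton.elim _ _)]
    congr 2
    exact Subsingleton.elim _ _

/-- On a one-dimensional system the separable approximation is the state itself. -/
lemma averageState_of_unique [Unique B] {ρ : Matrix (A × B) (A × B) ℂ}
    {R : Matrix (A × (Fin 1 → B)) (A × (Fin 1 → B)) ℂ} (h : IsExtension 1 ρ R)
    (M : Fin n → Matrix B B ℂ) : averageState R M = ρ := by
  have hF : ∀ y, prefixEffects M 1 ((0 : Fin 1) : ℕ) y = 1 := fun y => by
    ext1 i; simp [prefixEffects]
  have h1 : ∀ u v : B, single u v (1 : ℂ) = 1 := fun u v => by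
    ext i j
    simp [one_apply, Subsingleton.elim i u, Subsingleton.elim j v,
      Subsingleton.elim u v]
  have ht : (condMap R 1 0 1).trace = 1 := by
    rw [condMap_apply, ← h.1.2, ← trace_condState_one]
    congr 2
    exact Function.update_eq_self 0 (1 : Fin 1 → Matrix B B ℂ)
  rw [← h.2 0, ← pairMatrix_condMap_one]
  ext p q
  simp only [averageState, Nat.cast_one, inv_one, one_smul, Fin.sum_univ_one, conditionedState, hF,
    Finset.sum_const, marginalProduct, of_apply, pairMatrix, h1, ht]
  simp

end OneDimensional

/-! ### The complete program and its running time -/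

section Driver

/-- Sets the registers of a list to zero and then runs `c`. -/
def Prog.clearRegs (l : List ℕ) (c : Prog) : Prog :=
  l.foldr (fun i c => .seq (.setReg i (.lit 0)) c) c

lemma Prog.exists_runs_clearRegs (l : List ℕ) (c : Prog) (s : MState) :
    ∃ s₁ : MState, (∀ i ∈ l, s₁.reg i = 0) ∧ (∀ i, i ∉ l → s₁.reg i = s.reg i) ∧ s₁.arr = s.arr ∧
      ∀ t s', Runs c s₁ t s' → Runs (clearRegs l c) s (2 * l.length + t) s' := by
  induction l generalizing s with
  | nil => exact ⟨s, by simp, by simp, rfl, fun t s' h => by simpa [clearRegs] using h⟩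
  | cons i l ih =>
    obtain ⟨s₁, h1, h2, h3, h4⟩ := ih ⟨Function.update s.reg i 0, s.arr⟩
    refine ⟨s₁, fun j hj => ?_, fun j hj => ?_, h3, fun t s' h => ?_⟩
    · by_cases hjl : j ∈ l
      · exact h1 j hjl
      · have : j = i := by simpa [hjl] using hj
        subst this
        simp [h2 j hjl]
    · simp only [List.mem_cons, not_or] at hj
      simp [h2 j hj.2, hj.1]
    · have := Runs.seq (.setReg i (.lit 0) s) (h4 t s' h)
      have e : 2 * (i :: l).length + t = ((NExp.lit 0).cost s + 1) + (2 * l.length + t) := by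
        simp [NExp.cost]; ring
      rw [e]
      exact this

/-- The main program, preceded by the initialization of the registers that it uses. -/
def cleanMainProg : Prog := .clearRegs (List.range' 4 13) mainProg

/-- The memory outside the input is arbitrary, while the cost bound needs small registers. Clearing
the thirteen registers 4 to 16 takes two steps each, whence `26`. -/
lemma exists_runs_cleanMainProg {d : ProgInput} {L : ℕ} {s : MState} (hL : d.Bounded L)
    (ha : d.a ≤ L) (hb : d.b ≤ L) (hn : d.n ≤ L)
    (hr0 : s.reg 0 = d.a) (hr1 : s.reg 1 = d.b) (hr2 : s.reg 2 = d.k) (hr3 : s.reg 3 = d.n)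
    (hx : ∀ v < 4, s.arr v = d.x v) :
    ∃ t s', Runs cleanMainProg s t s' ∧ t ≤ 26 + mainProg.timeBound L ∧
      ∀ o < (d.a * d.b) * (d.a * d.b),
        s'.arr 4 o = (d.output o).re ∧ s'.arr 5 o = (d.output o).im := by
  obtain ⟨s₁, h1, h2, h3, h4⟩ := Prog.exists_runs_clearRegs (List.range' 4 13) mainProg s
  have e : ∀ i < 4, s₁.reg i = s.reg i := fun i hi => h2 i (by simp [List.mem_range'_1]; omega)
  have hs : RegsLe L s₁ := by
    intro i hi
    by_cases h : i < 4
    · rw [e i h]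
      have hk := hL.k_le
      interval_cases i <;> omega
    · rw [h1 i (by simp [List.mem_range'_1]; omega)]
      exact Nat.zero_le _
  obtain ⟨t, s', h5, h6, -, h7⟩ := ProgInput.exec_mainProg hL hs ((e 0 (by norm_num)).trans hr0)
    ((e 1 (by norm_num)).trans hr1) ((e 2 (by norm_num)).trans hr2)
    ((e 3 (by norm_num)).trans hr3) fun v hv => by rw [h3]; exact hx v hv
  exact ⟨_, s', h4 t s' h5, by simpa using h6, h7⟩

/-- The whole program. If `B` is one-dimensional then `k` is not bounded by the size of the input,
and is replaced by `1`. -/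
def deFinettiProg : Prog :=
  .seq (.cond (.ltN (.reg 1) (.lit 2)) (.setReg 2 (.lit 1)) .skip) cleanMainProg

lemma IsPOVM.pos_of_nonempty {B : Type*} [DecidableEq B] [Nonempty B] {n : ℕ}
    {M : Fin n → Matrix B B ℂ} (hM : IsPOVM M) : 1 ≤ n := by
  rcases Nat.eq_zero_or_pos n with rfl | h
  · have h := hM.2
    rw [Finset.univ_eq_empty, Finset.sum_empty] at h
    have := congrFun (congrFun h (Classical.arbitrary B)) (Classical.arbitrary B)
    simp at this
  · exact h

/-- The program halts in polynomial time; its output is separable, and is the average state or the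
given state itself. -/
theorem exists_runs_deFinettiProg : ∃ C : ℕ, ∀ (a b k n : ℕ)
    (ρ : Matrix (Fin a × Fin b) (Fin a × Fin b) ℂ)
    (R : Matrix (Fin a × (Fin k → Fin b)) (Fin a × (Fin k → Fin b)) ℂ)
    (M : Fin n → Matrix (Fin b) (Fin b) ℂ) (s : MState),
    1 ≤ k → IsExtension k ρ R → IsPOVM M → IsInput R M s →
    ∃ (t : ℕ) (s' : MState) (σ : Matrix (Fin a × Fin b) (Fin a × Fin b) ℂ),
      Runs deFinettiProg s t s' ∧ t ≤ C * (a * b ^ k * n ^ k) ^ C ∧ IsOutput σ s' ∧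
      σ ∈ SepStates (Fin a) (Fin b) ∧ (σ = ρ ∨ σ = averageState R M) := by
  obtain ⟨K, hK⟩ := Prog.exists_poly mainProg
  -- The exponent `2 * K` comes from the choice `L = X ^ 2`; `35` covers the clearing (`26`), the
  -- initial test and assignment (`8`) and the length of `b` (at most `X`).
  refine ⟨2 * K + 35, fun a b k n ρ R M s hk hR hM hs => ?_⟩
  obtain ⟨hr0, hr1, hr2, hr3, hx, hy⟩ := hs
  obtain ⟨p₀⟩ : Nonempty (Fin a × (Fin k → Fin b)) := by
    by_contra h
    rw [not_nonempty_iff] at h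
    have := hR.1.2
    simp [Matrix.trace] at this
  have ha : 1 ≤ a := by have := p₀.1.2; omega
  have hb : 1 ≤ b := by have := (p₀.2 ⟨0, hk⟩).2; omega
  have hn : 1 ≤ n := by
    have : Nonempty (Fin b) := ⟨p₀.2 ⟨0, hk⟩⟩
    exact hM.pos_of_nonempty
  set X := a * b ^ k * n ^ k with hX
  have hbk : 1 ≤ b ^ k := Nat.one_le_pow _ _ hb
  have hnk : 1 ≤ n ^ k := Nat.one_le_pow _ _ hn
  have habX : a * b ^ k ≤ X := Nat.le_mul_of_pos_right _ hnk
  have hbkX : b ^ k ≤ X := (Nat.le_mul_of_pos_left _ ha).trans habX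
  have hnkX : n ^ k ≤ X := Nat.le_mul_of_pos_left _ (Nat.mul_pos ha hbk)
  have haX : a ≤ X := (Nat.le_mul_of_pos_right _ hbk).trans habX
  have hbX : b ≤ X := (Nat.le_self_pow (by omega) b).trans hbkX
  have hnX : n ≤ X := (Nat.le_self_pow (by omega) n).trans hnkX
  have habX' : a * b ≤ X := (Nat.mul_le_mul_left a (Nat.le_self_pow (by omega) b)).trans habX
  have hX1 : 1 ≤ X := ha.trans haX
  have hXL : X ≤ X ^ 2 := Nat.le_self_pow (by norm_num) X
  -- The number of output entries is what forces the square.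
  have hout : a * b * (a * b) ≤ X ^ 2 := by rw [sq]; exact Nat.mul_le_mul habX' habX'
  have htime : ∀ t ≤ 26 + mainProg.timeBound (X ^ 2), 8 + b.size + t ≤
      (2 * K + 35) * X ^ (2 * K + 35) := by
    intro t ht
    have h1 := hK (X ^ 2) (Nat.one_le_pow _ _ hX1)
    have h2 : (X ^ 2) ^ K ≤ X ^ (2 * K + 35) := by
      rw [← pow_mul]; exact Nat.pow_le_pow_right hX1 (by omega)
    have h3 : X ≤ X ^ (2 * K + 35) := Nat.le_self_pow (by omega) X
    have h4 := Nat.mul_le_mul_left K h2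
    have h5 := size_le_self b
    have h6 : 0 ≤ K * X ^ (2 * K + 35) := Nat.zero_le _
    calc 8 + b.size + t ≤ 34 + X + K * X ^ (2 * K + 35) := by omega
      _ ≤ 35 * X ^ (2 * K + 35) + K * X ^ (2 * K + 35) := by omega
      _ ≤ (2 * K + 35) * X ^ (2 * K + 35) := by nlinarith
  have heff : ∀ (y : Fin n) (i j : Fin b),
      (⟨s.arr 2 (((y : ℕ) * b + i) * b + j), s.arr 3 (((y : ℕ) * b + i) * b + j)⟩ : ℂ) =
        M y i j := fun y i j => Complex.ext (hy y i j).1 (hy y i j).2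
  have hsz : Nat.size 2 = 2 := by decide
  rcases Nat.lt_or_ge b 2 with hb2 | hb2
  -- If also `n = 1`, then `a * b ^ k * n ^ k` does not grow with `k`, so no loop up to `k` is
  -- affordable. One copy of `B` suffices and the output is `ρ` itself.
  · obtain rfl : b = 1 := by omega
    have hR' := hR.restrict_of_unique hk 1
    set R' : Matrix (Fin a × (Fin 1 → Fin 1)) (Fin a × (Fin 1 → Fin 1)) ℂ :=
      R.submatrix (Prod.map id fun _ => default) (Prod.map id fun _ => default) with hRdef
    have henc : ProgInput.Encodes s.arr R' M := by
      refine ⟨fun p q => ?_, heff⟩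
      have h := hx (p.1, default) (q.1, default)
      simp only [position, Fin.val_eq_zero, zero_mul, Finset.sum_const_zero, one_pow] at h ⊢
      exact Complex.ext h.1 h.2
    obtain ⟨t, s', h1, h2, h3⟩ := exists_runs_cleanMainProg (d := ⟨a, 1, 1, n, s.arr⟩)
      (L := X ^ 2) (s := ⟨Function.update s.reg 2 1, s.arr⟩)
      ⟨le_rfl, hn, hX1.trans hXL, by simpa using haX.trans hXL, by simpa using hX1.trans hXL,
        by simpa using hnX.trans hXL, habX'.trans hXL, hout⟩
      (haX.trans hXL) (hbX.trans hXL) (hnX.trans hXL) (by simpa using hr0) (by simpa using hr1)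
      (by simp) (by simpa using hr3) fun v _ => rfl
    have hrun : Runs (.cond (.ltN (.reg 1) (.lit 2)) (.setReg 2 (.lit 1)) .skip) s _ _ :=
      .cond_true (by simp [Test.Holds, NExp.eval, hr1]) (.setReg 2 (.lit 1) s)
    refine ⟨_, s', averageState R' M, hrun.seq h1, ?_, fun p q => ?_,
      averageState_mem le_rfl hR'.1 hM, .inl (averageState_of_unique hR' M)⟩
    · refine le_trans (le_of_eq ?_) (htime t h2)
      simp only [Test.cost, NExp.cost, hr1, hsz, Nat.size_one]
    · have := h3 (ProgInput.outputIndex p q) (ProgInput.outputIndex_lt p q)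
      rwa [henc.output hR'.1.1 hM] at this
  · have henc : ProgInput.Encodes s.arr R M :=
      ⟨fun p q => Complex.ext (hx p q).1 (hx p q).2, heff⟩
    -- For `b ≥ 2` the loop bound `k` is at most `b ^ k`.
    have hkX : k ≤ X := (Nat.lt_pow_self hb2).le.trans hbkX
    obtain ⟨t, s', h1, h2, h3⟩ := exists_runs_cleanMainProg (d := ⟨a, b, k, n, s.arr⟩)
      (L := X ^ 2) (s := s)
      ⟨hb, hn, hkX.trans hXL, habX.trans hXL, hbkX.trans hXL, hnkX.trans hXL, habX'.trans hXL,
        hout⟩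
      (haX.trans hXL) (hbX.trans hXL) (hnX.trans hXL) hr0 hr1 hr2 hr3 fun v _ => rfl
    have hrun : Runs (.cond (.ltN (.reg 1) (.lit 2)) (.setReg 2 (.lit 1)) .skip) s _ _ :=
      .cond_false (by simp only [Test.Holds, NExp.eval, hr1]; omega) (.skip s)
    refine ⟨_, s', averageState R M, hrun.seq h1, ?_, fun p q => ?_,
      averageState_mem hk hR.1 hM, .inr rfl⟩
    · refine le_trans ?_ (htime t h2)
      simp only [Test.cost, NExp.cost, hr1, hsz]
      omega
    · have := h3 (ProgInput.outputIndex p q) (ProgInput.outputIndex_lt p q)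
      rwa [henc.output hR.1.1 hM] at this

lemma mapTensor_zero {A A' B B' : Type*} (E : Matrix A A ℂ →ₗ[ℂ] Matrix A' A' ℂ)
    (L : Matrix B B ℂ →ₗ[ℂ] Matrix B' B' ℂ) : mapTensor E L 0 = 0 := by
  have h1 : mapFst (B := B) E 0 = 0 := by
    ext p q
    exact congrFun (congrFun (map_zero E) _) _
  rw [mapTensor, h1]
  ext p q
  exact congrFun (congrFun (map_zero L) _) _

end Driver

end QDF

end

open QDF MeasureTheory in
theorem theorem1 :
    -- Part 1
    (∀ (A B A' Ω : Type*) [Fintype A] [Fintype B] [DecidableEq B] [Fintype A'] [DecidableEq A']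
      [MeasurableSpace Ω] (k : ℕ) (ρ : Matrix (A × B) (A × B) ℂ)
      (μ : Measure Ω) (E : Ω → Matrix A A ℂ →ₗ[ℂ] Matrix A' A' ℂ),
      1 ≤ k → IsExtendible k ρ → IsProbabilityMeasure μ → (∀ m, IsChannel (E m)) →
      (∀ X i j, Measurable fun m => E m X i j) →
      ∃ σ ∈ SepStates A B, ∀ (Y : Type*) [Fintype Y] [DecidableEq Y] (M : Y → Matrix B B ℂ), IsPOVM M →
        Integrable (fun m => traceNorm (mapTensor (E m) (measMap M) (ρ - σ))) μ ∧
        ∫ m, traceNorm (mapTensor (E m) (measMap M) (ρ - σ)) ∂μ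
          ≤ √(2 * Real.log (Fintype.card A') / k)) ∧
    -- Part 2
    (∃ (c : Prog) (C : ℕ), ∀ (a b k n : ℕ)
      (ρ : Matrix (Fin a × Fin b) (Fin a × Fin b) ℂ)
      (R : Matrix (Fin a × (Fin k → Fin b)) (Fin a × (Fin k → Fin b)) ℂ)
      (M : Fin n → Matrix (Fin b) (Fin b) ℂ) (s : MState),
      1 ≤ k → IsExtension k ρ R → IsPOVM M → IsInput R M s →
      ∃ (t : ℕ) (s' : MState) (σ : Matrix (Fin a × Fin b) (Fin a × Fin b) ℂ),
        Runs c s t s' ∧ t ≤ C * (a * b ^ k * n ^ k) ^ C ∧ IsOutput σ s' ∧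
        σ ∈ SepStates (Fin a) (Fin b) ∧
        ∀ (A' Ω : Type*) [Fintype A'] [DecidableEq A'] [MeasurableSpace Ω]
          (μ : Measure Ω) (E : Ω → Matrix (Fin a) (Fin a) ℂ →ₗ[ℂ] Matrix A' A' ℂ),
          IsProbabilityMeasure μ → (∀ m, IsChannel (E m)) →
          (∀ X i j, Measurable fun m => E m X i j) →
          Integrable (fun m => traceNorm (mapTensor (E m) (measMap M) (ρ - σ))) μ ∧
          ∫ m, traceNorm (mapTensor (E m) (measMap M) (ρ - σ)) ∂μ
            ≤ √(2 * Real.log (Fintype.card A') / k)) ∧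
    -- Part 3
    (∀ (X Y A B : Type*) [Fintype X] [Fintype Y] [DecidableEq Y] [Fintype A] [Fintype B]
      [Nonempty B] (k : ℕ) (p : X × Y → A × B → ℝ) (μ : A → ℝ),
      1 ≤ k → IsNSExtendible k p → (∀ a, 0 ≤ μ a) → ∑ a, μ a = 1 →
      ∃ q : X × Y → A × B → ℝ, IsLHV q ∧ ∀ b : B,
        ∑ a, μ a * ∑ x, ∑ y, |p (x, y) (a, b) - q (x, y) (a, b)|
          ≤ √(2 * Real.log (Fintype.card X) / k)) := by
  refine ⟨?_, ?_, ?_⟩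
  · intro A B A' Ω _ _ _ _ _ _ k ρ μ E hk hρ hμ hE hEm
    exact exists_sepState_forall_measurement hk hρ hE hEm
  · obtain ⟨C, hC⟩ := exists_runs_deFinettiProg
    refine ⟨deFinettiProg, C, fun a b k n ρ R M s hk hR hM hs => ?_⟩
    obtain ⟨t, s', σ, hrun, ht, hout, hsep, hσ⟩ := hC a b k n ρ R M s hk hR hM hs
    refine ⟨t, s', σ, hrun, ht, hout, hsep, ?_⟩
    intro A' Ω _ _ _ μ E hμ hE hEm
    rcases hσ with rfl | rfl
    · simp only [sub_self, mapTensor_zero, traceNorm_zero, integral_zero]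
      exact ⟨integrable_zero _ _ _, Real.sqrt_nonneg _⟩
    · exact averageState_spec hk hR hM hE hEm
  · intro X Y A B _ _ _ _ _ _ k p μ hk hp hμ hμ1
    exact exists_isLHV_of_isNSExtendible hk hp hμ hμ1
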